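/- Let $m\ge 0$ and let $M$ be a smooth (Hausdorff) manifold of dimension $2m+1$. A CR structure on $M$ is a pair $(H(M),J)$, where $H(M)\subset TM$ is a smooth subbundle of rank $2m$ and $J$ is a smooth bundle endomorphism of $H(M)$ with $J^2=-1$, such that the sections of $\{X-iJX : X\in H(M)\}\subset TM\otimes\mathbb C$ are closed under the Lie bracket. Let $(M,H(M),J,\theta)$ be a pseudo-Hermitian manifold: $\theta$ is a nowhere vanishing smooth $1$-form on $M$ with $\theta|_{H(M)}=0$ such that the Levi form $L_\theta(X,Y)=d\theta(X,JY)$ is positive definite on $H(M)$, where $d\theta(X,Y)=X\theta(Y)-Y\theta(X)-\theta([X,Y])$. Let $\xi$ be the Reeb vector field ($\theta(\xi)=1$, $d\theta(\xi,\cdot)=0$), extend $J$ by $J\xi=0$, let $\pi_H:TM\to H(M)$ be the projection along $\xi$, and let $g_\theta(X,Y)=\theta(X)\theta(Y)+L_\theta(\pi_HX,\pi_HY)$ be the Webster metric. Let $\nabla$ be the Tanaka–Webster connection, i.e. the smooth linear connection which preserves $H(M)$, satisfies $\nabla g_\theta=0$ and $\nabla J=0$, and whose torsion satisfies $T_\nabla(X,Y)=d\theta(X,Y)\xi$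 and $T_\nabla(\xi,JX)+JT_\nabla(\xi,X)=0$ for all $X,Y\in H(M)$. A $\nabla$-geodesic is a $C^1$ curve $\gamma$ with $\nabla_{\gamma'}\gamma'=0$. A broken $\nabla$-geodesic is a continuous curve $c:[a,b]\to M$ for which there are $a=t_0<t_1<\dots<t_n=b$ with $n\ge1$ such that each $c|_{[t_{i},t_{i+1}]}$ is a $\nabla$-geodesic. For $p,q\in M$ let $\delta(p,q)\in[0,\infty]$ be the infimum of the $g_\theta$-lengths of the broken $\nabla$-geodesics joining $p$ to $q$ (it is $\infty$ if there are none; $\delta$ is finite if $M$ is connected). A linear connection is called complete if each of its geodesics $[0,l]\to M$ extends to a geodesic $\mathbb R\to M$. (1) If $(M,\delta)$ is complete (every $\delta$-Cauchy sequence $\delta$-converges), then $(M,\nabla)$ is complete, and $\exp^\nabla$ is defined on all of $TM$, i.e. for every $p\in M$ and $v\in T_pM$ there is a $\nabla$-geodesic $\gamma:[0,1]\to M$ with $\gamma(0)=p$, $\gamma'(0)=v$. (2) If the Levi-Civita connection of $g_\theta$ is complete, then $(M,\nabla)$ is complete. -/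

import Mathlib

open Set Filter MeasureTheory Bundle Module
open scoped Topology Manifold ContDiff ENNReal

noncomputable section

/-! ## One-forms and the exterior derivative of a one-form -/

section OneForm

variable {E : Type*} [NormedAddCommGroup E] [NormedSpace ℝ E]
  {H : Type*} [TopologicalSpace H] (I : ModelWithCorners ℝ E H)
  (M : Type*) [TopologicalSpace M] [ChartedSpace H M]

/-- A smooth (real) one-form on `M`, i.e. a smooth section of `T*M`. -/
structure SmoothOneForm [IsManifold I ∞ M] where
  toFun : ∀ x : M, TangentSpace I x →L[ℝ] ℝ
  smooth : ContMDiff I (I.prod 𝓘(ℝ, E →L[ℝ] ℝ)) ∞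
    (fun x : M ↦ TotalSpace.mk' (E →L[ℝ] ℝ) (E := fun x : M ↦ TangentSpace I x →L[ℝ] ℝ) x (toFun x))

namespace SmoothOneForm

variable {I M} [IsManifold I ∞ M]

/-- The expression `X(θ(Y)) - Y(θ(X)) - θ([X, Y])`, for vector fields `X`, `Y`. -/
def dField (θ : SmoothOneForm I M) (X Y : Π x : M, TangentSpace I x) (x : M) : ℝ :=
  mvfderiv I (fun y ↦ θ.toFun y (Y y)) x (X x) - mvfderiv I (fun y ↦ θ.toFun y (X y)) x (Y x)
    - θ.toFun x (VectorField.mlieBracket I X Y x)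

theorem mdiffAt_apply (θ : SmoothOneForm I M) {X : Π x : M, TangentSpace I x} {x : M}
    (hX : MDiffAt (T% X) x) : MDiffAt (fun y ↦ θ.toFun y (X y)) x := by
  have h1 := (θ.smooth x).mdifferentiableAt (by simp)
  have h2 := MDifferentiableAt.clm_bundle_apply (F₁ := E) (F₂ := ℝ)
    (E₁ := fun x : M ↦ TangentSpace I x) (E₂ := Bundle.Trivial M ℝ) h1 hX
  rw [mdifferentiableAt_section] at h2
  exact h2

theorem dField_swap (θ : SmoothOneForm I M) (X Y : Π x : M, TangentSpace I x) (x : M) :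
    θ.dField X Y x = - θ.dField Y X x := by
  simp only [dField]
  rw [VectorField.mlieBracket_swap_apply]
  simp
  ring

variable [FiniteDimensional ℝ E]

theorem dField_tensorial_left (θ : SmoothOneForm I M) (x : M) (Y : Π x : M, TangentSpace I x) :
    TensorialAt I E (fun X ↦ θ.dField X Y x) x where
  smul {f X} hf hX := by
    have e : (fun y ↦ θ.toFun y ((f • X) y)) = fun y ↦ f y * θ.toFun y (X y) := by
      ext y; simp
    simp only [dField]
    rw [e, mvfderiv_fun_mul hf (θ.mdiffAt_apply hX), VectorField.mlieBracket_smul_left hf hX]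
    simp
    ring
  add {X X'} hX hX' := by
    have e : (fun y ↦ θ.toFun y ((X + X') y)) =
        fun y ↦ θ.toFun y (X y) + θ.toFun y (X' y) := by
      ext y; simp
    simp only [dField]
    rw [e, mvfderiv_fun_add (θ.mdiffAt_apply hX) (θ.mdiffAt_apply hX'),
      VectorField.mlieBracket_add_left hX hX']
    simp
    ring

theorem dField_tensorial_right (θ : SmoothOneForm I M) (x : M) (X : Π x : M, TangentSpace I x) :
    TensorialAt I E (fun Y ↦ θ.dField X Y x) x where
  smul {f Y} hf hY := by
    rw [dField_swap, dField_swap θ X Y, (θ.dField_tensorial_left x X).smul hf hY]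
    simp
  add {Y Y'} hY hY' := by
    rw [dField_swap, dField_swap θ X Y, dField_swap θ X Y',
      (θ.dField_tensorial_left x X).add hY hY']
    ring

/-- The exterior derivative `dθ`, a bilinear form on each tangent space; it is characterized by
`dθ(X, Y) = X(θ(Y)) - Y(θ(X)) - θ([X, Y])`, see `SmoothOneForm.d_apply`. -/
def d (θ : SmoothOneForm I M) (x : M) : TangentSpace I x →L[ℝ] TangentSpace I x →L[ℝ] ℝ :=
  TensorialAt.mkHom₂ (fun X Y ↦ θ.dField X Y x) x
    (fun Y _ ↦ θ.dField_tensorial_left x Y) (fun X _ ↦ θ.dField_tensorial_right x X)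

theorem d_apply (θ : SmoothOneForm I M) {x : M} {X Y : Π x : M, TangentSpace I x}
    (hX : MDiffAt (T% X) x) (hY : MDiffAt (T% Y) x) :
    θ.d x (X x) (Y x) = mvfderiv I (fun y ↦ θ.toFun y (Y y)) x (X x)
      - mvfderiv I (fun y ↦ θ.toFun y (X y)) x (Y x)
      - θ.toFun x (VectorField.mlieBracket I X Y x) :=
  TensorialAt.mkHom₂_apply _ _ hX hY

theorem d_swap (θ : SmoothOneForm I M) (x : M) (v w : TangentSpace I x) :
    θ.d x v w = - θ.d x w v := by
  simp only [d, TensorialAt.mkHom₂_apply_eq_extend]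
  exact θ.dField_swap _ _ x

end SmoothOneForm

end OneForm

/-! ## Geodesics of a linear connection -/

section Geodesics

variable {E : Type*} [NormedAddCommGroup E] [NormedSpace ℝ E]
  {H : Type*} [TopologicalSpace H] {I : ModelWithCorners ℝ E H}
  {M : Type*} [TopologicalSpace M] [ChartedSpace H M] [IsManifold I ∞ M]

variable (I) in
/-- The velocity vector `γ'(t) ∈ T_{γ(t)}M` of a curve `γ` considered on the set `s ⊆ ℝ`
(one-sided at the endpoints of `s` if `s` is an interval). -/
def curveVelocity (γ : ℝ → M) (s : Set ℝ) (t : ℝ) : TangentSpace I (γ t) :=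
  mfderivWithin 𝓘(ℝ, ℝ) I γ s t (1 : ℝ)

/-- `HasCovDerivAlong cov γ V s t w` says that the vector field `V` along the curve `γ` (both
considered on `s`) is differentiable at `t` with covariant derivative `∇_{γ'} V (t) = w`.

In the coordinate frame `(eᵢ)` of the chart at `γ t` write `V = ∑ Vⁱ eᵢ(γ)`; then
`∇_{γ'} V (t) = ∑ (Vⁱ)'(t) eᵢ + ∑ Vⁱ(t) ∇_{γ'(t)} eᵢ`. The second sum is the covariant derivative in
the direction `γ'(t)` of the vector field with constant coefficients `Vⁱ(t)` in this frame, which is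
`FiberBundle.extend E (V t)`. -/
def HasCovDerivAlong (cov : CovariantDerivative I E (fun x : M ↦ TangentSpace I x))
    (γ : ℝ → M) (V : ∀ t, TangentSpace I (γ t)) (s : Set ℝ) (t : ℝ)
    (w : TangentSpace I (γ t)) : Prop :=
  let coord (u : ℝ) (v : TangentSpace I (γ u)) : E :=
    (trivializationAt E (fun x : M ↦ TangentSpace I x) (γ t) ⟨γ u, v⟩).2
  HasDerivWithinAt (fun u ↦ coord u (V u))
    (coord t (w - cov (FiberBundle.extend E (V t)) (γ t) (curveVelocity I γ s t))) s t

/-- `γ` is a geodesic of the linear connection on the interval `s`: it is a `C¹` curve whose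
velocity is differentiable with `∇_{γ'} γ' = 0`. -/
def IsGeodesicOn (cov : CovariantDerivative I E (fun x : M ↦ TangentSpace I x))
    (γ : ℝ → M) (s : Set ℝ) : Prop :=
  ContMDiffOn 𝓘(ℝ, ℝ) I 1 γ s ∧
    ∀ t ∈ s, HasCovDerivAlong cov γ (fun u ↦ curveVelocity I γ s u) s t 0

/-- The connection is complete: every geodesic `[0, l] → M` extends to a geodesic `ℝ → M`. -/
def GeodesicallyComplete (cov : CovariantDerivative I E (fun x : M ↦ TangentSpace I x)) : Prop :=
  ∀ (γ : ℝ → M) (l : ℝ), 0 < l → IsGeodesicOn cov γ (Icc 0 l) →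
    ∃ η : ℝ → M, IsGeodesicOn cov η univ ∧ EqOn η γ (Icc 0 l)

/-- The exponential map of a linear connection as a partial map `TM → M`: it is defined at
`v ∈ T_pM` if there is a geodesic `γ` on `[0, 1]` with `γ 0 = p` and `γ' 0 = v`, and its value is then
`γ 1`. (The two initial conditions are one equation in the tangent bundle.) -/
def geodesicExp (cov : CovariantDerivative I E (fun x : M ↦ TangentSpace I x)) :
    TangentBundle I M →. M := fun v ↦
  ⟨∃ γ : ℝ → M, IsGeodesicOn cov γ (Icc 0 1) ∧
      (⟨γ 0, curveVelocity I γ (Icc 0 1) 0⟩ : TangentBundle I M) = v,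
    fun h ↦ h.choose 1⟩

/-- `c : [a, b] → M` is a broken geodesic: it is continuous, and there is a subdivision
`a = t₀ < t₁ < ⋯ < t_{n+1} = b` such that `c` is a geodesic on each `[tᵢ, tᵢ₊₁]`. -/
def IsBrokenGeodesic (cov : CovariantDerivative I E (fun x : M ↦ TangentSpace I x))
    (c : ℝ → M) (a b : ℝ) : Prop :=
  ContinuousOn c (Icc a b) ∧
    ∃ (n : ℕ) (t : Fin (n + 2) → ℝ), StrictMono t ∧ t 0 = a ∧ t (Fin.last (n + 1)) = b ∧
      ∀ i : Fin (n + 1), IsGeodesicOn cov c (Icc (t i.castSucc) (t i.succ))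

/-- The length of a curve `c` on `[a, b]` with respect to a field `g` of inner products. (The
velocity at the finitely many break points does not matter.) -/
def curveLength (g : ∀ x : M, TangentSpace I x → TangentSpace I x → ℝ)
    (c : ℝ → M) (a b : ℝ) : ℝ≥0∞ :=
  ∫⁻ t in Icc a b, ENNReal.ofReal
    (Real.sqrt (g (c t) (curveVelocity I c univ t) (curveVelocity I c univ t)))

/-- The infimum of the lengths of the broken geodesics from `p` to `q` (it is `∞` if there are
none). -/
def brokenGeodesicDist (g : ∀ x : M, TangentSpace I x → TangentSpace I x → ℝ)
    (cov : CovariantDerivative I E (fun x : M ↦ TangentSpace I x)) (p q : M) : ℝ≥0∞ :=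
  ⨅ (c : ℝ → M) (a : ℝ) (b : ℝ) (_ : IsBrokenGeodesic cov c a b) (_ : c a = p) (_ : c b = q),
    curveLength g c a b

/-- Completeness of a set with respect to a distance function: every Cauchy sequence converges. -/
def IsCompleteDist {X : Type*} (δ : X → X → ℝ≥0∞) : Prop :=
  ∀ u : ℕ → X, (∀ ε : ℝ≥0∞, 0 < ε → ∃ N, ∀ i ≥ N, ∀ j ≥ N, δ (u i) (u j) < ε) →
    ∃ q : X, Tendsto (fun i ↦ δ (u i) q) atTop (𝓝 0)

end Geodesics

/-! ## Pseudo-Hermitian manifolds -/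

section PseudoHermitian

/-- The vector field `X` is smooth on `U`. -/
def IsSmoothFieldOn {m : ℕ} {M : Type*} [TopologicalSpace M]
    [ChartedSpace (EuclideanSpace ℝ (Fin (2 * m + 1))) M] [IsManifold (𝓡 (2 * m + 1)) ∞ M]
    (U : Set M) (X : Π x : M, TangentSpace (𝓡 (2 * m + 1)) x) : Prop :=
  ContMDiffOn (𝓡 (2 * m + 1)) (𝓡 (2 * m + 1)).tangent ∞
    (fun x ↦ (⟨x, X x⟩ : TangentBundle (𝓡 (2 * m + 1)) M)) U

/-- A CR structure of real dimension `2m + 1` on `M`, given as the pair `(H(M), J)`: a smooth real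
subbundle `hor = H(M)` of rank `2m` of `TM` with a smooth complex structure `J` on it. The
integrability condition says that the sections of `H^{1,0} = {X - iJX : X ∈ H(M)}` are closed under
brackets: `[X - iJX, Y - iJY] = ([X, Y] - [JX, JY]) - i ([X, JY] + [JX, Y])` has to be of the form
`A - iJA` with `A` in `H(M)`. -/
structure CRStructure (m : ℕ) (M : Type*) [TopologicalSpace M]
    [ChartedSpace (EuclideanSpace ℝ (Fin (2 * m + 1))) M] [IsManifold (𝓡 (2 * m + 1)) ∞ M] where
  hor : ∀ x : M, Submodule ℝ (TangentSpace (𝓡 (2 * m + 1)) x)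
  exists_frame : ∀ x : M, ∃ U : Set M, IsOpen U ∧ x ∈ U ∧
    ∃ e : Fin (2 * m) → Π y : M, TangentSpace (𝓡 (2 * m + 1)) y,
      (∀ i, IsSmoothFieldOn U (e i)) ∧
      ∀ y ∈ U, LinearIndependent ℝ (fun i ↦ e i y) ∧
        Submodule.span ℝ (Set.range fun i ↦ e i y) = hor y
  J : ∀ x : M, hor x →ₗ[ℝ] hor x
  J_smooth : ∀ X : Π x : M, hor x,
    IsSmoothFieldOn univ ((fun x : M ↦ (X x : TangentSpace (𝓡 (2 * m + 1)) x))) →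
    IsSmoothFieldOn univ ((fun x : M ↦ (J x (X x) : TangentSpace (𝓡 (2 * m + 1)) x)))
  J_sq : ∀ (x : M) (v : hor x), J x (J x v) = -v
  integrable : ∀ X Y : Π x : M, hor x,
    IsSmoothFieldOn univ ((fun x : M ↦ (X x : TangentSpace (𝓡 (2 * m + 1)) x))) →
    IsSmoothFieldOn univ ((fun x : M ↦ (Y x : TangentSpace (𝓡 (2 * m + 1)) x))) →
    ∀ x : M, ∃ A : hor x,
      (A : TangentSpace (𝓡 (2 * m + 1)) x) =
        VectorField.mlieBracket (𝓡 (2 * m + 1)) (fun y ↦ (X y : TangentSpace (𝓡 (2 * m + 1)) y))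
          (fun y ↦ (Y y : TangentSpace (𝓡 (2 * m + 1)) y)) x
        - VectorField.mlieBracket (𝓡 (2 * m + 1))
          (fun y ↦ (J y (X y) : TangentSpace (𝓡 (2 * m + 1)) y))
          (fun y ↦ (J y (Y y) : TangentSpace (𝓡 (2 * m + 1)) y)) x ∧
      (J x A : TangentSpace (𝓡 (2 * m + 1)) x) =
        VectorField.mlieBracket (𝓡 (2 * m + 1)) (fun y ↦ (X y : TangentSpace (𝓡 (2 * m + 1)) y))
          (fun y ↦ (J y (Y y) : TangentSpace (𝓡 (2 * m + 1)) y)) x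
        + VectorField.mlieBracket (𝓡 (2 * m + 1))
          (fun y ↦ (J y (X y) : TangentSpace (𝓡 (2 * m + 1)) y))
          (fun y ↦ (Y y : TangentSpace (𝓡 (2 * m + 1)) y)) x

/-- A pseudo-Hermitian manifold `(M, H(M), J, θ)`: a CR structure with a nowhere vanishing one-form
`θ` annihilating `H(M)` whose Levi form `L_θ(X, Y) = dθ(X, JY)` on `H(M)` is positive definite. -/
structure PseudoHermitian (m : ℕ) (M : Type*) [TopologicalSpace M]
    [ChartedSpace (EuclideanSpace ℝ (Fin (2 * m + 1))) M] [IsManifold (𝓡 (2 * m + 1)) ∞ M]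
    extends CRStructure m M where
  θ : SmoothOneForm (𝓡 (2 * m + 1)) M
  θ_ne_zero : ∀ x : M, θ.toFun x ≠ 0
  θ_hor : ∀ (x : M) (v : hor x), θ.toFun x v = 0
  levi_pos : ∀ (x : M) (v : hor x), v ≠ 0 → 0 < θ.d x v (J x v)

namespace PseudoHermitian

variable {m : ℕ} {M : Type*} [TopologicalSpace M]
  [ChartedSpace (EuclideanSpace ℝ (Fin (2 * m + 1))) M] [IsManifold (𝓡 (2 * m + 1)) ∞ M]

/-- The Levi form `L_θ(X, Y) = dθ(X, JY)` on `H(M)`. -/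
def levi (P : PseudoHermitian m M) (x : M) (v w : P.hor x) : ℝ := P.θ.d x v (P.J x w)

theorem finrank_hor (P : PseudoHermitian m M) (x : M) : finrank ℝ (P.hor x) = 2 * m := by
  obtain ⟨U, -, hxU, e, -, he⟩ := P.exists_frame x
  obtain ⟨hli, hspan⟩ := he x hxU
  rw [← hspan, finrank_span_eq_card hli, Fintype.card_fin]

/-- `H(M)` is the kernel of `θ`. -/
theorem ker_θ (P : PseudoHermitian m M) (x : M) :
    LinearMap.ker (P.θ.toFun x : TangentSpace (𝓡 (2 * m + 1)) x →ₗ[ℝ] ℝ) = P.hor x := by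
  have : FiniteDimensional ℝ (TangentSpace (𝓡 (2 * m + 1)) x) :=
    inferInstanceAs (FiniteDimensional ℝ (EuclideanSpace ℝ (Fin (2 * m + 1))))
  have hdim : finrank ℝ (TangentSpace (𝓡 (2 * m + 1)) x) = 2 * m + 1 :=
    finrank_euclideanSpace_fin (𝕜 := ℝ) (n := 2 * m + 1)
  refine (Submodule.eq_of_le_of_finrank_le (fun v hv ↦ P.θ_hor x ⟨v, hv⟩) ?_).symm
  have hne : (P.θ.toFun x : TangentSpace (𝓡 (2 * m + 1)) x →ₗ[ℝ] ℝ) ≠ 0 := fun h ↦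
    P.θ_ne_zero x (ContinuousLinearMap.coe_injective h)
  have := Module.Dual.finrank_ker_add_one_of_ne_zero (f := (P.θ.toFun x :
    TangentSpace (𝓡 (2 * m + 1)) x →ₗ[ℝ] ℝ)) hne
  rw [P.finrank_hor x]
  omega

theorem exists_reeb (P : PseudoHermitian m M) (x : M) :
    ∃! v : TangentSpace (𝓡 (2 * m + 1)) x, P.θ.toFun x v = 1 ∧ ∀ w, P.θ.d x v w = 0 := by
  have : FiniteDimensional ℝ (TangentSpace (𝓡 (2 * m + 1)) x) :=
    inferInstanceAs (FiniteDimensional ℝ (EuclideanSpace ℝ (Fin (2 * m + 1))))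
  have hmem : ∀ v : TangentSpace (𝓡 (2 * m + 1)) x, P.θ.toFun x v = 0 → v ∈ P.hor x := by
    intro v hv
    rw [← P.ker_θ x]
    exact hv
  have hself : ∀ v, P.θ.d x v v = 0 := fun v ↦ by
    have := P.θ.d_swap x v v
    linarith
  obtain ⟨u₀, hu₀⟩ : ∃ u, P.θ.toFun x u ≠ 0 := by
    by_contra! h
    exact P.θ_ne_zero x (ContinuousLinearMap.ext h)
  set u := (P.θ.toFun x u₀)⁻¹ • u₀ with hu
  have hu1 : P.θ.toFun x u = 1 := by simp [hu, hu₀]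
  -- the restriction of `dθ` to `H` is nondegenerate
  let B : P.hor x →ₗ[ℝ] Module.Dual ℝ (P.hor x) :=
    { toFun := fun v ↦ ((P.θ.d x v : TangentSpace (𝓡 (2 * m + 1)) x →ₗ[ℝ] ℝ)) ∘ₗ (P.hor x).subtype
      map_add' := fun v w ↦ by ext; simp
      map_smul' := fun c v ↦ by ext; simp }
  have hB : Function.Injective B := by
    rw [injective_iff_map_eq_zero]
    intro v hv
    by_contra hne
    have h1 := P.levi_pos x v hne
    have h2 : B v (P.J x v) = 0 := by rw [hv]; rfl
    exact h1.ne' h2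
  have hsurj : Function.Surjective B :=
    (LinearMap.injective_iff_surjective_of_finrank_eq_finrank
      (Subspace.dual_finrank_eq (K := ℝ) (V := P.hor x)).symm).1 hB
  obtain ⟨h, hh⟩ := hsurj (((P.θ.d x u : TangentSpace (𝓡 (2 * m + 1)) x →ₗ[ℝ] ℝ)) ∘ₗ
    (P.hor x).subtype)
  have hhw : ∀ w : P.hor x, P.θ.d x h w = P.θ.d x u w := fun w ↦ congrArg (fun f ↦ f w) hh
  have h0 : P.θ.toFun x h = 0 := P.θ_hor x h
  have hv1 : P.θ.toFun x (u - h) = 1 := by rw [map_sub, hu1, h0, sub_zero]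
  refine ⟨u - h, ⟨hv1, fun w ↦ ?_⟩, ?_⟩
  · have hw : w - P.θ.toFun x w • (u - (h : TangentSpace (𝓡 (2 * m + 1)) x)) ∈ P.hor x := by
      apply hmem
      rw [map_sub, map_smul, hv1]
      simp
    have e1 := hhw ⟨_, hw⟩
    have e2 := hself (u - (h : TangentSpace (𝓡 (2 * m + 1)) x))
    have e3 : P.θ.d x (u - h) (w - P.θ.toFun x w • (u - (h : TangentSpace (𝓡 (2 * m + 1)) x))) = 0 := by
      rw [map_sub (P.θ.d x) u, sub_apply]
      exact sub_eq_zero.2 e1.symm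
    rw [map_sub (P.θ.d x (u - h)), map_smul, e2] at e3
    simpa using e3
  · rintro v ⟨hv, hvd⟩
    have hk : v - (u - (h : TangentSpace (𝓡 (2 * m + 1)) x)) ∈ P.hor x := by
      apply hmem
      rw [map_sub, hv, hv1, sub_self]
    by_contra hne
    have hpos := P.levi_pos x ⟨_, hk⟩ (fun h0 ↦ hne (sub_eq_zero.1 (congrArg Subtype.val h0)))
    have hz : ∀ w : P.hor x, P.θ.d x (u - h) w = 0 := fun w ↦ by
      rw [map_sub, sub_apply, hhw w, sub_self]
    refine hpos.ne' ?_
    rw [map_sub, sub_apply, hvd, hz, sub_zero]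

/-- The Reeb vector field `ξ`: the unique vector field with `θ(ξ) = 1` and `dθ(ξ, ·) = 0`. -/
def reeb (P : PseudoHermitian m M) (x : M) : TangentSpace (𝓡 (2 * m + 1)) x :=
  (P.exists_reeb x).choose

theorem θ_reeb (P : PseudoHermitian m M) (x : M) : P.θ.toFun x (P.reeb x) = 1 :=
  (P.exists_reeb x).choose_spec.1.1

theorem d_reeb (P : PseudoHermitian m M) (x : M) (w : TangentSpace (𝓡 (2 * m + 1)) x) :
    P.θ.d x (P.reeb x) w = 0 :=
  (P.exists_reeb x).choose_spec.1.2 w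

/-- The projection `π_H : TM → H(M)` along `ξ`, i.e. `π_H v = v - θ(v) ξ`. -/
def projHor (P : PseudoHermitian m M) (x : M) :
    TangentSpace (𝓡 (2 * m + 1)) x →ₗ[ℝ] P.hor x :=
  LinearMap.codRestrict (P.hor x)
    (LinearMap.id - (P.θ.toFun x : TangentSpace (𝓡 (2 * m + 1)) x →ₗ[ℝ] ℝ).smulRight (P.reeb x))
    (fun v ↦ by
      rw [← P.ker_θ x]
      simp [P.θ_reeb x])

/-- The extension of `J` to an endomorphism of `TM` with `J ξ = 0`. -/
def Jfull (P : PseudoHermitian m M) (x : M) :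
    TangentSpace (𝓡 (2 * m + 1)) x →ₗ[ℝ] TangentSpace (𝓡 (2 * m + 1)) x :=
  (P.hor x).subtype ∘ₗ P.J x ∘ₗ P.projHor x

/-- The Webster metric `g_θ = θ ⊗ θ + G_θ`, where `G_θ(X, Y) = L_θ(π_H X, π_H Y)`. -/
def webster (P : PseudoHermitian m M) (x : M) (v w : TangentSpace (𝓡 (2 * m + 1)) x) : ℝ :=
  P.θ.toFun x v * P.θ.toFun x w + P.levi x (P.projHor x v) (P.projHor x w)

/-- `∇ g_θ = 0`, i.e. `Z(g_θ(X, Y)) = g_θ(∇_Z X, Y) + g_θ(X, ∇_Z Y)`. (In Mathlib's notation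
`cov X x v` is `∇_v X` at `x`.) -/
def IsMetric (P : PseudoHermitian m M)
    (cov : CovariantDerivative (𝓡 (2 * m + 1)) (EuclideanSpace ℝ (Fin (2 * m + 1)))
      (fun x : M ↦ TangentSpace (𝓡 (2 * m + 1)) x)) : Prop :=
  ∀ X Y : Π x : M, TangentSpace (𝓡 (2 * m + 1)) x, IsSmoothFieldOn univ X → IsSmoothFieldOn univ Y →
    ∀ (x : M) (v : TangentSpace (𝓡 (2 * m + 1)) x),
      mvfderiv (𝓡 (2 * m + 1)) (fun y ↦ P.webster y (X y) (Y y)) x v =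
        P.webster x (cov X x v) (Y x) + P.webster x (X x) (cov Y x v)

/-- The Tanaka-Webster connection: the smooth linear connection that preserves `H(M)`, `g_θ` and `J`
and has pure torsion. -/
structure IsTanakaWebster (P : PseudoHermitian m M)
    (cov : CovariantDerivative (𝓡 (2 * m + 1)) (EuclideanSpace ℝ (Fin (2 * m + 1)))
      (fun x : M ↦ TangentSpace (𝓡 (2 * m + 1)) x)) : Prop where
  smooth : cov.ContMDiffCovariantDerivative ∞
  preserves_hor : ∀ X : Π x : M, P.hor x,
    IsSmoothFieldOn univ ((fun x : M ↦ (X x : TangentSpace (𝓡 (2 * m + 1)) x))) →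
    ∀ (x : M) (v : TangentSpace (𝓡 (2 * m + 1)) x),
      cov (fun y ↦ (X y : TangentSpace (𝓡 (2 * m + 1)) y)) x v ∈ P.hor x
  metric : P.IsMetric cov
  parallel_J : ∀ X : Π x : M, TangentSpace (𝓡 (2 * m + 1)) x, IsSmoothFieldOn univ X →
    ∀ (x : M) (v : TangentSpace (𝓡 (2 * m + 1)) x),
      cov (fun y ↦ P.Jfull y (X y)) x v = P.Jfull x (cov X x v)
  torsion_hor : ∀ (x : M) (v w : P.hor x), cov.torsion x v w = P.θ.d x v w • P.reeb x
  torsion_reeb : ∀ (x : M) (v : P.hor x),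
    cov.torsion x (P.reeb x) (P.J x v) + P.Jfull x (cov.torsion x (P.reeb x) v) = 0

/-- The Levi-Civita connection of the Webster metric: the smooth linear connection that is metric and
torsion-free. -/
structure IsLeviCivita (P : PseudoHermitian m M)
    (cov : CovariantDerivative (𝓡 (2 * m + 1)) (EuclideanSpace ℝ (Fin (2 * m + 1)))
      (fun x : M ↦ TangentSpace (𝓡 (2 * m + 1)) x)) : Prop where
  smooth : cov.ContMDiffCovariantDerivative ∞
  metric : P.IsMetric cov
  torsion_eq_zero : ∀ x : M, cov.torsion x = 0

end PseudoHermitian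

end PseudoHermitian

end

noncomputable section

set_option linter.unusedSectionVars false
set_option synthInstance.maxHeartbeats 200000

section ChartCoordinates

variable {E : Type*} [NormedAddCommGroup E] [NormedSpace ℝ E]
  {M : Type*} [TopologicalSpace M] [ChartedSpace E M] [IsManifold 𝓘(ℝ, E) ∞ M]

/-- The coordinates of a tangent vector at `p` in the chart at `x₀`. -/
def chartCoord (x₀ p : M) : TangentSpace 𝓘(ℝ, E) p →L[ℝ] E :=
  (trivializationAt E (TangentSpace 𝓘(ℝ, E)) x₀).continuousLinearMapAt ℝ p

/-- The tangent vector at `p` with given coordinates in the chart at `x₀`. -/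
def chartVec (x₀ p : M) : E →L[ℝ] TangentSpace 𝓘(ℝ, E) p :=
  (trivializationAt E (TangentSpace 𝓘(ℝ, E)) x₀).symmL ℝ p

/-- The vector field with constant coordinates in the chart at `x₀`. -/
def chartFrame (x₀ : M) (a : E) (p : M) : TangentSpace 𝓘(ℝ, E) p := chartVec x₀ p a

variable {x₀ p : M}

theorem trivializationAt_snd (hp : p ∈ (chartAt E x₀).source) (v : TangentSpace 𝓘(ℝ, E) p) :
    (trivializationAt E (TangentSpace 𝓘(ℝ, E)) x₀ ⟨p, v⟩).2 = chartCoord x₀ p v := by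
  rw [chartCoord, Trivialization.continuousLinearMapAt_apply,
    Trivialization.linearMapAt_apply, if_pos (by simpa using hp)]

theorem chartCoord_chartVec (hp : p ∈ (chartAt E x₀).source) (a : E) :
    chartCoord x₀ p (chartVec x₀ p a) = a :=
  Trivialization.continuousLinearMapAt_symmL _ (by simpa using hp) a

theorem chartVec_chartCoord (hp : p ∈ (chartAt E x₀).source) (v : TangentSpace 𝓘(ℝ, E) p) :
    chartVec x₀ p (chartCoord x₀ p v) = v :=
  Trivialization.symmL_continuousLinearMapAt _ (by simpa using hp) v

theorem chartCoord_eq_mfderiv (hp : p ∈ (chartAt E x₀).source) :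
    chartCoord x₀ p = mfderiv 𝓘(ℝ, E) 𝓘(ℝ, E) (extChartAt 𝓘(ℝ, E) x₀) p :=
  TangentBundle.continuousLinearMapAt_trivializationAt hp

theorem contMDiffAt_iff_chartCoord {X : Π p : M, TangentSpace 𝓘(ℝ, E) p} {k : ℕ∞}
    (hp : p ∈ (chartAt E x₀).source) :
    CMDiffAt k (T% X) p ↔ ContMDiffAt 𝓘(ℝ, E) 𝓘(ℝ, E) k (fun q ↦ chartCoord x₀ q (X q)) p := by
  rw [(trivializationAt E (TangentSpace 𝓘(ℝ, E)) x₀).contMDiffAt_section_iff (by simpa using hp)]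
  refine Filter.EventuallyEq.contMDiffAt_iff ?_
  filter_upwards [(chartAt E x₀).open_source.mem_nhds hp] with q hq
  exact trivializationAt_snd hq _

theorem mdifferentiableAt_iff_chartCoord {X : Π p : M, TangentSpace 𝓘(ℝ, E) p}
    (hp : p ∈ (chartAt E x₀).source) :
    MDiffAt (T% X) p ↔
      MDifferentiableAt 𝓘(ℝ, E) 𝓘(ℝ, E) (fun q ↦ chartCoord x₀ q (X q)) p := by
  rw [(trivializationAt E (TangentSpace 𝓘(ℝ, E)) x₀).mdifferentiableAt_section_iff _ _
    (by simpa using hp)]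
  refine Filter.EventuallyEq.mdifferentiableAt_iff ?_
  filter_upwards [(chartAt E x₀).open_source.mem_nhds hp] with q hq
  exact trivializationAt_snd hq _

theorem contMDiffAt_chartFrame {k : ℕ∞} (hp : p ∈ (chartAt E x₀).source) (a : E) :
    CMDiffAt k (T% (chartFrame x₀ a)) p := by
  rw [contMDiffAt_iff_chartCoord hp]
  refine (contMDiffAt_const (c := a)).congr_of_eventuallyEq ?_
  filter_upwards [(chartAt E x₀).open_source.mem_nhds hp] with q hq
  exact chartCoord_chartVec hq a

theorem mdifferentiableAt_chartFrame (hp : p ∈ (chartAt E x₀).source) (a : E) :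
    MDiffAt (T% (chartFrame x₀ a)) p :=
  (contMDiffAt_chartFrame (k := 1) hp a).mdifferentiableAt one_ne_zero

theorem extend_eq_chartFrame (v : TangentSpace 𝓘(ℝ, E) p) {q : M}
    (hq : q ∈ (chartAt E p).source) :
    FiberBundle.extend E v q = chartFrame p (chartCoord p p v) q := by
  simp only [FiberBundle.extend, chartFrame, chartVec]
  rw [trivializationAt_snd (mem_chart_source E p), Trivialization.symmL_apply]
  simpa using hq

/-- The flat connection of the chart at `x₀`. -/
def flatCov (x₀ : M) (X : Π p : M, TangentSpace 𝓘(ℝ, E) p) (p : M) :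
    TangentSpace 𝓘(ℝ, E) p →L[ℝ] TangentSpace 𝓘(ℝ, E) p :=
  (chartVec x₀ p).comp (mvfderiv 𝓘(ℝ, E) (fun q ↦ chartCoord x₀ q (X q)) p)

theorem isCovariantDerivativeOn_flatCov (x₀ : M) :
    IsCovariantDerivativeOn E (flatCov (E := E) x₀) (chartAt E x₀).source where
  add {X Y p} hX hY hp := by
    rw [mdifferentiableAt_iff_chartCoord hp] at hX hY
    have : (fun q ↦ chartCoord x₀ q ((X + Y) q)) =
        fun q ↦ chartCoord x₀ q (X q) + chartCoord x₀ q (Y q) := by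
      ext q; simp
    ext v
    simp only [flatCov, this]
    rw [mvfderiv_fun_add hX hY]
    simp
  leibniz {X f p} hX hf hp := by
    rw [mdifferentiableAt_iff_chartCoord hp] at hX
    have : (fun q ↦ chartCoord x₀ q ((f • X) q)) =
        fun q ↦ f q • chartCoord x₀ q (X q) := by
      ext q; simp
    ext v
    simp only [flatCov, this]
    rw [mvfderiv_fun_smul hf hX]
    simp [chartVec_chartCoord hp]

variable [FiniteDimensional ℝ E]
  (cov : CovariantDerivative 𝓘(ℝ, E) E (fun x : M ↦ TangentSpace 𝓘(ℝ, E) x))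

/-- The difference between a connection and the flat connection of a chart. -/
def connectionForm (x₀ p : M) : TangentSpace 𝓘(ℝ, E) p →L[ℝ]
    TangentSpace 𝓘(ℝ, E) p →L[ℝ] TangentSpace 𝓘(ℝ, E) p :=
  IsCovariantDerivativeOn.difference
    (cov.isCovariantDerivativeOn (s := (chartAt E x₀).source)) (isCovariantDerivativeOn_flatCov x₀) p

theorem cov_eq_flatCov_add (hp : p ∈ (chartAt E x₀).source)
    {X : Π p : M, TangentSpace 𝓘(ℝ, E) p} (hX : MDiffAt (T% X) p) :
    cov X p = flatCov x₀ X p + connectionForm cov x₀ p (X p) := by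
  rw [connectionForm, IsCovariantDerivativeOn.difference_apply _ _ hp hX]
  abel

/-- The Christoffel symbol of a connection in the chart at `x₀`: `christoffel cov x₀ z a b` are the
coordinates of `∇_b a` at the point with coordinates `z`, where `a` and `b` are constant. -/
def christoffel (x₀ : M) (z : E) : E →L[ℝ] E →L[ℝ] E :=
  LinearMap.toContinuousLinearMap
    { toFun := fun a ↦ (chartCoord x₀ ((extChartAt 𝓘(ℝ, E) x₀).symm z)).comp
        ((connectionForm cov x₀ ((extChartAt 𝓘(ℝ, E) x₀).symm z) (chartVec x₀ _ a)).comp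
          (chartVec x₀ _))
      map_add' := fun a b ↦ by
        rw [map_add, map_add, ContinuousLinearMap.add_comp, ContinuousLinearMap.comp_add]
      map_smul' := fun c a ↦ by
        rw [map_smul, map_smul, ContinuousLinearMap.smul_comp, ContinuousLinearMap.comp_smul]
        rfl }

theorem christoffel_apply (hp : p ∈ (chartAt E x₀).source) (a b : E) :
    christoffel cov x₀ (extChartAt 𝓘(ℝ, E) x₀ p) a b =
      chartCoord x₀ p (connectionForm cov x₀ p (chartVec x₀ p a) (chartVec x₀ p b)) := by
  have : (extChartAt 𝓘(ℝ, E) x₀).symm (extChartAt 𝓘(ℝ, E) x₀ p) = p :=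
    (extChartAt 𝓘(ℝ, E) x₀).left_inv (by simpa using hp)
  simp only [christoffel]
  change chartCoord x₀ ((extChartAt 𝓘(ℝ, E) x₀).symm (extChartAt 𝓘(ℝ, E) x₀ p))
    (connectionForm cov x₀ _ (chartVec x₀ _ a) (chartVec x₀ _ b)) = _
  rw [this]

theorem chartCoord_cov (hp : p ∈ (chartAt E x₀).source)
    {X : Π p : M, TangentSpace 𝓘(ℝ, E) p} (hX : MDiffAt (T% X) p) (v : TangentSpace 𝓘(ℝ, E) p) :
    chartCoord x₀ p (cov X p v) = mvfderiv 𝓘(ℝ, E) (fun q ↦ chartCoord x₀ q (X q)) p v +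
      christoffel cov x₀ (extChartAt 𝓘(ℝ, E) x₀ p) (chartCoord x₀ p (X p)) (chartCoord x₀ p v) := by
  rw [cov_eq_flatCov_add cov hp hX, christoffel_apply cov hp, chartVec_chartCoord hp,
    chartVec_chartCoord hp]
  simp [flatCov, chartCoord_chartVec hp]

theorem chartCoord_cov_chartFrame (hp : p ∈ (chartAt E x₀).source) (a b : E) :
    chartCoord x₀ p (cov (chartFrame x₀ a) p (chartVec x₀ p b)) =
      christoffel cov x₀ (extChartAt 𝓘(ℝ, E) x₀ p) a b := by
  rw [chartCoord_cov cov hp (mdifferentiableAt_chartFrame hp a), chartCoord_chartVec hp]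
  have h : mvfderiv 𝓘(ℝ, E) (fun q ↦ chartCoord x₀ q (chartFrame x₀ a q)) p = 0 := by
    have e : (fun q ↦ chartCoord x₀ q (chartFrame x₀ a q)) =ᶠ[𝓝 p] fun _ ↦ a := by
      filter_upwards [(chartAt E x₀).open_source.mem_nhds hp] with q hq
      exact chartCoord_chartVec hq a
    have := (((hasMFDerivAt_const (I := 𝓘(ℝ, E)) (I' := 𝓘(ℝ, E)) a p).congr_of_eventuallyEq e)).mfderiv
    simp only [mvfderiv]
    rw [this]
    exact ContinuousLinearMap.comp_zero _
  rw [h]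
  simp [chartFrame, chartCoord_chartVec hp]

end ChartCoordinates

section GeodesicEquation

variable {E : Type*} [NormedAddCommGroup E] [NormedSpace ℝ E]
  {M : Type*} [TopologicalSpace M] [ChartedSpace E M] [IsManifold 𝓘(ℝ, E) ∞ M]
  {γ η : ℝ → M} {s : Set ℝ} {t : ℝ} {x₀ x₁ : M}

theorem chart_source_mem_nhds_of_mem {p : M} (hp : p ∈ (chartAt E x₀).source) :
    (chartAt E x₀).source ∈ 𝓝 p :=
  (chartAt E x₀).open_source.mem_nhds hp

theorem hasDerivWithinAt_comp_curve {F : Type*} [NormedAddCommGroup F] [NormedSpace ℝ F]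
    {f : M → F} {f' : TangentSpace 𝓘(ℝ, E) (γ t) →L[ℝ] F}
    (hf : HasMFDerivAt 𝓘(ℝ, E) 𝓘(ℝ, F) f (γ t) f')
    (hγ : MDifferentiableWithinAt 𝓘(ℝ, ℝ) 𝓘(ℝ, E) γ s t) :
    HasDerivWithinAt (f ∘ γ) (f' (curveVelocity 𝓘(ℝ, E) γ s t)) s t := by
  have h := hf.comp_hasMFDerivWithinAt t hγ.hasMFDerivWithinAt
  let L : ℝ →L[ℝ] F := f'.comp (mfderivWithin 𝓘(ℝ, ℝ) 𝓘(ℝ, E) γ s t)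
  have h' : HasFDerivWithinAt (f ∘ γ) L s t := hasMFDerivWithinAt_iff_hasFDerivWithinAt.1 h
  exact h'.hasDerivWithinAt

theorem hasMFDerivAt_chartCoord {p : M} (hp : p ∈ (chartAt E x₀).source) :
    HasMFDerivAt 𝓘(ℝ, E) 𝓘(ℝ, E) (extChartAt 𝓘(ℝ, E) x₀) p (chartCoord x₀ p) := by
  rw [chartCoord_eq_mfderiv hp]
  exact (mdifferentiableAt_extChartAt hp).hasMFDerivAt

theorem hasDerivWithinAt_chart_curve (hγ : MDifferentiableWithinAt 𝓘(ℝ, ℝ) 𝓘(ℝ, E) γ s t)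
    (ht : γ t ∈ (chartAt E x₀).source) :
    HasDerivWithinAt (extChartAt 𝓘(ℝ, E) x₀ ∘ γ)
      (chartCoord x₀ (γ t) (curveVelocity 𝓘(ℝ, E) γ s t)) s t :=
  hasDerivWithinAt_comp_curve (hasMFDerivAt_chartCoord ht) hγ

variable [FiniteDimensional ℝ E]
  {cov : CovariantDerivative 𝓘(ℝ, E) E (fun x : M ↦ TangentSpace 𝓘(ℝ, E) x)}

variable (cov) in
/-- The covariant derivative along a curve, computed in the chart at `x₀`. -/
def HasChartCovDerivAlong (x₀ : M) (γ : ℝ → M) (V : ∀ t, TangentSpace 𝓘(ℝ, E) (γ t)) (s : Set ℝ)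
    (t : ℝ) (w : TangentSpace 𝓘(ℝ, E) (γ t)) : Prop :=
  HasDerivWithinAt (fun u ↦ chartCoord x₀ (γ u) (V u))
    (chartCoord x₀ (γ t) w - christoffel cov x₀ (extChartAt 𝓘(ℝ, E) x₀ (γ t))
      (chartCoord x₀ (γ t) (V t)) (chartCoord x₀ (γ t) (curveVelocity 𝓘(ℝ, E) γ s t))) s t

theorem hasCovDerivAlong_iff {V : ∀ t, TangentSpace 𝓘(ℝ, E) (γ t)}
    {w : TangentSpace 𝓘(ℝ, E) (γ t)} (hγ : ContinuousWithinAt γ s t) :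
    HasCovDerivAlong cov γ V s t w ↔ HasChartCovDerivAlong cov (γ t) γ V s t w := by
  have hs : γ t ∈ (chartAt E (γ t)).source := mem_chart_source E (γ t)
  have hcov : cov (FiberBundle.extend E (V t)) (γ t) =
      cov (chartFrame (γ t) (chartCoord (γ t) (γ t) (V t))) (γ t) := by
    refine cov.isCovariantDerivativeOn.congr_of_eventuallyEq
      (FiberBundle.mdifferentiableAt_extend _ _ _) (mdifferentiableAt_chartFrame hs _) univ_mem ?_
    filter_upwards [chart_source_mem_nhds_of_mem hs] with q hq
    exact extend_eq_chartFrame _ hq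
  have h2 := chartCoord_cov_chartFrame cov hs (chartCoord (γ t) (γ t) (V t))
    (chartCoord (γ t) (γ t) (curveVelocity 𝓘(ℝ, E) γ s t))
  rw [chartVec_chartCoord hs] at h2
  have e1 : (trivializationAt E (fun x : M ↦ TangentSpace 𝓘(ℝ, E) x) (γ t)
      ⟨γ t, w - cov (FiberBundle.extend E (V t)) (γ t) (curveVelocity 𝓘(ℝ, E) γ s t)⟩).2 =
      chartCoord (γ t) (γ t) w - christoffel cov (γ t) (extChartAt 𝓘(ℝ, E) (γ t) (γ t))
      (chartCoord (γ t) (γ t) (V t)) (chartCoord (γ t) (γ t) (curveVelocity 𝓘(ℝ, E) γ s t)) := by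
    rw [trivializationAt_snd hs, map_sub, hcov, h2]
  have e2 : (fun u ↦ (trivializationAt E (fun x : M ↦ TangentSpace 𝓘(ℝ, E) x) (γ t)
      ⟨γ u, V u⟩).2) =ᶠ[𝓝[s] t] fun u ↦ chartCoord (γ t) (γ u) (V u) := by
    filter_upwards [hγ (chart_source_mem_nhds_of_mem hs)] with u hu
    exact trivializationAt_snd hu _
  simp only [HasCovDerivAlong, HasChartCovDerivAlong]
  rw [e1]
  exact e2.hasDerivWithinAt_iff (trivializationAt_snd hs _)

theorem HasChartCovDerivAlong.change {V : ∀ t, TangentSpace 𝓘(ℝ, E) (γ t)}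
    {w : TangentSpace 𝓘(ℝ, E) (γ t)} (hγ : MDifferentiableWithinAt 𝓘(ℝ, ℝ) 𝓘(ℝ, E) γ s t)
    (h₀ : γ t ∈ (chartAt E x₀).source) (h₁ : γ t ∈ (chartAt E x₁).source)
    (h : HasChartCovDerivAlong cov x₀ γ V s t w) : HasChartCovDerivAlong cov x₁ γ V s t w := by
  set c := chartCoord x₀ (γ t) (V t) with hc
  let A : M → E →L[ℝ] E := fun p ↦
    ((trivializationAt E (TangentSpace 𝓘(ℝ, E)) x₀).coordChangeL ℝ
      (trivializationAt E (TangentSpace 𝓘(ℝ, E)) x₁) p : E →L[ℝ] E)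
  have hA : MDifferentiableAt 𝓘(ℝ, E) 𝓘(ℝ, E →L[ℝ] E) A (γ t) := by
    have := contMDiffOn_coordChangeL (IB := 𝓘(ℝ, E)) (n := 1)
      (trivializationAt E (TangentSpace 𝓘(ℝ, E)) x₀)
      (trivializationAt E (TangentSpace 𝓘(ℝ, E)) x₁)
    refine (this.contMDiffAt ?_).mdifferentiableAt one_ne_zero
    refine IsOpen.mem_nhds ((Trivialization.open_baseSet _).inter (Trivialization.open_baseSet _)) ?_
    exact ⟨by simpa using h₀, by simpa using h₁⟩
  have hAe : ∀ p, p ∈ (chartAt E x₀).source → p ∈ (chartAt E x₁).source → ∀ a,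
      A p a = chartCoord x₁ p (chartVec x₀ p a) := by
    intro p h0 h1 a
    change (trivializationAt E (TangentSpace 𝓘(ℝ, E)) x₀).coordChangeL ℝ
      (trivializationAt E (TangentSpace 𝓘(ℝ, E)) x₁) p a = _
    rw [Trivialization.coordChangeL_apply _ _ ⟨by simpa using h0, by simpa using h1⟩,
      trivializationAt_snd h1, chartVec, Trivialization.symmL_apply]
    simpa using h0
  obtain ⟨A', hA'⟩ : ∃ A' : TangentSpace 𝓘(ℝ, E) (γ t) →L[ℝ] (E →L[ℝ] E),
    HasMFDerivAt 𝓘(ℝ, E) 𝓘(ℝ, E →L[ℝ] E) A (γ t) A' := ⟨_, hA.hasMFDerivAt⟩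
  have hAγ := hasDerivWithinAt_comp_curve (s := s) hA' hγ
  have hprod := hAγ.clm_apply h
  have hev : (fun u ↦ chartCoord x₁ (γ u) (V u)) =ᶠ[𝓝[s] t]
      fun u ↦ (A ∘ γ) u (chartCoord x₀ (γ u) (V u)) := by
    filter_upwards [hγ.continuousWithinAt (chart_source_mem_nhds_of_mem h₀),
      hγ.continuousWithinAt (chart_source_mem_nhds_of_mem h₁)] with u hu0 hu1
    simp only [Function.comp_apply]
    rw [hAe _ hu0 hu1, chartVec_chartCoord hu0]
  have hev' : chartCoord x₁ (γ t) (V t) = (A ∘ γ) t (chartCoord x₀ (γ t) (V t)) := by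
    simp only [Function.comp_apply]
    rw [hAe _ h₀ h₁, chartVec_chartCoord h₀]
  refine (hprod.congr_of_eventuallyEq hev hev').congr_deriv ?_
  -- the derivative of the coordinates of the frame
  have hfr : mvfderiv 𝓘(ℝ, E) (fun q ↦ chartCoord x₁ q (chartFrame x₀ c q)) (γ t) =
      (ContinuousLinearMap.apply ℝ E c).comp A' := by
    have h1 : HasMFDerivAt 𝓘(ℝ, E) 𝓘(ℝ, E) (fun p ↦ A p c) (γ t)
        ((ContinuousLinearMap.apply ℝ E c).comp A') :=
      (ContinuousLinearMap.apply ℝ E c).hasMFDerivAt.comp (γ t) hA'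
    have h2 : (fun q ↦ chartCoord x₁ q (chartFrame x₀ c q)) =ᶠ[𝓝 (γ t)] fun p ↦ A p c := by
      filter_upwards [chart_source_mem_nhds_of_mem h₀, chart_source_mem_nhds_of_mem h₁] with q h0 h1
      exact (hAe q h0 h1 c).symm
    have h3 := (h1.congr_of_eventuallyEq h2).mfderiv
    simp only [mvfderiv]
    rw [h3]
    rfl
  have k0 := chartCoord_cov_chartFrame cov h₀ c (chartCoord x₀ (γ t) (curveVelocity 𝓘(ℝ, E) γ s t))
  have k1 := chartCoord_cov cov h₁ (mdifferentiableAt_chartFrame h₀ c)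
    (curveVelocity 𝓘(ℝ, E) γ s t)
  rw [hfr] at k1
  rw [chartVec_chartCoord h₀] at k0
  have k2 : chartFrame x₀ c (γ t) = V t := by
    rw [chartFrame, hc, chartVec_chartCoord h₀]
  rw [k2] at k1
  rw [← k0, Function.comp_apply, map_sub, hAe _ h₀ h₁, hAe _ h₀ h₁, chartVec_chartCoord h₀,
    chartVec_chartCoord h₀, k1]
  simp only [ContinuousLinearMap.comp_apply, ContinuousLinearMap.apply_apply]
  abel

theorem hasCovDerivAlong_iff_chart {V : ∀ t, TangentSpace 𝓘(ℝ, E) (γ t)}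
    {w : TangentSpace 𝓘(ℝ, E) (γ t)} (hγ : MDifferentiableWithinAt 𝓘(ℝ, ℝ) 𝓘(ℝ, E) γ s t)
    (h₀ : γ t ∈ (chartAt E x₀).source) :
    HasCovDerivAlong cov γ V s t w ↔ HasChartCovDerivAlong cov x₀ γ V s t w := by
  rw [hasCovDerivAlong_iff hγ.continuousWithinAt]
  exact ⟨fun h ↦ h.change hγ (mem_chart_source E _) h₀,
    fun h ↦ h.change hγ h₀ (mem_chart_source E _)⟩

end GeodesicEquation

section GeodesicFlow

variable {E : Type*} [NormedAddCommGroup E] [NormedSpace ℝ E] [FiniteDimensional ℝ E]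
  {M : Type*} [TopologicalSpace M] [ChartedSpace E M] [IsManifold 𝓘(ℝ, E) ∞ M]
  {cov : CovariantDerivative 𝓘(ℝ, E) E (fun x : M ↦ TangentSpace 𝓘(ℝ, E) x)}
  {γ η : ℝ → M} {s s' : Set ℝ} {t : ℝ} {x₀ : M}

theorem IsGeodesicOn.mdifferentiableWithinAt (h : IsGeodesicOn cov γ s) (ht : t ∈ s) :
    MDifferentiableWithinAt 𝓘(ℝ, ℝ) 𝓘(ℝ, E) γ s t :=
  h.1.mdifferentiableOn one_ne_zero t ht

theorem IsGeodesicOn.hasDerivWithinAt_velocity (h : IsGeodesicOn cov γ s) (ht : t ∈ s)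
    (h₀ : γ t ∈ (chartAt E x₀).source) :
    HasDerivWithinAt (fun u ↦ chartCoord x₀ (γ u) (curveVelocity 𝓘(ℝ, E) γ s u))
      (-christoffel cov x₀ (extChartAt 𝓘(ℝ, E) x₀ (γ t))
        (chartCoord x₀ (γ t) (curveVelocity 𝓘(ℝ, E) γ s t))
        (chartCoord x₀ (γ t) (curveVelocity 𝓘(ℝ, E) γ s t))) s t := by
  have := (hasCovDerivAlong_iff_chart (h.mdifferentiableWithinAt ht) h₀).1 (h.2 t ht)
  rw [HasChartCovDerivAlong, map_zero, zero_sub] at this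
  exact this

theorem curveVelocity_mono (hγ : MDifferentiableWithinAt 𝓘(ℝ, ℝ) 𝓘(ℝ, E) γ s t) (hs : s' ⊆ s)
    (hu : UniqueDiffWithinAt ℝ s' t) :
    curveVelocity 𝓘(ℝ, E) γ s' t = curveVelocity 𝓘(ℝ, E) γ s t := by
  simp only [curveVelocity]
  rw [mfderivWithin_subset hs hu.uniqueMDiffWithinAt hγ]

theorem curveVelocity_of_mem_nhds (hs : s ∈ 𝓝 t) :
    curveVelocity 𝓘(ℝ, E) γ s t = curveVelocity 𝓘(ℝ, E) γ univ t := by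
  simp only [curveVelocity]
  rw [mfderivWithin_of_mem_nhds hs, mfderivWithin_univ]

theorem IsGeodesicOn.mono (h : IsGeodesicOn cov γ s) (hs : s' ⊆ s) (hu : UniqueDiffOn ℝ s') :
    IsGeodesicOn cov γ s' := by
  refine ⟨h.1.mono hs, fun t ht ↦ ?_⟩
  have hd := h.mdifferentiableWithinAt (hs ht)
  rw [hasCovDerivAlong_iff_chart (hd.mono hs) (mem_chart_source E (γ t)), HasChartCovDerivAlong,
    map_zero, zero_sub, curveVelocity_mono hd hs (hu t ht)]
  have := (h.hasDerivWithinAt_velocity (hs ht) (mem_chart_source E (γ t))).mono hs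
  refine this.congr (fun u hu' ↦ ?_) ?_
  · rw [curveVelocity_mono (h.mdifferentiableWithinAt (hs hu')) hs (hu u hu')]
  · rw [curveVelocity_mono hd hs (hu t ht)]

variable (cov) in
/-- The geodesic vector field in the chart at `x₀`. -/
def geodesicField (x₀ : M) (q : E × E) : E × E := (q.2, -christoffel cov x₀ q.1 q.2 q.2)

/-- The position and the velocity of a curve in the chart at `x₀`. -/
def chartPhase (x₀ : M) (γ : ℝ → M) (t : ℝ) : E × E :=
  (extChartAt 𝓘(ℝ, E) x₀ (γ t), chartCoord x₀ (γ t) (curveVelocity 𝓘(ℝ, E) γ univ t))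

theorem IsGeodesicOn.hasDerivAt_chartPhase (h : IsGeodesicOn cov γ s) (hs : s ∈ 𝓝 t)
    (h₀ : γ t ∈ (chartAt E x₀).source) :
    HasDerivAt (chartPhase x₀ γ) (geodesicField cov x₀ (chartPhase x₀ γ t)) t := by
  have ht := mem_of_mem_nhds hs
  have h1 := (hasDerivWithinAt_chart_curve (h.mdifferentiableWithinAt ht) h₀).hasDerivAt hs
  have h2 := (h.hasDerivWithinAt_velocity ht h₀).hasDerivAt hs
  rw [curveVelocity_of_mem_nhds hs] at h1 h2
  refine h1.prodMk (h2.congr_of_eventuallyEq ?_)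
  filter_upwards [eventually_mem_nhds_iff.2 hs] with u hu
  rw [curveVelocity_of_mem_nhds hu]

theorem EventuallyEq.curveVelocity_heq (h : γ =ᶠ[𝓝 t] η) :
    (⟨γ t, curveVelocity 𝓘(ℝ, E) γ univ t⟩ : TangentBundle 𝓘(ℝ, E) M) =
      ⟨η t, curveVelocity 𝓘(ℝ, E) η univ t⟩ := by
  have h1 : γ t = η t := h.self_of_nhds
  have h2 : mfderiv 𝓘(ℝ, ℝ) 𝓘(ℝ, E) γ t = mfderiv 𝓘(ℝ, ℝ) 𝓘(ℝ, E) η t := h.mfderiv_eq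
  refine Bundle.TotalSpace.ext h1 (heq_of_eq ?_)
  simp only [curveVelocity, mfderivWithin_univ]
  rw [h2]
  rfl

theorem chartPhase_congr {x₀ : M} (h : γ =ᶠ[𝓝 t] η) : (chartPhase x₀ γ t : E × E) = chartPhase x₀ η t := by
  have := EventuallyEq.curveVelocity_heq (E := E) h
  exact congrArg (fun v : TangentBundle 𝓘(ℝ, E) M ↦
    ((extChartAt 𝓘(ℝ, E) x₀ v.1, chartCoord x₀ v.1 v.2) : E × E)) this

theorem isGeodesicOn_iff_of_isOpen (hs : IsOpen s) :
    IsGeodesicOn cov γ s ↔ ContMDiffOn 𝓘(ℝ, ℝ) 𝓘(ℝ, E) 1 γ s ∧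
      ∀ t ∈ s, ∃ x₀, γ t ∈ (chartAt E x₀).source ∧
        HasDerivAt (chartPhase x₀ γ) (geodesicField cov x₀ (chartPhase x₀ γ t)) t := by
  refine ⟨fun h ↦ ⟨h.1, fun t ht ↦ ⟨γ t, mem_chart_source E _,
    h.hasDerivAt_chartPhase (hs.mem_nhds ht) (mem_chart_source E _)⟩⟩, fun h ↦ ⟨h.1, fun t ht ↦ ?_⟩⟩
  obtain ⟨x₀, h₀, hd⟩ := h.2 t ht
  rw [hasCovDerivAlong_iff_chart (h.1.mdifferentiableOn one_ne_zero t ht) h₀,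
    HasChartCovDerivAlong, map_zero, zero_sub, curveVelocity_of_mem_nhds (hs.mem_nhds ht)]
  have h2 : HasDerivAt (fun u ↦ (chartPhase x₀ γ u).2) _ t := hd.snd
  refine h2.hasDerivWithinAt.congr (fun u hu ↦ ?_) ?_
  · rw [curveVelocity_of_mem_nhds (hs.mem_nhds hu)]
    rfl
  · rw [curveVelocity_of_mem_nhds (hs.mem_nhds ht)]
    rfl

theorem isGeodesicOn_of_locally (hs : IsOpen s)
    (h : ∀ t ∈ s, ∃ η : ℝ → M, ∃ U ∈ 𝓝 t, IsGeodesicOn cov η U ∧ γ =ᶠ[𝓝 t] η) :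
    IsGeodesicOn cov γ s := by
  rw [isGeodesicOn_iff_of_isOpen hs]
  refine ⟨fun t ht ↦ ?_, fun t ht ↦ ?_⟩
  · obtain ⟨η, U, hU, hη, he⟩ := h t ht
    exact ((hη.1.contMDiffAt hU).congr_of_eventuallyEq he).contMDiffWithinAt
  · obtain ⟨η, U, hU, hη, he⟩ := h t ht
    refine ⟨η t, ?_, ?_⟩
    · rw [he.self_of_nhds]
      exact mem_chart_source E _
    · have h1 := hη.hasDerivAt_chartPhase (x₀ := η t) hU (mem_chart_source E _)
      rw [chartPhase_congr he]
      refine h1.congr_of_eventuallyEq ?_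
      filter_upwards [he.eventuallyEq_nhds] with u hu
      exact chartPhase_congr hu

/-- A solution of the geodesic equation in a chart gives a geodesic. -/
theorem chartPhase_of_hasDerivAt {α : ℝ → E × E} {x₀ : M}
    (hd : ∀ᶠ u in 𝓝 t, HasDerivAt α (geodesicField cov x₀ (α u)) u)
    (hm : (α t).1 ∈ (extChartAt 𝓘(ℝ, E) x₀).target) :
    ContMDiffAt 𝓘(ℝ, ℝ) 𝓘(ℝ, E) 1 (fun u ↦ (extChartAt 𝓘(ℝ, E) x₀).symm (α u).1) t ∧
      chartPhase x₀ (fun u ↦ (extChartAt 𝓘(ℝ, E) x₀).symm (α u).1) t = α t := by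
  have hz : ∀ᶠ u in 𝓝 t, HasDerivAt (fun u ↦ (α u).1) (α u).2 u :=
    hd.mono fun u hu ↦ hu.fst
  have hc : ContDiffAt ℝ 1 (fun u ↦ (α u).1) t := by
    have : ∀ᶠ u in 𝓝 t, ContinuousAt (fun u ↦ (α u).2) u :=
      hd.mono fun u hu ↦ hu.continuousAt.snd
    obtain ⟨U, hU, hUo, htU⟩ := eventually_nhds_iff.1 (hz.and this)
    have hdiff : ContDiffOn ℝ 1 (fun u ↦ (α u).1) U := by
      rw [show (1 : WithTop ℕ∞) = 0 + 1 by simp, contDiffOn_succ_iff_deriv_of_isOpen hUo]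
      refine ⟨fun u hu ↦ (hU u hu).1.differentiableAt.differentiableWithinAt, by simp, ?_⟩
      rw [contDiffOn_zero]
      refine ContinuousOn.congr (f := fun u ↦ (α u).2)
        (fun u hu ↦ (hU u hu).2.continuousWithinAt) fun u hu ↦ (hU u hu).1.deriv
    exact hdiff.contDiffAt (hUo.mem_nhds htU)
  have hs : ContMDiffAt 𝓘(ℝ, ℝ) 𝓘(ℝ, E) 1 (fun u ↦ (extChartAt 𝓘(ℝ, E) x₀).symm (α u).1) t := by
    have h1 : ContMDiffAt 𝓘(ℝ, E) 𝓘(ℝ, E) 1 (extChartAt 𝓘(ℝ, E) x₀).symm (α t).1 :=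
      (contMDiffOn_extChartAt_symm x₀).contMDiffAt
        ((isOpen_extChartAt_target x₀).mem_nhds hm)
    exact h1.comp t hc.contMDiffAt
  refine ⟨hs, ?_⟩
  have hsrc : (extChartAt 𝓘(ℝ, E) x₀).symm (α t).1 ∈ (chartAt E x₀).source := by
    simpa using (extChartAt 𝓘(ℝ, E) x₀).map_target hm
  refine Prod.ext ((extChartAt 𝓘(ℝ, E) x₀).right_inv hm) ?_
  have h1 := hasDerivWithinAt_chart_curve (s := univ) (x₀ := x₀)
    (hs.mdifferentiableAt one_ne_zero).mdifferentiableWithinAt hsrc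
  rw [hasDerivWithinAt_univ] at h1
  have h2 : HasDerivAt (extChartAt 𝓘(ℝ, E) x₀ ∘
      fun u ↦ (extChartAt 𝓘(ℝ, E) x₀).symm (α u).1) (α t).2 t := by
    refine hz.self_of_nhds.congr_of_eventuallyEq ?_
    filter_upwards [hz.self_of_nhds.continuousAt
      ((isOpen_extChartAt_target x₀).mem_nhds hm)] with u hu
    exact (extChartAt 𝓘(ℝ, E) x₀).right_inv hu
  exact h1.unique h2

theorem isGeodesicOn_of_hasDerivAt {α : ℝ → E × E} {x₀ : M} (hs : IsOpen s)
    (hd : ∀ u ∈ s, HasDerivAt α (geodesicField cov x₀ (α u)) u)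
    (hm : ∀ u ∈ s, (α u).1 ∈ (extChartAt 𝓘(ℝ, E) x₀).target) :
    IsGeodesicOn cov (fun u ↦ (extChartAt 𝓘(ℝ, E) x₀).symm (α u).1) s := by
  have key : ∀ u ∈ s, _ := fun u hu ↦ chartPhase_of_hasDerivAt (cov := cov) (x₀ := x₀) (t := u)
    (by filter_upwards [hs.mem_nhds hu] with w hw using hd w hw) (hm u hu)
  rw [isGeodesicOn_iff_of_isOpen hs]
  refine ⟨fun u hu ↦ (key u hu).1.contMDiffWithinAt, fun u hu ↦ ⟨x₀, ?_, ?_⟩⟩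
  · simpa using (extChartAt 𝓘(ℝ, E) x₀).map_target (hm u hu)
  · rw [(key u hu).2]
    refine (hd u hu).congr_of_eventuallyEq ?_
    filter_upwards [hs.mem_nhds hu] with w hw using (key w hw).2

theorem symm_chartPhase_fst (h : γ t ∈ (chartAt E x₀).source) :
    (extChartAt 𝓘(ℝ, E) x₀).symm (chartPhase x₀ γ t).1 = γ t :=
  (extChartAt 𝓘(ℝ, E) x₀).left_inv (by simpa using h)

theorem curveVelocity_comp_affine {c d : ℝ} (h : MDifferentiableAt 𝓘(ℝ, ℝ) 𝓘(ℝ, E) γ (c * t + d)) :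
    curveVelocity 𝓘(ℝ, E) (fun u ↦ γ (c * u + d)) univ t =
      c • curveVelocity 𝓘(ℝ, E) γ univ (c * t + d) := by
  have h2 : HasDerivAt (fun u : ℝ ↦ c * u + d) c t := by
    simpa using ((hasDerivAt_id t).const_mul c).add_const d
  have h3 := h.hasMFDerivAt.comp t h2.hasFDerivAt.hasMFDerivAt
  have h4 : mfderiv 𝓘(ℝ, ℝ) 𝓘(ℝ, E) (fun u ↦ γ (c * u + d)) t = _ := h3.mfderiv
  simp only [curveVelocity, mfderivWithin_univ]
  rw [h4]
  exact (congrArg (mfderiv 𝓘(ℝ, ℝ) 𝓘(ℝ, E) γ (c * t + d)) (mul_comm (1 : ℝ) c)).trans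
    ((mfderiv 𝓘(ℝ, ℝ) 𝓘(ℝ, E) γ (c * t + d)).map_smul c (1 : ℝ))

theorem chartPhase_comp_affine {c d : ℝ} (h : MDifferentiableAt 𝓘(ℝ, ℝ) 𝓘(ℝ, E) γ (c * t + d)) :
    (chartPhase x₀ (fun u ↦ γ (c * u + d)) t : E × E) =
      ((chartPhase x₀ γ (c * t + d) : E × E).1, c • (chartPhase x₀ γ (c * t + d) : E × E).2) := by
  refine Prod.ext rfl ?_
  simp only [chartPhase]
  rw [curveVelocity_comp_affine h, map_smul]

/-- Affine reparametrizations of geodesics are geodesics. -/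
theorem IsGeodesicOn.comp_affine (h : IsGeodesicOn cov γ s) (hs : IsOpen s) (c d : ℝ) :
    IsGeodesicOn cov (fun u ↦ γ (c * u + d)) ((fun u ↦ c * u + d) ⁻¹' s) := by
  have hcont : Continuous fun u : ℝ ↦ c * u + d := by fun_prop
  refine isGeodesicOn_of_locally (hs.preimage hcont) fun t ht ↦ ?_
  set x₀ := γ (c * t + d) with hx₀
  have hsrc : ∀ᶠ u in 𝓝 t, γ (c * u + d) ∈ (chartAt E x₀).source := by
    have h1 : ContinuousAt γ (c * t + d) := (h.1.continuousOn).continuousAt (hs.mem_nhds ht)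
    have h2 : ContinuousAt (fun u ↦ γ (c * u + d)) t := h1.comp (f := fun u ↦ c * u + d)
      hcont.continuousAt
    exact h2 (chart_source_mem_nhds_of_mem (mem_chart_source E _))
  obtain ⟨U, hU, hUo, htU⟩ := eventually_nhds_iff.1
    (hsrc.and ((hs.preimage hcont).mem_nhds ht))
  let α : ℝ → E × E := fun u ↦
    ((chartPhase x₀ γ (c * u + d)).1, c • (chartPhase x₀ γ (c * u + d)).2)
  refine ⟨fun u ↦ (extChartAt 𝓘(ℝ, E) x₀).symm (α u).1, U, hUo.mem_nhds htU, ?_, ?_⟩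
  · refine isGeodesicOn_of_hasDerivAt hUo (fun u hu ↦ ?_) fun u hu ↦ ?_
    · have h1 := h.hasDerivAt_chartPhase (hs.mem_nhds (hU u hu).2) (hU u hu).1
      have h2 : HasDerivAt (fun u : ℝ ↦ c * u + d) c u := by
        simpa using ((hasDerivAt_id u).const_mul c).add_const d
      have h3 : HasDerivAt (fun u ↦ chartPhase x₀ γ (c * u + d))
        (c • geodesicField cov x₀ (chartPhase x₀ γ (c * u + d))) u :=
        HasDerivAt.scomp (g₁ := chartPhase x₀ γ) (h := fun u : ℝ ↦ c * u + d) u h1 h2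
      have h4 : HasDerivAt (fun u ↦ (chartPhase x₀ γ (c * u + d)).1) _ u := h3.fst
      have h5 : HasDerivAt (fun u ↦ (chartPhase x₀ γ (c * u + d)).2) _ u := h3.snd
      have h6 : HasDerivAt α _ u := h4.prodMk (h5.const_smul c)
      convert h6 using 1
      simp [geodesicField, α]
    · exact (extChartAt 𝓘(ℝ, E) x₀).map_source (by simpa using (hU u hu).1)
  · filter_upwards [hUo.mem_nhds htU] with u hu
    exact (symm_chartPhase_fst (hU u hu).1).symm

end GeodesicFlow

section SmoothExtension

variable {E : Type*} [NormedAddCommGroup E] [NormedSpace ℝ E] [FiniteDimensional ℝ E]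
  {M : Type*} [TopologicalSpace M] [T2Space M] [ChartedSpace E M] [IsManifold 𝓘(ℝ, E) ∞ M]

/-- A locally defined smooth vector field agrees near a given point with a global one. -/
theorem exists_contMDiff_eventuallyEq {X : Π p : M, TangentSpace 𝓘(ℝ, E) p} {p : M}
    (hX : ∀ᶠ q in 𝓝 p, CMDiffAt ∞ (T% X) q) :
    ∃ Y : Π p : M, TangentSpace 𝓘(ℝ, E) p, CMDiff ∞ (T% Y) ∧ ∀ᶠ q in 𝓝 p, Y q = X q := by
  obtain ⟨f, -, hf⟩ := (SmoothBumpFunction.nhds_basis_tsupport (I := 𝓘(ℝ, E)) p).mem_iff.1 hX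
  refine ⟨(f : M → ℝ) • X, fun q ↦ ?_, ?_⟩
  · by_cases hq : q ∈ tsupport f
    · exact f.contMDiffAt.smul_section (hf hq)
    · have : (fun q ↦ (⟨q, ((f : M → ℝ) • X) q⟩ : TangentBundle 𝓘(ℝ, E) M)) =ᶠ[𝓝 q]
          zeroSection E (TangentSpace 𝓘(ℝ, E)) := by
        filter_upwards [(isClosed_tsupport f).isOpen_compl.mem_nhds hq] with y hy
        have : f y = 0 := image_eq_zero_of_notMem_tsupport hy
        simp [zeroSection, this]
      exact (contMDiffAt_zeroSection ℝ _).congr_of_eventuallyEq this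
  · filter_upwards [f.eventuallyEq_one] with q hq
    simp [hq]

variable {cov : CovariantDerivative 𝓘(ℝ, E) E (fun x : M ↦ TangentSpace 𝓘(ℝ, E) x)}

theorem contDiffOn_christoffel (hcov : cov.ContMDiffCovariantDerivative ∞) (x₀ : M) :
    ContDiffOn ℝ ∞ (christoffel cov x₀) (extChartAt 𝓘(ℝ, E) x₀).target := by
  rw [contDiffOn_clm_apply]
  intro a
  rw [contDiffOn_clm_apply]
  intro b z hz
  refine ContDiffAt.contDiffWithinAt ?_
  set p := (extChartAt 𝓘(ℝ, E) x₀).symm z with hp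
  have hps : p ∈ (chartAt E x₀).source := by
    rw [← extChartAt_source 𝓘(ℝ, E) x₀]
    exact (extChartAt 𝓘(ℝ, E) x₀).map_target hz
  obtain ⟨Y, hY, hYe⟩ := exists_contMDiff_eventuallyEq (X := chartFrame x₀ a) (p := p) (by
    filter_upwards [chart_source_mem_nhds_of_mem hps] with q hq using contMDiffAt_chartFrame hq a)
  have h1 := (hcov.contMDiff.contMDiff (σ := Y) (by simpa using hY.contMDiffOn)).contMDiffAt
    (x := p) univ_mem
  have h2 := h1.clm_bundle_apply (contMDiffAt_chartFrame (k := (⊤ : ℕ∞)) hps b)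
  have h3 : ContMDiffAt 𝓘(ℝ, E) 𝓘(ℝ, E) ∞
      (fun q ↦ chartCoord x₀ q (cov Y q (chartFrame x₀ b q))) p :=
    (contMDiffAt_iff_chartCoord (k := (⊤ : ℕ∞)) hps).1 h2
  have h4 : ContMDiffAt 𝓘(ℝ, E) 𝓘(ℝ, E) ∞
      (fun q ↦ christoffel cov x₀ (extChartAt 𝓘(ℝ, E) x₀ q) a b) p := by
    refine h3.congr_of_eventuallyEq ?_
    filter_upwards [hYe.eventually_nhds, chart_source_mem_nhds_of_mem hps] with q hq hqs
    rw [← chartCoord_cov_chartFrame cov hqs]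
    have : cov Y q = cov (chartFrame x₀ a) q :=
      cov.isCovariantDerivativeOn.congr_of_eventuallyEq
        ((hY q).mdifferentiableAt (by simp)) (mdifferentiableAt_chartFrame hqs _) univ_mem hq
    rw [this]
    rfl
  have h5 : ContMDiffAt 𝓘(ℝ, E) 𝓘(ℝ, E) ∞ (extChartAt 𝓘(ℝ, E) x₀).symm z :=
    (contMDiffOn_extChartAt_symm x₀).contMDiffAt ((isOpen_extChartAt_target x₀).mem_nhds hz)
  have h6 : ContMDiffAt 𝓘(ℝ, E) 𝓘(ℝ, E) ∞ (fun w ↦ christoffel cov x₀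
      (extChartAt 𝓘(ℝ, E) x₀ ((extChartAt 𝓘(ℝ, E) x₀).symm w)) a b) z := ContMDiffAt.comp z h4 h5
  refine (contMDiffAt_iff_contDiffAt.1 h6).congr_of_eventuallyEq ?_
  filter_upwards [(isOpen_extChartAt_target x₀).mem_nhds hz] with w hw
  rw [(extChartAt 𝓘(ℝ, E) x₀).right_inv hw]

theorem contDiffAt_geodesicField (hcov : cov.ContMDiffCovariantDerivative ∞) {x₀ : M} {q : E × E}
    (hq : q.1 ∈ (extChartAt 𝓘(ℝ, E) x₀).target) : ContDiffAt ℝ 1 (geodesicField cov x₀) q := by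
  have h1 : ContDiffAt ℝ 1 (christoffel cov x₀) q.1 :=
    ((contDiffOn_christoffel hcov x₀).contDiffAt
      ((isOpen_extChartAt_target x₀).mem_nhds hq)).of_le (by simp)
  have h2 : ContDiffAt ℝ 1 (fun q : E × E ↦ christoffel cov x₀ q.1) q := h1.comp q contDiffAt_fst
  exact contDiffAt_snd.prodMk (((h2.clm_apply contDiffAt_snd).clm_apply contDiffAt_snd).neg)

/-- Local existence for the geodesic equation, uniformly in the initial condition. -/
theorem exists_geodesicField_flow (hcov : cov.ContMDiffCovariantDerivative ∞) {x₀ : M} {q₀ : E × E}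
    (hq : q₀.1 ∈ (extChartAt 𝓘(ℝ, E) x₀).target) {W : Set (E × E)} (hW : W ∈ 𝓝 q₀) :
    ∃ r > 0, ∃ ε > 0, ∀ q ∈ Metric.closedBall q₀ r, ∃ α : ℝ → E × E, α 0 = q ∧
      ∀ t ∈ Ioo (-ε) ε, HasDerivAt α (geodesicField cov x₀ (α t)) t ∧ α t ∈ W ∧
        (α t).1 ∈ (extChartAt 𝓘(ℝ, E) x₀).target := by
  obtain ⟨ε, hε, a, r, L, K, hr, hpl⟩ :=
    IsPicardLindelof.of_contDiffAt_one (contDiffAt_geodesicField hcov hq)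
  obtain ⟨α, hα, hαc⟩ := (hpl 0).exists_forall_mem_closedBall_eq_hasDerivWithinAt_continuousOn
  have hW' : W ∩ {q | q.1 ∈ (extChartAt 𝓘(ℝ, E) x₀).target} ∈ 𝓝 q₀ :=
    inter_mem hW (continuousAt_fst ((isOpen_extChartAt_target x₀).mem_nhds hq))
  have hc : ContinuousAt α (q₀, 0) := by
    refine hαc.continuousAt ?_
    refine prod_mem_nhds (Metric.closedBall_mem_nhds _ (by exact_mod_cast hr)) ?_
    exact Icc_mem_nhds (by simpa using hε) (by simpa using hε)
  have h0 : α (q₀, 0) = q₀ := (hα q₀ (Metric.mem_closedBall_self r.2)).1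
  have hmem : α ⁻¹' (W ∩ {q | q.1 ∈ (extChartAt 𝓘(ℝ, E) x₀).target}) ∈ 𝓝 (q₀, (0 : ℝ)) :=
    hc (by rw [h0]; exact hW')
  rw [nhds_prod_eq, mem_prod_iff] at hmem
  obtain ⟨U, hU, V, hV, hUV⟩ := hmem
  obtain ⟨r', hr', hrU⟩ := Metric.nhds_basis_closedBall.mem_iff.1 hU
  obtain ⟨ε', hε', hεV⟩ := Metric.mem_nhds_iff.1 hV
  refine ⟨min r r', lt_min (by exact_mod_cast hr) hr', min ε ε', lt_min hε hε', fun q hqr ↦ ?_⟩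
  have hqr1 : q ∈ Metric.closedBall q₀ r := Metric.closedBall_subset_closedBall (min_le_left _ _) hqr
  have hqU : q ∈ U := hrU (Metric.closedBall_subset_closedBall (min_le_right _ _) hqr)
  refine ⟨fun t ↦ α (q, t), (hα q hqr1).1, fun t ht ↦ ?_⟩
  have ht1 : -ε < t ∧ t < ε := ⟨lt_of_le_of_lt (neg_le_neg (min_le_left _ _)) ht.1,
    lt_of_lt_of_le ht.2 (min_le_left _ _)⟩
  have ht2 : t ∈ V := hεV (by
    rw [Metric.mem_ball, dist_zero_right, Real.norm_eq_abs, abs_lt]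
    exact ⟨lt_of_le_of_lt (neg_le_neg (min_le_right _ _)) ht.1,
      lt_of_lt_of_le ht.2 (min_le_right _ _)⟩)
  have h3 := hUV (mk_mem_prod hqU ht2)
  refine ⟨?_, h3.1, h3.2⟩
  have hIoo : Icc (0 - ε) (0 + ε) ∈ 𝓝 t := Icc_mem_nhds (by simpa using ht1.1) (by simpa using ht1.2)
  exact ((hα q hqr1).2 t (mem_of_mem_nhds hIoo)).hasDerivAt hIoo

theorem geodesicField_solution_eventuallyEq (hcov : cov.ContMDiffCovariantDerivative ∞) {x₀ : M}
    {α β : ℝ → E × E} {t : ℝ} (hq : (α t).1 ∈ (extChartAt 𝓘(ℝ, E) x₀).target)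
    (hα : ∀ᶠ u in 𝓝 t, HasDerivAt α (geodesicField cov x₀ (α u)) u)
    (hβ : ∀ᶠ u in 𝓝 t, HasDerivAt β (geodesicField cov x₀ (β u)) u) (h : α t = β t) :
    α =ᶠ[𝓝 t] β := by
  obtain ⟨K, U, hU, hL⟩ := (contDiffAt_geodesicField hcov hq).exists_lipschitzOnWith
  refine ODE_solution_unique_of_eventually (v := fun _ ↦ geodesicField cov x₀) (s := fun _ ↦ U)
    (Eventually.of_forall fun _ ↦ hL) ?_ ?_ h
  · exact hα.and (hα.self_of_nhds.continuousAt hU)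
  · exact hβ.and (hβ.self_of_nhds.continuousAt (h ▸ hU))

end SmoothExtension

section Continuation

variable {E : Type*} [NormedAddCommGroup E] [NormedSpace ℝ E] [FiniteDimensional ℝ E]
  {M : Type*} [TopologicalSpace M] [T2Space M] [ChartedSpace E M] [IsManifold 𝓘(ℝ, E) ∞ M]
  {cov : CovariantDerivative 𝓘(ℝ, E) E (fun x : M ↦ TangentSpace 𝓘(ℝ, E) x)}
  {γ η : ℝ → M} {s s' : Set ℝ} {t : ℝ} {x₀ : M}

theorem IsGeodesicOn.eventually_source (h : IsGeodesicOn cov γ s) (hs : s ∈ 𝓝 t)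
    (h₀ : γ t ∈ (chartAt E x₀).source) : ∀ᶠ u in 𝓝 t, γ u ∈ (chartAt E x₀).source :=
  (h.1.continuousOn.continuousAt hs) (chart_source_mem_nhds_of_mem h₀)

theorem IsGeodesicOn.eventually_hasDerivAt (h : IsGeodesicOn cov γ s) (hs : s ∈ 𝓝 t)
    (h₀ : γ t ∈ (chartAt E x₀).source) :
    ∀ᶠ u in 𝓝 t, HasDerivAt (chartPhase x₀ γ) (geodesicField cov x₀ (chartPhase x₀ γ u)) u := by
  filter_upwards [h.eventually_source hs h₀, eventually_mem_nhds_iff.2 hs] with u hu hus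
  exact h.hasDerivAt_chartPhase hus hu

theorem IsGeodesicOn.eventuallyEq (hcov : cov.ContMDiffCovariantDerivative ∞)
    (hγ : IsGeodesicOn cov γ s) (hη : IsGeodesicOn cov η s') (hs : s ∈ 𝓝 t) (hs' : s' ∈ 𝓝 t)
    (h₀ : γ t ∈ (chartAt E x₀).source) (h₁ : η t ∈ (chartAt E x₀).source)
    (h : (chartPhase x₀ γ t : E × E) = chartPhase x₀ η t) : γ =ᶠ[𝓝 t] η := by
  have := geodesicField_solution_eventuallyEq hcov (x₀ := x₀)
    ((extChartAt 𝓘(ℝ, E) x₀).map_source (by simpa using h₀))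
    (hγ.eventually_hasDerivAt hs h₀) (hη.eventually_hasDerivAt hs' h₁) h
  filter_upwards [this, hγ.eventually_source hs h₀, hη.eventually_source hs' h₁] with u hu h1 h2
  rw [← symm_chartPhase_fst (E := E) h1, ← symm_chartPhase_fst (E := E) h2, hu]

/-- Two geodesics on an open interval which agree near a point are equal. -/
theorem IsGeodesicOn.eqOn (hcov : cov.ContMDiffCovariantDerivative ∞)
    (hs : IsOpen s) (hc : IsPreconnected s)
    (hγ : IsGeodesicOn cov γ s) (hη : IsGeodesicOn cov η s) (ht : t ∈ s) (h : γ =ᶠ[𝓝 t] η) :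
    EqOn γ η s := by
  have key : s ⊆ {u | γ =ᶠ[𝓝 u] η} := by
    refine hc.subset_of_closure_inter_subset isOpen_setOfPred_eventually_nhds ⟨t, ht, h⟩ ?_
    rintro u ⟨hu, hus⟩
    have hus' := hs.mem_nhds hus
    have hfr : ∃ᶠ w in 𝓝 u, γ =ᶠ[𝓝 w] η := mem_closure_iff_frequently.1 hu
    have h1 : γ u = η u := tendsto_nhds_unique_of_frequently_eq
      (hγ.1.continuousOn.continuousAt hus') (hη.1.continuousOn.continuousAt hus')
      (hfr.mono fun w hw ↦ hw.self_of_nhds)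
    have h2 : (chartPhase (γ u) γ u : E × E) = chartPhase (γ u) η u :=
      tendsto_nhds_unique_of_frequently_eq
        (hγ.hasDerivAt_chartPhase hus' (mem_chart_source E _)).continuousAt
        (hη.hasDerivAt_chartPhase hus' (h1 ▸ mem_chart_source E _)).continuousAt
        (hfr.mono fun w hw ↦ chartPhase_congr hw)
    exact hγ.eventuallyEq hcov hη hus' hus' (mem_chart_source E _) (h1 ▸ mem_chart_source E _) h2
  exact fun u hu ↦ (key hu).self_of_nhds

theorem IsGeodesicOn.glue {τ : ℝ} {U : Set ℝ} (hγ : IsGeodesicOn cov γ s)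
    (hη : IsGeodesicOn cov η s') (hs : IsOpen s) (hs' : IsOpen s') (hU : IsOpen U)
    (hτ : τ ∈ s) (he : γ =ᶠ[𝓝 τ] η) (h1 : ∀ t ∈ U, t < τ → t ∈ s) (h2 : ∀ t ∈ U, τ < t → t ∈ s') :
    IsGeodesicOn cov (fun t ↦ if t < τ then γ t else η t) U := by
  refine isGeodesicOn_of_locally hU fun t ht ↦ ?_
  rcases lt_trichotomy t τ with h | h | h
  · refine ⟨γ, s, hs.mem_nhds (h1 t ht h), hγ, ?_⟩
    filter_upwards [Iio_mem_nhds h] with u hu using if_pos hu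
  · subst h
    refine ⟨γ, s, hs.mem_nhds hτ, hγ, ?_⟩
    filter_upwards [he] with u hu
    rw [hu, ite_self]
  · refine ⟨η, s', hs'.mem_nhds (h2 t ht h), hη, ?_⟩
    filter_upwards [Ioi_mem_nhds h] with u hu using if_neg (not_lt.2 (le_of_lt hu))

variable (cov) in
/-- Every geodesic on a bounded open interval can be extended beyond its right endpoint. -/
def GeodesicsExtendForward : Prop :=
  ∀ (γ : ℝ → M) (a b : ℝ), a < b → IsGeodesicOn cov γ (Ioo a b) →
    ∃ η : ℝ → M, ∃ b' > b, IsGeodesicOn cov η (Ioo a b') ∧ EqOn η γ (Ioo a b)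

theorem GeodesicsExtendForward.exists_Ioi (hcov : cov.ContMDiffCovariantDerivative ∞)
    (hF : GeodesicsExtendForward cov) {a b : ℝ} (hab : a < b) (hγ : IsGeodesicOn cov γ (Ioo a b)) :
    ∃ η : ℝ → M, IsGeodesicOn cov η (Ioi a) ∧ EqOn η γ (Ioo a b) := by
  let S : Set ℝ := {T | b ≤ T ∧ ∃ η : ℝ → M, IsGeodesicOn cov η (Ioo a T) ∧ EqOn η γ (Ioo a b)}
  have hbS : b ∈ S := ⟨le_rfl, γ, hγ, fun _ _ ↦ rfl⟩
  have huniq : ∀ T ∈ S, ∀ T' ∈ S, ∀ η η' : ℝ → M, IsGeodesicOn cov η (Ioo a T) →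
      EqOn η γ (Ioo a b) → IsGeodesicOn cov η' (Ioo a T') → EqOn η' γ (Ioo a b) →
      EqOn η η' (Ioo a (min T T')) := by
    intro T hT T' hT' η η' h1 h2 h3 h4
    have hm : Ioo a b ∈ 𝓝 ((a + b) / 2) := Ioo_mem_nhds (by linarith) (by linarith)
    refine IsGeodesicOn.eqOn (t := (a + b) / 2) hcov isOpen_Ioo isPreconnected_Ioo
      (h1.mono (Ioo_subset_Ioo_right (min_le_left _ _)) isOpen_Ioo.uniqueDiffOn)
      (h3.mono (Ioo_subset_Ioo_right (min_le_right _ _)) isOpen_Ioo.uniqueDiffOn) ?_ ?_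
    · exact ⟨by linarith, lt_of_lt_of_le (by linarith) (le_min hT.1 hT'.1)⟩
    · filter_upwards [hm] with u hu
      rw [h2 hu, h4 hu]
  let U : Set ℝ := {t | a < t ∧ ∃ T ∈ S, t < T}
  have hch : ∀ t, t ∈ U → ∃ T, ∃ η : ℝ → M, t < T ∧ T ∈ S ∧ IsGeodesicOn cov η (Ioo a T) ∧
      EqOn η γ (Ioo a b) := by
    rintro t ⟨-, T, hT, htT⟩
    obtain ⟨hbT, η, h1, h2⟩ := hT
    exact ⟨T, η, htT, ⟨hbT, η, h1, h2⟩, h1, h2⟩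
  have : Nonempty (ℝ → M) := ⟨γ⟩
  choose! T ζ hT1 hT2 hT3 hT4 using hch
  have hUo : IsOpen U := by
    have : U = ⋃ T ∈ S, Ioo a T := by
      ext t
      simp only [U, mem_iUnion, mem_Ioo, exists_prop, mem_ofPred_eq]
      grind
    rw [this]
    exact isOpen_biUnion fun _ _ ↦ isOpen_Ioo
  have hη : IsGeodesicOn cov (fun t ↦ ζ t t) U := by
    refine isGeodesicOn_of_locally hUo fun t ht ↦ ?_
    refine ⟨ζ t, Ioo a (T t), Ioo_mem_nhds ht.1 (hT1 t ht), hT3 t ht, ?_⟩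
    filter_upwards [Ioo_mem_nhds ht.1 (hT1 t ht)] with u hu
    have huU : u ∈ U := ⟨hu.1, T t, hT2 t ht, hu.2⟩
    exact huniq _ (hT2 u huU) _ (hT2 t ht) _ _ (hT3 u huU) (hT4 u huU) (hT3 t ht) (hT4 t ht)
      ⟨hu.1, lt_min (hT1 u huU) hu.2⟩
  have hηγ : EqOn (fun t ↦ ζ t t) γ (Ioo a b) := fun t ht ↦ hT4 t ⟨ht.1, b, hbS, ht.2⟩ ht
  by_cases hbdd : BddAbove S
  · exfalso
    have hUI : Ioo a (sSup S) = U := by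
      ext t
      refine ⟨fun ht ↦ ⟨ht.1, ?_⟩, fun ht ↦ ⟨ht.1, ?_⟩⟩
      · obtain ⟨T, hT, h⟩ := exists_lt_of_lt_csSup ⟨b, hbS⟩ ht.2
        exact ⟨T, hT, h⟩
      · obtain ⟨T, hT, h⟩ := ht.2
        exact lt_of_lt_of_le h (le_csSup hbdd hT)
    have hbs : b ≤ sSup S := le_csSup hbdd hbS
    obtain ⟨η', b', hb', h1, h2⟩ := hF _ a (sSup S) (lt_of_lt_of_le hab hbs) (hUI ▸ hη)
    have : b' ∈ S := ⟨hbs.trans hb'.le, η', h1, fun t ht ↦ by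
      rw [h2 ⟨ht.1, lt_of_lt_of_le ht.2 hbs⟩]
      exact hηγ ht⟩
    exact absurd (le_csSup hbdd this) (not_le.2 hb')
  · have hUI : Ioi a = U := by
      ext t
      refine ⟨fun ht ↦ ⟨ht, ?_⟩, fun ht ↦ ht.1⟩
      obtain ⟨T, hT, h⟩ := not_bddAbove_iff.1 hbdd t
      exact ⟨T, hT, h⟩
    exact ⟨_, hUI ▸ hη, hηγ⟩

theorem GeodesicsExtendForward.exists_univ (hcov : cov.ContMDiffCovariantDerivative ∞)
    (hF : GeodesicsExtendForward cov) {a b : ℝ} (hab : a < b) (hγ : IsGeodesicOn cov γ (Ioo a b)) :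
    ∃ η : ℝ → M, IsGeodesicOn cov η univ ∧ EqOn η γ (Ioo a b) := by
  obtain ⟨η₁, h₁, e₁⟩ := hF.exists_Ioi hcov hab hγ
  have hr : IsGeodesicOn cov (fun u ↦ γ (-1 * u + 0)) (Ioo (-b) (-a)) := by
    refine (hγ.comp_affine isOpen_Ioo (-1) 0).mono (fun u hu ↦ ?_) isOpen_Ioo.uniqueDiffOn
    simp only [mem_preimage, mem_Ioo] at hu ⊢
    constructor <;> linarith
  obtain ⟨η₂, h₂, e₂⟩ := hF.exists_Ioi hcov (neg_lt_neg hab) hr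
  have h₃ := h₂.comp_affine isOpen_Ioi (-1) 0
  have hpre : (fun u : ℝ ↦ -1 * u + 0) ⁻¹' (Ioi (-b)) = Iio b := by
    ext u
    simp only [mem_preimage, mem_Ioi, mem_Iio]
    constructor <;> intro h <;> linarith
  rw [hpre] at h₃
  have e₃ : EqOn (fun u ↦ η₂ (-1 * u + 0)) γ (Ioo a b) := by
    intro u hu
    have : -1 * u + 0 ∈ Ioo (-b) (-a) := by
      constructor <;> linarith [hu.1, hu.2]
    simp only [e₂ this]
    congr 1
    ring
  have hmid : (a + b) / 2 ∈ Ioo a b := ⟨by linarith, by linarith⟩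
  refine ⟨_, IsGeodesicOn.glue (τ := (a + b) / 2) h₃ h₁ isOpen_Iio isOpen_Ioi isOpen_univ hmid.2 ?_
    (fun t _ ht ↦ lt_trans ht hmid.2) (fun t _ ht ↦ lt_trans hmid.1 ht), fun t ht ↦ ?_⟩
  · filter_upwards [isOpen_Ioo.mem_nhds hmid] with u hu
    exact (e₃ hu).trans (e₁ hu).symm
  · by_cases h : t < (a + b) / 2
    · simp only [h, if_true]
      exact e₃ ht
    · simp only [h, if_false]
      exact e₁ ht

theorem GeodesicsExtendForward.geodesicallyComplete (hcov : cov.ContMDiffCovariantDerivative ∞)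
    (hF : GeodesicsExtendForward cov) : GeodesicallyComplete cov := by
  intro γ l hl hγ
  obtain ⟨η, h1, h2⟩ := hF.exists_univ hcov hl
    (hγ.mono Ioo_subset_Icc_self isOpen_Ioo.uniqueDiffOn)
  refine ⟨η, h1, ?_⟩
  have := h2.of_subset_closure (h1.1.continuousOn.mono (subset_univ _)) hγ.1.continuousOn
    Ioo_subset_Icc_self (by rw [closure_Ioo hl.ne])
  exact this

theorem exists_geodesic (hcov : cov.ContMDiffCovariantDerivative ∞) (x₀ : M) {q : E × E}
    (hq : q.1 ∈ (extChartAt 𝓘(ℝ, E) x₀).target) :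
    ∃ γ : ℝ → M, ∃ ε > 0, IsGeodesicOn cov γ (Ioo (-ε) ε) ∧ chartPhase x₀ γ 0 = q ∧
      γ 0 = (extChartAt 𝓘(ℝ, E) x₀).symm q.1 := by
  obtain ⟨r, hr, ε, hε, h⟩ := exists_geodesicField_flow hcov hq univ_mem
  obtain ⟨α, h0, hα⟩ := h q (Metric.mem_closedBall_self hr.le)
  refine ⟨fun u ↦ (extChartAt 𝓘(ℝ, E) x₀).symm (α u).1, ε, hε,
    isGeodesicOn_of_hasDerivAt isOpen_Ioo (fun u hu ↦ (hα u hu).1) (fun u hu ↦ (hα u hu).2.2), ?_, ?_⟩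
  · have h0' : (0 : ℝ) ∈ Ioo (-ε) ε := ⟨by linarith, hε⟩
    rw [(chartPhase_of_hasDerivAt (cov := cov) (by
      filter_upwards [isOpen_Ioo.mem_nhds h0'] with u hu using (hα u hu).1) (hα 0 h0').2.2).2, h0]
  · simp only [h0]

theorem GeodesicsExtendForward.geodesicExp_dom (hcov : cov.ContMDiffCovariantDerivative ∞)
    (hF : GeodesicsExtendForward cov) : (geodesicExp cov).Dom = univ := by
  refine eq_univ_of_forall fun v ↦ ?_
  set x₀ := v.1 with hx₀
  have hs : x₀ ∈ (chartAt E x₀).source := mem_chart_source E x₀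
  obtain ⟨γ, ε, hε, hγ, hph, h0⟩ := exists_geodesic hcov x₀
    (q := (extChartAt 𝓘(ℝ, E) x₀ x₀, chartCoord x₀ x₀ v.2)) (mem_extChartAt_target x₀)
  obtain ⟨η, h1, h2⟩ := hF.exists_univ hcov (by linarith : -ε < ε) hγ
  refine ⟨η, h1.mono (subset_univ _) (uniqueDiffOn_Icc one_pos), ?_⟩
  rw [curveVelocity_mono (h1.mdifferentiableWithinAt (mem_univ 0)) (subset_univ _)
    (uniqueDiffOn_Icc one_pos 0 (by simp))]
  have he : η =ᶠ[𝓝 0] γ := h2.eventuallyEq_of_mem (Ioo_mem_nhds (by linarith) hε)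
  rw [EventuallyEq.curveVelocity_heq he]
  have hγ0 : γ 0 = x₀ := by
    rw [h0]
    exact extChartAt_to_inv x₀
  have h3 : chartCoord x₀ (γ 0) (curveVelocity 𝓘(ℝ, E) γ univ 0) = chartCoord x₀ x₀ v.2 :=
    congrArg Prod.snd hph
  have hinj := (trivializationAt E (TangentSpace 𝓘(ℝ, E)) x₀).injOn
  refine hinj ?_ ?_ ?_
  · rw [Trivialization.mem_source]
    simp [hγ0]
  · rw [Trivialization.mem_source]
    simp [hx₀]
  · refine Prod.ext hγ0 ?_
    refine (trivializationAt_snd (by rw [hγ0]; exact hs) _).trans (h3.trans ?_)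
    exact (trivializationAt_snd hs v.2).symm

end Continuation

section Metric

variable {E : Type*} [NormedAddCommGroup E] [NormedSpace ℝ E]
  {M : Type*} [TopologicalSpace M] [ChartedSpace E M] [IsManifold 𝓘(ℝ, E) ∞ M]

/-- The coefficients of a field of bilinear forms in the chart at `x₀`. -/
def chartMetric (g : ∀ x : M, TangentSpace 𝓘(ℝ, E) x →L[ℝ] TangentSpace 𝓘(ℝ, E) x →L[ℝ] ℝ) (x₀ : M)
    (z : E) : E →L[ℝ] E →L[ℝ] ℝ :=
  (ContinuousLinearMap.precomp ℝ (chartVec x₀ ((extChartAt 𝓘(ℝ, E) x₀).symm z))).comp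
    ((g ((extChartAt 𝓘(ℝ, E) x₀).symm z)).comp (chartVec x₀ _))

/-- `g` is a smooth Riemannian metric. -/
structure IsSmoothMetric
    (g : ∀ x : M, TangentSpace 𝓘(ℝ, E) x →L[ℝ] TangentSpace 𝓘(ℝ, E) x →L[ℝ] ℝ) : Prop where
  symm : ∀ x v w, g x v w = g x w v
  pos : ∀ x v, v ≠ 0 → 0 < g x v v
  smooth : ∀ x₀ : M, ContDiffOn ℝ ∞ (chartMetric g x₀) (extChartAt 𝓘(ℝ, E) x₀).target

variable {g : ∀ x : M, TangentSpace 𝓘(ℝ, E) x →L[ℝ] TangentSpace 𝓘(ℝ, E) x →L[ℝ] ℝ} {x₀ p : M}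

theorem chartMetric_apply (z a b : E) :
    chartMetric g x₀ z a b = g ((extChartAt 𝓘(ℝ, E) x₀).symm z) (chartVec x₀ _ a) (chartVec x₀ _ b) :=
  rfl

theorem chartMetric_chartCoord (hp : p ∈ (chartAt E x₀).source) (v w : TangentSpace 𝓘(ℝ, E) p) :
    chartMetric g x₀ (extChartAt 𝓘(ℝ, E) x₀ p) (chartCoord x₀ p v) (chartCoord x₀ p w) = g p v w := by
  have : (extChartAt 𝓘(ℝ, E) x₀).symm (extChartAt 𝓘(ℝ, E) x₀ p) = p :=
    (extChartAt 𝓘(ℝ, E) x₀).left_inv (by simpa using hp)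
  rw [chartMetric_apply, this, chartVec_chartCoord hp, chartVec_chartCoord hp]

theorem IsSmoothMetric.chartMetric_symm (hg : IsSmoothMetric g) (z a b : E) :
    chartMetric g x₀ z a b = chartMetric g x₀ z b a :=
  hg.symm _ _ _

theorem IsSmoothMetric.chartMetric_pos (hg : IsSmoothMetric g) {z : E}
    (hz : z ∈ (extChartAt 𝓘(ℝ, E) x₀).target) {a : E} (ha : a ≠ 0) : 0 < chartMetric g x₀ z a a := by
  refine hg.pos _ _ fun h ↦ ha ?_
  have hs : (extChartAt 𝓘(ℝ, E) x₀).symm z ∈ (chartAt E x₀).source := by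
    rw [← extChartAt_source 𝓘(ℝ, E) x₀]
    exact (extChartAt 𝓘(ℝ, E) x₀).map_target hz
  rw [← chartCoord_chartVec hs a]
  exact (congrArg (chartCoord x₀ _) h).trans (map_zero _)

theorem IsSmoothMetric.nonneg (hg : IsSmoothMetric g) (x : M) (v : TangentSpace 𝓘(ℝ, E) x) :
    0 ≤ g x v v := by
  by_cases h : v = 0
  · simp [h]
  · exact (hg.pos x v h).le

theorem IsSmoothMetric.contDiffAt (hg : IsSmoothMetric g) {z : E}
    (hz : z ∈ (extChartAt 𝓘(ℝ, E) x₀).target) : ContDiffAt ℝ ∞ (chartMetric g x₀) z :=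
  (hg.smooth x₀).contDiffAt ((isOpen_extChartAt_target x₀).mem_nhds hz)

variable [FiniteDimensional ℝ E]

/-- A positive definite bilinear form on a finite dimensional space is bounded below. -/
theorem exists_pos_mul_sq_le_of_posDef (B : E →L[ℝ] E →L[ℝ] ℝ) (hB : ∀ a, a ≠ 0 → 0 < B a a) :
    ∃ l > 0, ∀ a, l * ‖a‖ ^ 2 ≤ B a a := by
  have : ProperSpace E := FiniteDimensional.proper ℝ E
  obtain ⟨l, hl, h⟩ := (isCompact_sphere (0 : E) 1).exists_forall_le' (f := fun a ↦ B a a) (a := 0)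
    (by fun_prop) (fun a ha ↦ hB a (ne_zero_of_mem_unit_sphere ⟨a, ha⟩))
  refine ⟨l, hl, fun a ↦ ?_⟩
  by_cases ha : a = 0
  · simp [ha]
  have h1 := h (‖a‖⁻¹ • a) (by simp [norm_smul, ha])
  simp only [map_smul, smul_apply, smul_eq_mul] at h1
  have h2 : 0 < ‖a‖ := norm_pos_iff.2 ha
  calc l * ‖a‖ ^ 2 ≤ (‖a‖⁻¹ * (‖a‖⁻¹ * B a a)) * ‖a‖ ^ 2 := by gcongr
    _ = B a a := by field_simp

theorem IsSmoothMetric.exists_bounds (hg : IsSmoothMetric g) {z₀ : E}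
    (hz : z₀ ∈ (extChartAt 𝓘(ℝ, E) x₀).target) :
    ∃ l > 0, ∃ C > 0, ∀ᶠ z in 𝓝 z₀, ∀ a, l * ‖a‖ ^ 2 ≤ chartMetric g x₀ z a a ∧
      chartMetric g x₀ z a a ≤ C * ‖a‖ ^ 2 := by
  obtain ⟨l, hl, h⟩ := exists_pos_mul_sq_le_of_posDef (chartMetric g x₀ z₀)
    fun a ha ↦ hg.chartMetric_pos hz ha
  have hc := (hg.contDiffAt hz).continuousAt
  refine ⟨l / 2, by positivity, ‖chartMetric g x₀ z₀‖ + l / 2, by positivity, ?_⟩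
  filter_upwards [Metric.continuousAt_iff'.1 hc (l / 2) (by positivity)] with z hz a
  rw [dist_eq_norm] at hz
  have h1 : |(chartMetric g x₀ z - chartMetric g x₀ z₀) a a| ≤ l / 2 * ‖a‖ ^ 2 := by
    have := (chartMetric g x₀ z - chartMetric g x₀ z₀).le_opNorm₂ a a
    rw [Real.norm_eq_abs] at this
    refine this.trans ?_
    rw [mul_assoc, ← sq]
    gcongr
  have h2 : |chartMetric g x₀ z₀ a a| ≤ ‖chartMetric g x₀ z₀‖ * ‖a‖ ^ 2 := by
    have := (chartMetric g x₀ z₀).le_opNorm₂ a a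
    rwa [Real.norm_eq_abs, mul_assoc, ← sq] at this
  have h3 := h a
  simp only [sub_apply] at h1
  rw [abs_le] at h1 h2
  constructor <;> nlinarith

variable {cov : CovariantDerivative 𝓘(ℝ, E) E (fun x : M ↦ TangentSpace 𝓘(ℝ, E) x)}

variable (g cov) in
/-- The metric `g` is parallel, expressed in charts. -/
def IsParallelMetric : Prop :=
  ∀ x₀ : M, ∀ z ∈ (extChartAt 𝓘(ℝ, E) x₀).target, ∀ w a b : E,
    fderiv ℝ (chartMetric g x₀) z w a b =
      chartMetric g x₀ z (christoffel cov x₀ z a w) b + chartMetric g x₀ z a (christoffel cov x₀ z b w)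

variable {γ : ℝ → M} {s : Set ℝ} {t : ℝ}

variable (g) in
/-- The square of the speed of a curve. -/
def speedSq (γ : ℝ → M) (t : ℝ) : ℝ :=
  g (γ t) (curveVelocity 𝓘(ℝ, E) γ univ t) (curveVelocity 𝓘(ℝ, E) γ univ t)

theorem speedSq_eq (h : γ t ∈ (chartAt E x₀).source) :
    speedSq g γ t = chartMetric g x₀ (chartPhase x₀ γ t : E × E).1 (chartPhase x₀ γ t : E × E).2
      (chartPhase x₀ γ t : E × E).2 :=
  (chartMetric_chartCoord h _ _).symm

theorem hasDerivAt_chartMetric (hg : IsSmoothMetric g) {z : ℝ → E} {z' a a' b b' : _}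
    {u v : ℝ → E} (hz : z t ∈ (extChartAt 𝓘(ℝ, E) x₀).target) (hz' : HasDerivAt z z' t)
    (ha : u t = a) (hb : v t = b) (hu : HasDerivAt u a' t) (hv : HasDerivAt v b' t) :
    HasDerivAt (fun r ↦ chartMetric g x₀ (z r) (u r) (v r))
      (fderiv ℝ (chartMetric g x₀) (z t) z' a b + chartMetric g x₀ (z t) a' b +
        chartMetric g x₀ (z t) a b') t := by
  have h1 : HasDerivAt (fun r ↦ chartMetric g x₀ (z r)) (fderiv ℝ (chartMetric g x₀) (z t) z') t :=
    ((hg.contDiffAt hz).differentiableAt (by simp)).hasFDerivAt.comp_hasDerivAt t hz'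
  subst ha hb
  have := (h1.clm_apply hu).clm_apply hv
  simpa using this

variable [T2Space M]

/-- Geodesics of a metric connection have constant speed. -/
theorem IsGeodesicOn.speedSq_eq_of_mem (hg : IsSmoothMetric g) (hm : IsParallelMetric g cov)
    (h : IsGeodesicOn cov γ s) (hs : IsOpen s) (hc : IsPreconnected s) {t u : ℝ} (ht : t ∈ s)
    (hu : u ∈ s) : speedSq g γ t = speedSq g γ u := by
  have key : ∀ t ∈ s, HasDerivAt (speedSq g γ) 0 t := by
    intro t ht
    have h0 := hs.mem_nhds ht
    have hsrc := h.eventually_source h0 (mem_chart_source E (γ t))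
    have hd := h.hasDerivAt_chartPhase h0 (mem_chart_source E (γ t))
    have hz : (chartPhase (γ t) γ t : E × E).1 ∈ (extChartAt 𝓘(ℝ, E) (γ t)).target :=
      mem_extChartAt_target (γ t)
    have h1 := hasDerivAt_chartMetric (x₀ := γ t) hg hz hd.fst rfl rfl hd.snd hd.snd
    rw [hm _ _ hz] at h1
    refine (h1.congr_of_eventuallyEq ?_).congr_deriv ?_
    · filter_upwards [hsrc] with u hu using speedSq_eq hu
    · simp only [geodesicField, map_neg, neg_apply]
      ring
  exact hs.is_const_of_deriv_eq_zero hc (fun t ht ↦ (key t ht).differentiableAt.differentiableWithinAt)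
    (fun t ht ↦ (key t ht).deriv) ht hu

theorem exists_geodesic_uniform (hcov : cov.ContMDiffCovariantDerivative ∞) (x₀ : M) {q₀ : E × E}
    (hq : q₀.1 ∈ (extChartAt 𝓘(ℝ, E) x₀).target) :
    ∃ ε > 0, ∀ᶠ q in 𝓝 q₀, ∃ γ : ℝ → M, IsGeodesicOn cov γ (Ioo (-ε) ε) ∧ chartPhase x₀ γ 0 = q ∧
      γ 0 ∈ (chartAt E x₀).source := by
  obtain ⟨r, hr, ε, hε, h⟩ := exists_geodesicField_flow hcov hq univ_mem
  refine ⟨ε, hε, ?_⟩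
  filter_upwards [Metric.closedBall_mem_nhds q₀ hr] with q hqr
  obtain ⟨α, h0, hα⟩ := h q hqr
  have h0' : (0 : ℝ) ∈ Ioo (-ε) ε := ⟨by linarith, hε⟩
  refine ⟨fun u ↦ (extChartAt 𝓘(ℝ, E) x₀).symm (α u).1,
    isGeodesicOn_of_hasDerivAt isOpen_Ioo (fun u hu ↦ (hα u hu).1) (fun u hu ↦ (hα u hu).2.2), ?_, ?_⟩
  · rw [(chartPhase_of_hasDerivAt (cov := cov) (by
      filter_upwards [isOpen_Ioo.mem_nhds h0'] with u hu using (hα u hu).1) (hα 0 h0').2.2).2, h0]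
  · rw [← extChartAt_source 𝓘(ℝ, E) x₀]
    exact (extChartAt 𝓘(ℝ, E) x₀).map_target (hα 0 h0').2.2

/-- A geodesic of a metric connection which accumulates at a point as `t → b` extends beyond `b`. -/
theorem IsGeodesicOn.exists_extend_of_tendsto (hcov : cov.ContMDiffCovariantDerivative ∞)
    (hg : IsSmoothMetric g) (hm : IsParallelMetric g cov) {a b : ℝ} (h : IsGeodesicOn cov γ (Ioo a b))
    {τ : ℕ → ℝ} (hτ : ∀ i, τ i ∈ Ioo a b) (hτb : Tendsto τ atTop (𝓝 b)) {q : M}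
    (hq : Tendsto (fun i ↦ γ (τ i)) atTop (𝓝 q)) :
    ∃ η : ℝ → M, ∃ b' > b, IsGeodesicOn cov η (Ioo a b') ∧ EqOn η γ (Ioo a b) := by
  have : ProperSpace E := FiniteDimensional.proper ℝ E
  have hqs : q ∈ (chartAt E q).source := mem_chart_source E q
  obtain ⟨l, hl, C, -, hb⟩ := hg.exists_bounds (mem_extChartAt_target (I := 𝓘(ℝ, E)) q)
  have hz : Tendsto (fun i ↦ extChartAt 𝓘(ℝ, E) q (γ (τ i))) atTop (𝓝 (extChartAt 𝓘(ℝ, E) q q)) :=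
    (continuousAt_extChartAt q).tendsto.comp hq
  have hsrc : ∀ᶠ i in atTop, γ (τ i) ∈ (chartAt E q).source :=
    hq.eventually (chart_source_mem_nhds_of_mem hqs)
  set c := speedSq g γ (τ 0) with hc
  have hsp : ∀ i, speedSq g γ (τ i) = c := fun i ↦
    h.speedSq_eq_of_mem hg hm isOpen_Ioo isPreconnected_Ioo (hτ i) (hτ 0)
  have hbd : ∀ᶠ i in atTop, (chartPhase q γ (τ i) : E × E).2 ∈ Metric.closedBall (0 : E) (c / l + 1) := by
    filter_upwards [hsrc, hz.eventually hb] with i h1 h2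
    have h3 := (h2 (chartPhase q γ (τ i) : E × E).2).1
    have h4 := speedSq_eq (g := g) h1
    rw [hsp i] at h4
    rw [mem_closedBall_zero_iff]
    have h5 : l * ‖(chartPhase q γ (τ i) : E × E).2‖ ^ 2 ≤ c := h3.trans h4.ge
    have h6 : ‖(chartPhase q γ (τ i) : E × E).2‖ ^ 2 ≤ c / l := by
      rw [le_div_iff₀ hl]
      linarith
    nlinarith [sq_nonneg (‖(chartPhase q γ (τ i) : E × E).2‖ - 1)]
  obtain ⟨w, -, ψ, hψ, hw⟩ := (isCompact_closedBall (0 : E) (c / l + 1)).tendsto_subseq'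
    hbd.frequently
  obtain ⟨ε, hε, hex⟩ := exists_geodesic_uniform hcov q (q₀ := (extChartAt 𝓘(ℝ, E) q q, w))
    (mem_extChartAt_target q)
  have hph : Tendsto (fun i ↦ (chartPhase q γ (τ (ψ i)) : E × E)) atTop
      (𝓝 (extChartAt 𝓘(ℝ, E) q q, w)) :=
    (hz.comp hψ.tendsto_atTop).prodMk_nhds hw
  have hτψ := hτb.comp hψ.tendsto_atTop
  obtain ⟨i, ⟨η, hη, hη0, hηs⟩, hi1, hi2⟩ := ((hph.eventually hex).and
    ((hτψ.eventually (Ioi_mem_nhds (by linarith : b - ε < b))).and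
      (hψ.tendsto_atTop.eventually hsrc))).exists
  set T := τ (ψ i) with hT
  have hTm : T ∈ Ioo a b := hτ _
  have hi1 : b - ε < T := hi1
  have hη' : IsGeodesicOn cov (fun u ↦ η (1 * u + -T)) (Ioo (T - ε) (T + ε)) := by
    refine (hη.comp_affine isOpen_Ioo 1 (-T)).mono (fun u hu ↦ ?_) isOpen_Ioo.uniqueDiffOn
    simp only [mem_preimage, mem_Ioo] at hu ⊢
    constructor <;> linarith
  have hTε : Ioo (T - ε) (T + ε) ∈ 𝓝 T := Ioo_mem_nhds (by linarith) (by linarith)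
  have hT0 : (1 * T + -T : ℝ) = 0 := by ring
  have hph0 : (chartPhase q γ T : E × E) = chartPhase q (fun u ↦ η (1 * u + -T)) T := by
    have hsrc0 : (fun u ↦ η (1 * u + -T)) T ∈ (chartAt E q).source := by
      change η (1 * T + -T) ∈ _
      rw [hT0]
      exact hηs
    rw [chartPhase_comp_affine (x₀ := q) (by
      rw [hT0]
      exact (hη.1.contMDiffAt (Ioo_mem_nhds (by linarith) hε)).mdifferentiableAt one_ne_zero)]
    rw [hT0, hη0, one_smul]
  have he : γ =ᶠ[𝓝 T] fun u ↦ η (1 * u + -T) :=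
    h.eventuallyEq hcov hη' (Ioo_mem_nhds hTm.1 hTm.2) hTε hi2 (by
      rw [hT0]
      exact hηs) hph0
  refine ⟨_, T + ε, by linarith, IsGeodesicOn.glue h hη' isOpen_Ioo isOpen_Ioo isOpen_Ioo hTm he
    (fun t ht h' ↦ ⟨ht.1, h'.trans hTm.2⟩) (fun t ht h' ↦ ⟨by linarith, ht.2⟩), fun t ht ↦ ?_⟩
  by_cases h' : t < T
  · simp only [h', if_true]
  · simp only [h', if_false]
    have hsub : Ioo (max a (T - ε)) b ⊆ Ioo (T - ε) (T + ε) :=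
      Ioo_subset_Ioo (le_max_right _ _) (by linarith)
    refine (IsGeodesicOn.eqOn hcov isOpen_Ioo isPreconnected_Ioo
      (h.mono (Ioo_subset_Ioo_left (le_max_left _ _)) isOpen_Ioo.uniqueDiffOn)
      (hη'.mono hsub isOpen_Ioo.uniqueDiffOn) (t := T) ⟨max_lt hTm.1 (by linarith), hTm.2⟩ he ?_).symm
    exact ⟨max_lt ht.1 (by linarith), ht.2⟩

end Metric

section Distance

variable {E : Type*} [NormedAddCommGroup E] [NormedSpace ℝ E]
  {M : Type*} [TopologicalSpace M] [ChartedSpace E M] [IsManifold 𝓘(ℝ, E) ∞ M]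
  (g : ∀ x : M, TangentSpace 𝓘(ℝ, E) x →L[ℝ] TangentSpace 𝓘(ℝ, E) x →L[ℝ] ℝ)

/-- The norm of tangent vectors given by `g`. -/
@[reducible] def metricENorm (x : M) : ENorm (TangentSpace 𝓘(ℝ, E) x) :=
  ⟨fun v ↦ ENNReal.ofReal (Real.sqrt (g x v v))⟩

theorem enormSMulClass_metricENorm (x : M) :
    @ENormSMulClass ℝ (TangentSpace 𝓘(ℝ, E) x) _ (metricENorm g x) _ := by
  let _ := metricENorm g x
  refine ⟨fun c v ↦ ?_⟩
  change ENNReal.ofReal (Real.sqrt (g x (c • v) (c • v))) =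
    ‖c‖ₑ * ENNReal.ofReal (Real.sqrt (g x v v))
  rw [← ofReal_norm, ← ENNReal.ofReal_mul (norm_nonneg c), Real.norm_eq_abs,
    ← Real.sqrt_sq_eq_abs, ← Real.sqrt_mul (sq_nonneg c)]
  simp only [map_smul, smul_apply, smul_eq_mul]
  ring_nf

/-- The length of a curve on `[a, b]`. -/
def metricLength (γ : ℝ → M) (a b : ℝ) : ℝ≥0∞ :=
  ∫⁻ t in Icc a b, ENNReal.ofReal (Real.sqrt (speedSq g γ t))

/-- The Riemannian distance of `g`. -/
def metricDist (x y : M) : ℝ≥0∞ :=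
  letI := metricENorm g
  Manifold.riemannianEDist 𝓘(ℝ, E) x y

variable {g} {x y z : M} {γ : ℝ → M} {a b c : ℝ}

theorem pathELength_eq_metricLength :
    letI := metricENorm g
    Manifold.pathELength 𝓘(ℝ, E) γ a b = metricLength g γ a b := by
  let _ := metricENorm g
  rw [Manifold.pathELength_eq_lintegral_mfderiv_Icc]
  simp only [metricLength, speedSq, curveVelocity, mfderivWithin_univ]
  rfl

theorem metricDist_self : metricDist g x x = 0 := by
  let _ := metricENorm g
  have := enormSMulClass_metricENorm g
  exact Manifold.riemannianEDist_self

theorem metricDist_comm : metricDist g x y = metricDist g y x := by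
  let _ := metricENorm g
  have := enormSMulClass_metricENorm g
  exact Manifold.riemannianEDist_comm

theorem metricDist_triangle : metricDist g x z ≤ metricDist g x y + metricDist g y z := by
  let _ := metricENorm g
  have := enormSMulClass_metricENorm g
  exact Manifold.riemannianEDist_triangle

theorem metricDist_le_metricLength (hγ : ContMDiffOn 𝓘(ℝ, ℝ) 𝓘(ℝ, E) 1 γ (Icc a b)) (hab : a ≤ b) :
    metricDist g (γ a) (γ b) ≤ metricLength g γ a b := by
  let _ := metricENorm g
  have := enormSMulClass_metricENorm g
  rw [← pathELength_eq_metricLength]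
  exact Manifold.riemannianEDist_le_pathELength hγ rfl rfl hab

theorem exists_path_of_metricDist_lt {r : ℝ≥0∞} (h : metricDist g x y < r) :
    ∃ γ : ℝ → M, γ 0 = x ∧ γ 1 = y ∧ ContMDiff 𝓘(ℝ, ℝ) 𝓘(ℝ, E) 1 γ ∧ metricLength g γ 0 1 < r := by
  let _ := metricENorm g
  have := enormSMulClass_metricENorm g
  obtain ⟨γ, h0, h1, h2, h3, -⟩ :=
    Manifold.exists_lt_locally_constant_of_riemannianEDist_lt h zero_lt_one
  rw [pathELength_eq_metricLength] at h3
  exact ⟨γ, h0, h1, h2, h3⟩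

theorem metricLength_add (h : a ≤ b) (h' : b ≤ c) :
    metricLength g γ a b + metricLength g γ b c = metricLength g γ a c := by
  let _ := metricENorm g
  simp only [← pathELength_eq_metricLength]
  exact Manifold.pathELength_add h h'

theorem metricLength_mono {a' b' : ℝ} (h : a' ≤ a) (h' : b ≤ b') :
    metricLength g γ a b ≤ metricLength g γ a' b' :=
  lintegral_mono_set (Icc_subset_Icc h h')

theorem metricLength_le_of_speedSq_le {σ : ℝ} (hσ : 0 ≤ σ) (h : ∀ t ∈ Ioo a b, speedSq g γ t ≤ σ ^ 2) :
    metricLength g γ a b ≤ ENNReal.ofReal (σ * (b - a)) := by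
  rw [metricLength, ← restrict_Ioo_eq_restrict_Icc]
  calc ∫⁻ t in Ioo a b, ENNReal.ofReal (Real.sqrt (speedSq g γ t))
      ≤ ∫⁻ t in Ioo a b, ENNReal.ofReal σ := by
        refine setLIntegral_mono' measurableSet_Ioo fun t ht ↦ ENNReal.ofReal_le_ofReal ?_
        exact Real.sqrt_le_iff.2 ⟨hσ, h t ht⟩
    _ = ENNReal.ofReal (σ * (b - a)) := by
        rw [setLIntegral_const, Real.volume_Ioo, ENNReal.ofReal_mul hσ]

theorem metricDist_le_of_speedSq_le {σ : ℝ} (hσ : 0 ≤ σ)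
    (hγ : ContMDiffOn 𝓘(ℝ, ℝ) 𝓘(ℝ, E) 1 γ (Icc a b)) (hab : a ≤ b)
    (h : ∀ t ∈ Ioo a b, speedSq g γ t ≤ σ ^ 2) :
    metricDist g (γ a) (γ b) ≤ ENNReal.ofReal (σ * (b - a)) :=
  (metricDist_le_metricLength hγ hab).trans (metricLength_le_of_speedSq_le hσ h)

end Distance

section ChartEstimates

variable {E : Type*} [NormedAddCommGroup E] [NormedSpace ℝ E] [FiniteDimensional ℝ E]
  {M : Type*} [TopologicalSpace M] [ChartedSpace E M] [IsManifold 𝓘(ℝ, E) ∞ M]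
  {g : ∀ x : M, TangentSpace 𝓘(ℝ, E) x →L[ℝ] TangentSpace 𝓘(ℝ, E) x →L[ℝ] ℝ}
  {x₀ : M} {γ : ℝ → M} {a b t : ℝ}

theorem hasDerivAt_extChartAt_comp (h : MDifferentiableAt 𝓘(ℝ, ℝ) 𝓘(ℝ, E) γ t)
    (h₀ : γ t ∈ (chartAt E x₀).source) :
    HasDerivAt (fun u ↦ extChartAt 𝓘(ℝ, E) x₀ (γ u))
      (chartCoord x₀ (γ t) (curveVelocity 𝓘(ℝ, E) γ univ t)) t := by
  have := hasDerivWithinAt_chart_curve (s := univ) (mdifferentiableWithinAt_univ.2 h) h₀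
  exact hasDerivWithinAt_univ.1 this

theorem speedSq_eq_of_hasDerivAt (h : MDifferentiableAt 𝓘(ℝ, ℝ) 𝓘(ℝ, E) γ t)
    (h₀ : γ t ∈ (chartAt E x₀).source) {w : E}
    (hw : HasDerivAt (fun u ↦ extChartAt 𝓘(ℝ, E) x₀ (γ u)) w t) :
    speedSq g γ t = chartMetric g x₀ (extChartAt 𝓘(ℝ, E) x₀ (γ t)) w w := by
  rw [(hw.unique (hasDerivAt_extChartAt_comp h h₀)), chartMetric_chartCoord h₀]
  rfl

theorem contMDiffOn_extChartAt_symm_comp {n : WithTop ℕ∞} (hn : n ≤ (∞ : WithTop ℕ∞)) {z : ℝ → E} {s : Set ℝ}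
    (hz : ContDiffOn ℝ n z s) (hzt : ∀ t ∈ s, z t ∈ (extChartAt 𝓘(ℝ, E) x₀).target) :
    ContMDiffOn 𝓘(ℝ, ℝ) 𝓘(ℝ, E) n (fun u ↦ (extChartAt 𝓘(ℝ, E) x₀).symm (z u)) s := 
  ((contMDiffOn_extChartAt_symm (n := ∞) x₀).of_le hn).comp (contMDiffOn_iff_contDiffOn.2 hz) hzt

theorem extChartAt_symm_mem_chart_source {z : E} (hz : z ∈ (extChartAt 𝓘(ℝ, E) x₀).target) :
    (extChartAt 𝓘(ℝ, E) x₀).symm z ∈ (chartAt E x₀).source := by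
  rw [← extChartAt_source 𝓘(ℝ, E) x₀]
  exact (extChartAt 𝓘(ℝ, E) x₀).map_target hz

theorem speedSq_extChartAt_symm_comp {z : ℝ → E} {w : E} (hzt : z t ∈ (extChartAt 𝓘(ℝ, E) x₀).target)
    (hz : HasDerivAt z w t) :
    speedSq g (fun u ↦ (extChartAt 𝓘(ℝ, E) x₀).symm (z u)) t = chartMetric g x₀ (z t) w w := by
  have h1 : MDifferentiableAt 𝓘(ℝ, ℝ) 𝓘(ℝ, E) (fun u ↦ (extChartAt 𝓘(ℝ, E) x₀).symm (z u)) t := by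
    have h2 : MDifferentiableAt 𝓘(ℝ, E) 𝓘(ℝ, E) (extChartAt 𝓘(ℝ, E) x₀).symm (z t) :=
      ((contMDiffOn_extChartAt_symm (n := ∞) x₀).contMDiffAt
        ((isOpen_extChartAt_target x₀).mem_nhds hzt)).mdifferentiableAt (by simp)
    exact h2.comp t hz.differentiableAt.mdifferentiableAt
  have h3 := speedSq_eq_of_hasDerivAt (g := g) h1 (extChartAt_symm_mem_chart_source hzt) (w := w) (by
    refine hz.congr_of_eventuallyEq ?_
    filter_upwards [hz.continuousAt ((isOpen_extChartAt_target x₀).mem_nhds hzt)] with u hu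
    exact (extChartAt 𝓘(ℝ, E) x₀).right_inv hu)
  rw [h3, (extChartAt 𝓘(ℝ, E) x₀).right_inv hzt]

/-- The distance of two points is bounded by the length of the segment in a chart. -/
theorem metricDist_le_of_segment {u v : E} {C : ℝ} (hC : 0 ≤ C)
    (h : ∀ z ∈ segment ℝ u v, z ∈ (extChartAt 𝓘(ℝ, E) x₀).target ∧
      chartMetric g x₀ z (v - u) (v - u) ≤ C ^ 2) :
    metricDist g ((extChartAt 𝓘(ℝ, E) x₀).symm u) ((extChartAt 𝓘(ℝ, E) x₀).symm v) ≤
      ENNReal.ofReal C := by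
  let z : ℝ → E := fun t ↦ u + t • (v - u)
  have hz : ∀ t ∈ Icc (0 : ℝ) 1, z t ∈ segment ℝ u v := fun t ht ↦ by
    rw [segment_eq_image']
    exact ⟨t, ht, rfl⟩
  have hd : ∀ t, HasDerivAt z (v - u) t := fun t ↦ by
    simpa [z] using ((hasDerivAt_id t).smul_const (v - u)).const_add u
  have hc : ContDiff ℝ 1 z := by fun_prop
  have := metricDist_le_of_speedSq_le (g := g) (γ := fun t ↦ (extChartAt 𝓘(ℝ, E) x₀).symm (z t)) (a := 0)
    (b := 1) hC (contMDiffOn_extChartAt_symm_comp (by simp) hc.contDiffOn fun t ht ↦ (h _ (hz t ht)).1)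
    zero_le_one (fun t ht ↦ by
      have ht' := h _ (hz t (Ioo_subset_Icc_self ht))
      rw [speedSq_extChartAt_symm_comp ht'.1 (hd t)]
      exact ht'.2)
  simpa [z] using this

variable (g x₀) in
/-- On the closed ball of radius `R` in the chart at `x₀` the metric `g` is comparable to the norm. -/
structure IsChartBall (R l C : ℝ) : Prop where
  R_pos : 0 < R
  l_pos : 0 < l
  C_pos : 0 < C
  subset : Metric.closedBall (extChartAt 𝓘(ℝ, E) x₀ x₀) R ⊆ (extChartAt 𝓘(ℝ, E) x₀).target
  lower : ∀ z ∈ Metric.closedBall (extChartAt 𝓘(ℝ, E) x₀ x₀) R, ∀ a,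
    (l * ‖a‖) ^ 2 ≤ chartMetric g x₀ z a a
  upper : ∀ z ∈ Metric.closedBall (extChartAt 𝓘(ℝ, E) x₀ x₀) R, ∀ a,
    chartMetric g x₀ z a a ≤ (C * ‖a‖) ^ 2

theorem IsSmoothMetric.exists_isChartBall (hg : IsSmoothMetric g) (x₀ : M) :
    ∃ R l C, IsChartBall g x₀ R l C := by
  obtain ⟨l, hl, C, hC, h⟩ := hg.exists_bounds (mem_extChartAt_target (I := 𝓘(ℝ, E)) x₀)
  obtain ⟨R, hR, hb⟩ := Metric.nhds_basis_closedBall.mem_iff.1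
    (h.and ((isOpen_extChartAt_target x₀).mem_nhds (mem_extChartAt_target (I := 𝓘(ℝ, E)) x₀)))
  refine ⟨R, Real.sqrt l, Real.sqrt C, hR, Real.sqrt_pos.2 hl, Real.sqrt_pos.2 hC,
    fun z hz ↦ (hb hz).2, fun z hz a ↦ ?_, fun z hz a ↦ ?_⟩
  · rw [mul_pow, Real.sq_sqrt hl.le]
    exact ((hb hz).1 a).1
  · rw [mul_pow, Real.sq_sqrt hC.le]
    exact ((hb hz).1 a).2

theorem IsChartBall.mono {R l C R' : ℝ} (h : IsChartBall g x₀ R l C) (hR : 0 < R') (hR' : R' ≤ R) :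
    IsChartBall g x₀ R' l C :=
  ⟨hR, h.l_pos, h.C_pos, (Metric.closedBall_subset_closedBall hR').trans h.subset,
    fun z hz ↦ h.lower z (Metric.closedBall_subset_closedBall hR' hz),
    fun z hz ↦ h.upper z (Metric.closedBall_subset_closedBall hR' hz)⟩

variable (E) in
/-- The points whose coordinates in the chart at `x₀` have distance less than `R` from `x₀`. -/
def chartBall (x₀ : M) (R : ℝ) : Set M :=
  (chartAt E x₀).source ∩ extChartAt 𝓘(ℝ, E) x₀ ⁻¹' Metric.ball (extChartAt 𝓘(ℝ, E) x₀ x₀) R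

variable (E) in
/-- The points whose coordinates in the chart at `x₀` have distance at most `R` from `x₀`. -/
def closedChartBall (x₀ : M) (R : ℝ) : Set M :=
  (chartAt E x₀).source ∩ extChartAt 𝓘(ℝ, E) x₀ ⁻¹' Metric.closedBall (extChartAt 𝓘(ℝ, E) x₀ x₀) R

theorem isOpen_chartBall (x₀ : M) (R : ℝ) : IsOpen (chartBall E x₀ R) := by
  have := (continuousOn_extChartAt (I := 𝓘(ℝ, E)) x₀).isOpen_inter_preimage
    (isOpen_extChartAt_source x₀) (Metric.isOpen_ball (x := extChartAt 𝓘(ℝ, E) x₀ x₀) (ε := R))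
  rwa [extChartAt_source] at this

theorem mem_chartBall_self {R : ℝ} (hR : 0 < R) (x₀ : M) : x₀ ∈ chartBall E x₀ R :=
  ⟨mem_chart_source E x₀, Metric.mem_ball_self hR⟩

theorem closedChartBall_eq_image {R : ℝ}
    (h : Metric.closedBall (extChartAt 𝓘(ℝ, E) x₀ x₀) R ⊆ (extChartAt 𝓘(ℝ, E) x₀).target) :
    closedChartBall E x₀ R =
      (extChartAt 𝓘(ℝ, E) x₀).symm '' Metric.closedBall (extChartAt 𝓘(ℝ, E) x₀ x₀) R := by
  ext p
  constructor
  · rintro ⟨h1, h2⟩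
    exact ⟨_, h2, (extChartAt 𝓘(ℝ, E) x₀).left_inv (by simpa using h1)⟩
  · rintro ⟨z, hz, rfl⟩
    refine ⟨extChartAt_symm_mem_chart_source (h hz), ?_⟩
    rw [mem_preimage, (extChartAt 𝓘(ℝ, E) x₀).right_inv (h hz)]
    exact hz

theorem isCompact_closedChartBall {R : ℝ}
    (h : Metric.closedBall (extChartAt 𝓘(ℝ, E) x₀ x₀) R ⊆ (extChartAt 𝓘(ℝ, E) x₀).target) :
    IsCompact (closedChartBall E x₀ R) := by
  have : ProperSpace E := FiniteDimensional.proper ℝ E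
  rw [closedChartBall_eq_image h]
  exact (isCompact_closedBall _ _).image_of_continuousOn ((continuousOn_extChartAt_symm x₀).mono h)

theorem IsChartBall.le_metricLength {R l C : ℝ} (h : IsChartBall g x₀ R l C)
    (hγ : ContMDiffOn 𝓘(ℝ, ℝ) 𝓘(ℝ, E) 1 γ (Icc a b)) (hab : a ≤ b)
    (hm : ∀ t ∈ Icc a b, γ t ∈ closedChartBall E x₀ R) :
    ENNReal.ofReal (l * ‖extChartAt 𝓘(ℝ, E) x₀ (γ b) - extChartAt 𝓘(ℝ, E) x₀ (γ a)‖) ≤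
      metricLength g γ a b := by
  have hc : ContDiffOn ℝ 1 (fun t ↦ extChartAt 𝓘(ℝ, E) x₀ (γ t)) (Icc a b) := by
    rw [← contMDiffOn_iff_contDiffOn]
    exact ((contMDiffOn_extChartAt (I := 𝓘(ℝ, E)) (n := ∞) (x := x₀)).of_le (by simp)).comp hγ
      fun t ht ↦ (hm t ht).1
  have h1 := enorm_sub_le_lintegral_deriv_of_contDiffOn_Icc hc hab
  rw [ENNReal.ofReal_mul h.l_pos.le, ofReal_norm]
  calc _ ≤ ENNReal.ofReal l * ∫⁻ t in Icc a b, ‖deriv (fun t ↦ extChartAt 𝓘(ℝ, E) x₀ (γ t)) t‖ₑ := by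
        gcongr
    _ = ∫⁻ t in Ioo a b, ENNReal.ofReal l * ‖deriv (fun t ↦ extChartAt 𝓘(ℝ, E) x₀ (γ t)) t‖ₑ := by
        rw [restrict_Ioo_eq_restrict_Icc, lintegral_const_mul' _ _ ENNReal.ofReal_ne_top]
    _ ≤ ∫⁻ t in Ioo a b, ENNReal.ofReal (Real.sqrt (speedSq g γ t)) := by
        refine setLIntegral_mono' measurableSet_Ioo fun t ht ↦ ?_
        have ht' := Ioo_subset_Icc_self ht
        have hmd : MDifferentiableAt 𝓘(ℝ, ℝ) 𝓘(ℝ, E) γ t :=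
          (hγ.contMDiffAt (Icc_mem_nhds ht.1 ht.2)).mdifferentiableAt one_ne_zero
        have hd := hasDerivAt_extChartAt_comp hmd (hm t ht').1
        rw [← ofReal_norm, ← ENNReal.ofReal_mul h.l_pos.le,
          speedSq_eq_of_hasDerivAt hmd (hm t ht').1 hd, hd.deriv]
        exact ENNReal.ofReal_le_ofReal (Real.le_sqrt_of_sq_le (h.lower _ (hm t ht').2 _))
    _ = _ := by rw [restrict_Ioo_eq_restrict_Icc, metricLength]

variable [T2Space M]

/-- A curve leaving a chart ball crosses its boundary sphere. -/
theorem exists_mem_sphere_of_notMem_chartBall {R : ℝ}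
    (h : Metric.closedBall (extChartAt 𝓘(ℝ, E) x₀ x₀) R ⊆ (extChartAt 𝓘(ℝ, E) x₀).target)
    (hab : a ≤ b) (hγ : ContinuousOn γ (Icc a b)) (ha : γ a ∈ chartBall E x₀ R)
    (hb : γ b ∉ chartBall E x₀ R) :
    ∃ s ∈ Icc a b, (∀ t ∈ Icc a s, γ t ∈ closedChartBall E x₀ R) ∧
      ‖extChartAt 𝓘(ℝ, E) x₀ (γ s) - extChartAt 𝓘(ℝ, E) x₀ x₀‖ = R := by
  let S : Set ℝ := Icc a b ∩ γ ⁻¹' (chartBall E x₀ R)ᶜ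
  have hSc : IsClosed S :=
    hγ.preimage_isClosed_of_isClosed isClosed_Icc (isOpen_chartBall x₀ R).isClosed_compl
  have hSn : S.Nonempty := ⟨b, right_mem_Icc.2 hab, hb⟩
  have hSb : BddBelow S := ⟨a, fun t ht ↦ ht.1.1⟩
  have hs : sInf S ∈ S := hSc.csInf_mem hSn hSb
  set s := sInf S
  have hlt : ∀ t ∈ Ico a s, γ t ∈ chartBall E x₀ R := fun t ht ↦ by
    by_contra hn
    exact absurd (csInf_le hSb ⟨⟨ht.1, ht.2.le.trans hs.1.2⟩, hn⟩) (not_le.2 ht.2)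
  have has : a < s := lt_of_le_of_ne hs.1.1 fun e ↦ hs.2 (e ▸ ha)
  have hsub : chartBall E x₀ R ⊆ closedChartBall E x₀ R := fun p hp ↦
    ⟨hp.1, Metric.ball_subset_closedBall hp.2⟩
  have hsm : γ s ∈ closedChartBall E x₀ R := by
    have hcl : IsClosed (closedChartBall E x₀ R) := (isCompact_closedChartBall h).isClosed
    have h1 : s ∈ closure (Ico a s) := by
      rw [closure_Ico has.ne]
      exact right_mem_Icc.2 has.le
    have h2 : ContinuousWithinAt γ (Ico a s) s :=
      (hγ s hs.1).mono fun t ht ↦ ⟨ht.1, ht.2.le.trans hs.1.2⟩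
    exact hcl.closure_subset_iff.2 (image_subset_iff.2 fun t ht ↦ hsub (hlt t ht) :
      γ '' Ico a s ⊆ closedChartBall E x₀ R)
      (h2.mem_closure_image h1)
  refine ⟨s, hs.1, fun t ht ↦ ?_, ?_⟩
  · rcases ht.2.eq_or_lt with e | e
    · rw [e]
      exact hsm
    · exact hsub (hlt t ⟨ht.1, e⟩)
  · refine le_antisymm (by simpa [dist_eq_norm] using hsm.2) (not_lt.1 fun hn ↦ hs.2 ⟨hsm.1, ?_⟩)
    simpa [dist_eq_norm] using hn

theorem IsChartBall.le_metricDist_of_notMem {R l C : ℝ} (h : IsChartBall g x₀ R l C) {y : M}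
    (hy : y ∉ chartBall E x₀ R) : ENNReal.ofReal (l * R) ≤ metricDist g x₀ y := by
  by_contra! hlt
  obtain ⟨γ, h0, h1, hγ, hL⟩ := exists_path_of_metricDist_lt hlt
  obtain ⟨s, hs, hm, he⟩ := exists_mem_sphere_of_notMem_chartBall h.subset zero_le_one
    hγ.continuous.continuousOn (by rw [h0]; exact mem_chartBall_self h.R_pos x₀) (by rwa [h1])
  have h2 := h.le_metricLength hγ.contMDiffOn hs.1 hm
  rw [h0, he] at h2
  exact absurd (h2.trans (metricLength_mono le_rfl hs.2)) (not_le.2 hL)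

theorem IsChartBall.metricDist_le {R l C : ℝ} (h : IsChartBall g x₀ R l C) {y : M}
    (hy : y ∈ closedChartBall E x₀ R) : metricDist g x₀ y ≤
      ENNReal.ofReal (C * ‖extChartAt 𝓘(ℝ, E) x₀ y - extChartAt 𝓘(ℝ, E) x₀ x₀‖) := by
  have h1 := metricDist_le_of_segment (g := g) (x₀ := x₀) (u := extChartAt 𝓘(ℝ, E) x₀ x₀)
    (v := extChartAt 𝓘(ℝ, E) x₀ y)
    (C := C * ‖extChartAt 𝓘(ℝ, E) x₀ y - extChartAt 𝓘(ℝ, E) x₀ x₀‖)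
    (mul_nonneg h.C_pos.le (norm_nonneg _)) (fun z hz ↦ by
      have hz' := (convex_closedBall _ _).segment_subset (Metric.mem_closedBall_self h.R_pos.le) hy.2 hz
      exact ⟨h.subset hz', h.upper z hz' _⟩)
  rwa [(extChartAt 𝓘(ℝ, E) x₀).left_inv (mem_extChartAt_source x₀),
    (extChartAt 𝓘(ℝ, E) x₀).left_inv (by simpa using hy.1)] at h1

/-- Convergence in the Riemannian distance implies convergence in the manifold. -/
theorem tendsto_of_tendsto_metricDist (hg : IsSmoothMetric g) {ι : Type*} {F : Filter ι} {u : ι → M} {q : M}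
    (h : Tendsto (fun i ↦ metricDist g q (u i)) F (𝓝 0)) : Tendsto u F (𝓝 q) := by
  obtain ⟨R, l, C, hb⟩ := hg.exists_isChartBall q
  have key : ∀ r, 0 < r → r ≤ R → ∀ᶠ i in F, u i ∈ chartBall E q r := fun r hr hrR ↦ by
    have hb' := hb.mono hr hrR
    filter_upwards [h.eventually_lt_const (ENNReal.ofReal_pos.2 (mul_pos hb'.l_pos hr))] with i hi
    by_contra hn
    exact absurd (hb'.le_metricDist_of_notMem hn) (not_le.2 hi)
  have h1 : Tendsto (fun i ↦ extChartAt 𝓘(ℝ, E) q (u i)) F (𝓝 (extChartAt 𝓘(ℝ, E) q q)) := by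
    rw [Metric.tendsto_nhds]
    intro ε hε
    filter_upwards [key (min ε R) (lt_min hε hb.R_pos) (min_le_right _ _)] with i hi
    exact lt_of_lt_of_le hi.2 (min_le_left _ _)
  have h2 := ((continuousAt_extChartAt_symm (I := 𝓘(ℝ, E)) q).tendsto.comp h1)
  rw [extChartAt_to_inv] at h2
  refine h2.congr' ?_
  filter_upwards [key R hb.R_pos le_rfl] with i hi
  exact (extChartAt 𝓘(ℝ, E) q).left_inv (by simpa using hi.1)

end ChartEstimates

section BrokenGeodesics

variable {E : Type*} [NormedAddCommGroup E] [NormedSpace ℝ E] [FiniteDimensional ℝ E]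
  {M : Type*} [TopologicalSpace M] [ChartedSpace E M] [IsManifold 𝓘(ℝ, E) ∞ M]
  {g : ∀ x : M, TangentSpace 𝓘(ℝ, E) x →L[ℝ] TangentSpace 𝓘(ℝ, E) x →L[ℝ] ℝ}
  {h : ∀ x : M, TangentSpace 𝓘(ℝ, E) x → TangentSpace 𝓘(ℝ, E) x → ℝ}
  {cov : CovariantDerivative 𝓘(ℝ, E) E (fun x : M ↦ TangentSpace 𝓘(ℝ, E) x)}
  {γ : ℝ → M} {a b t : ℝ} {s : Set ℝ}

theorem curveLength_eq_metricLength (hh : ∀ x v, h x v v = g x v v) (γ : ℝ → M) (a b : ℝ) :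
    curveLength h γ a b = metricLength g γ a b := by
  simp only [curveLength, metricLength, hh]
  rfl

theorem metricDist_le_brokenGeodesicDist (hh : ∀ x v, h x v v = g x v v) (p q : M) :
    metricDist g p q ≤ brokenGeodesicDist h cov p q := by
  refine le_iInf fun c ↦ le_iInf fun a ↦ le_iInf fun b ↦ le_iInf fun hc ↦ le_iInf fun hp ↦
    le_iInf fun hq ↦ ?_
  obtain ⟨-, n, t, ht, rfl, rfl, hg⟩ := hc
  rw [curveLength_eq_metricLength hh, ← hp, ← hq]
  have key : ∀ i : Fin (n + 2), metricDist g (c (t 0)) (c (t i)) ≤ metricLength g c (t 0) (t i) := by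
    intro i
    induction i using Fin.induction with
    | zero => simp [metricDist_self]
    | succ i ih =>
      have h1 : t i.castSucc ≤ t i.succ := (ht Fin.castSucc_lt_succ).le
      calc _ ≤ metricDist g (c (t 0)) (c (t i.castSucc)) +
            metricDist g (c (t i.castSucc)) (c (t i.succ)) := metricDist_triangle
        _ ≤ metricLength g c (t 0) (t i.castSucc) + metricLength g c (t i.castSucc) (t i.succ) :=
            add_le_add ih (metricDist_le_metricLength (hg i).1 h1)
        _ = _ := metricLength_add (ht.monotone (Fin.zero_le _)) h1
  exact key _

theorem speedSq_comp_affine {c d : ℝ} (h : MDifferentiableAt 𝓘(ℝ, ℝ) 𝓘(ℝ, E) γ (c * t + d)) :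
    speedSq g (fun u ↦ γ (c * u + d)) t = c ^ 2 * speedSq g γ (c * t + d) := by
  simp only [speedSq]
  rw [curveVelocity_comp_affine h]
  simp only [map_smul, smul_apply, smul_eq_mul]
  ring

theorem IsGeodesicOn.mdifferentiableAt (h : IsGeodesicOn cov γ s) (hs : s ∈ 𝓝 t) :
    MDifferentiableAt 𝓘(ℝ, ℝ) 𝓘(ℝ, E) γ t :=
  (h.1.contMDiffAt hs).mdifferentiableAt one_ne_zero

theorem IsGeodesicOn.brokenGeodesicDist_le (hh : ∀ x v, h x v v = g x v v)
    (hγ : IsGeodesicOn cov γ s) (hs : IsOpen s) (hc : s.OrdConnected) {σ : ℝ} (hσ : 0 ≤ σ)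
    (hsp : ∀ t ∈ s, speedSq g γ t ≤ σ ^ 2) {t u : ℝ} (ht : t ∈ s) (hu : u ∈ s) :
    brokenGeodesicDist h cov (γ t) (γ u) ≤ ENNReal.ofReal (σ * |u - t|) := by
  have hη := hγ.comp_affine hs (u - t) t
  have hm : ∀ r ∈ Icc (0 : ℝ) 1, (u - t) * r + t ∈ s := fun r hr ↦ by
    refine hc.uIcc_subset ht hu ?_
    rw [← segment_eq_uIcc, segment_eq_image']
    exact ⟨r, hr, by simp only [smul_eq_mul]; ring⟩
  have hη' := hη.mono (s' := Icc 0 1) hm (uniqueDiffOn_Icc one_pos)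
  have hbr : IsBrokenGeodesic cov (fun r ↦ γ ((u - t) * r + t)) 0 1 := by
    refine ⟨hη'.1.continuousOn, 0, ![0, 1], ?_, rfl, rfl, fun i ↦ ?_⟩
    · intro i j hij
      fin_cases i <;> fin_cases j <;> simp_all
    · fin_cases i
      exact hη'
  have h0 : γ ((u - t) * 0 + t) = γ t := by simp
  have h1 : γ ((u - t) * 1 + t) = γ u := by simp
  have hle : brokenGeodesicDist h cov (γ t) (γ u) ≤ curveLength h (fun r ↦ γ ((u - t) * r + t)) 0 1 :=
    iInf_le_of_le _ (iInf_le_of_le 0 (iInf_le_of_le 1 (iInf_le_of_le hbr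
      (iInf_le_of_le h0 (iInf_le_of_le h1 le_rfl)))))
  refine hle.trans ?_
  rw [curveLength_eq_metricLength hh]
  have := metricLength_le_of_speedSq_le (g := g) (γ := fun r ↦ γ ((u - t) * r + t)) (a := 0) (b := 1)
    (σ := σ * |u - t|) (by positivity) fun r hr ↦ by
      have hr' := hm r (Ioo_subset_Icc_self hr)
      rw [speedSq_comp_affine (hγ.mdifferentiableAt (hs.mem_nhds hr')), mul_pow, sq_abs, mul_comm]
      exact mul_le_mul_of_nonneg_right (hsp _ hr') (sq_nonneg _)
  simpa using this

variable [T2Space M]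

theorem exists_seq_tendsto_right_endpoint {a b : ℝ} (hab : a < b) :
    ∃ τ : ℕ → ℝ, (∀ i, τ i ∈ Ioo a b) ∧ Tendsto τ atTop (𝓝 b) := by
  obtain ⟨τ, -, h1, h2⟩ := exists_seq_strictMono_tendsto' hab
  exact ⟨τ, h1, h2⟩

/-- If the broken geodesic distance of a metric connection is complete, then geodesics extend. -/
theorem geodesicsExtendForward_of_isCompleteDist (hcov : cov.ContMDiffCovariantDerivative ∞)
    (hg : IsSmoothMetric g) (hm : IsParallelMetric g cov) (hh : ∀ x v, h x v v = g x v v)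
    (hδ : IsCompleteDist (brokenGeodesicDist h cov)) : GeodesicsExtendForward cov := by
  intro γ a b hab hγ
  obtain ⟨τ, hτ, hτb⟩ := exists_seq_tendsto_right_endpoint hab
  set σ := Real.sqrt (speedSq g γ (τ 0)) with hσ
  have hsp : ∀ t ∈ Ioo a b, speedSq g γ t ≤ σ ^ 2 := fun t ht ↦ by
    rw [hσ, Real.sq_sqrt (show 0 ≤ speedSq g γ (τ 0) from hg.nonneg _ _)]
    exact (hγ.speedSq_eq_of_mem hg hm isOpen_Ioo isPreconnected_Ioo ht (hτ 0)).le
  have hbd := fun i j ↦ hγ.brokenGeodesicDist_le hh isOpen_Ioo ordConnected_Ioo (Real.sqrt_nonneg _) hsp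
    (hτ i) (hτ j)
  have hcs : ∀ ε : ℝ, 0 < ε → ∃ N, ∀ i ≥ N, ∀ j ≥ N, σ * |τ j - τ i| < ε := by
    intro ε hε
    obtain ⟨N, hN⟩ := Metric.cauchySeq_iff.1 hτb.cauchySeq (ε / (σ + 1))
      (div_pos hε (by positivity))
    refine ⟨N, fun i hi j hj ↦ ?_⟩
    have h1 := hN j hj i hi
    rw [Real.dist_eq, lt_div_iff₀ (by positivity)] at h1
    nlinarith [abs_nonneg (τ j - τ i)]
  obtain ⟨q, hq⟩ := hδ (fun i ↦ γ (τ i)) fun ε hε ↦ by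
    obtain ⟨r, hr, hrε⟩ := ENNReal.lt_iff_exists_real_btwn.1 hε
    obtain ⟨N, hN⟩ := hcs r (by simpa using hrε.1)
    refine ⟨N, fun i hi j hj ↦ (hbd i j).trans_lt (lt_trans ?_ hrε.2)⟩
    exact ENNReal.ofReal_lt_ofReal_iff (by simpa using hrε.1) |>.2 (hN i hi j hj)
  refine hγ.exists_extend_of_tendsto hcov hg hm hτ hτb (q := q) (tendsto_of_tendsto_metricDist hg ?_)
  refine tendsto_of_tendsto_of_tendsto_of_le_of_le tendsto_const_nhds hq (fun _ ↦ zero_le) fun i ↦ ?_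
  rw [metricDist_comm]
  exact metricDist_le_brokenGeodesicDist hh _ _

end BrokenGeodesics

section Bilinear

variable {E : Type*} [NormedAddCommGroup E] [NormedSpace ℝ E]

theorem trilinear_smul_add_bilinear_smul_neg (D : E →L[ℝ] E →L[ℝ] E →L[ℝ] ℝ) (B : E →L[ℝ] E →L[ℝ] ℝ)
    (τ : ℝ) (v a b : E) :
    (D (τ • v) v + B (τ • (-a))) b = τ * (D v v b - B a b) := by
  simp only [map_smul, add_apply, smul_apply, smul_eq_mul, map_neg, neg_apply, smul_neg]
  ring

theorem bilinear_add_smul_self (B : E →L[ℝ] E →L[ℝ] ℝ) (hB : ∀ a b, B a b = B b a) (τ : ℝ) (a v : E) :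
    B (a + τ • v) (a + τ • v) = B a a + 2 * τ * B a v + τ ^ 2 * B v v := by
  simp only [map_smul, add_apply, smul_apply, smul_eq_mul, map_add, hB v a]
  ring

theorem hasDerivAt_comp_of_differentiableAt {F : Type*} [NormedAddCommGroup F] [NormedSpace ℝ F]
    {f : E → F} {z : ℝ → E} {z' : E} {t : ℝ} (hf : DifferentiableAt ℝ f (z t)) (hz : HasDerivAt z z' t) :
    HasDerivAt (fun r ↦ f (z r)) (fderiv ℝ f (z t) z') t :=
  hf.hasFDerivAt.comp_hasDerivAt t hz

end Bilinear

section Minimality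

/-- The quadratic estimate behind the minimality of short geodesics. -/
theorem sq_mul_sq_le_of_quadratic_estimate {A X Y S D Gz n m τ C K L B T t u σ : ℝ} (hL : 0 < L)
    (hC : 0 ≤ C) (hn : 0 ≤ n) (hm : 0 ≤ m) (hτ : 0 ≤ τ) (ht : 0 ≤ t) (htT : t ≤ T)
    (hA : L * m ^ 2 ≤ A) (hX : |X| ≤ C * n * m * K) (hY : -(C * n ^ 2 * K ^ 2) ≤ Y) (hS : |S| ≤ n * m)
    (hB : 2 * C ^ 2 * K ^ 2 + C * K ^ 2 * L ≤ B * L) (hT : 8 * B * T ^ 2 ≤ L)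
    (h0 : τ * D + 2 * Gz - 2 * B * τ * n ^ 2 - 4 * B * t * S = 0)
    (hu : u ^ 2 = A + 2 * τ * (X + Gz) + τ ^ 2 * (Y + σ ^ 2 + D)) : τ ^ 2 * σ ^ 2 ≤ u ^ 2 := by
  have hB0 : 0 ≤ B := by
    have : 0 ≤ B * L := le_trans (by positivity) hB
    exact nonneg_of_mul_nonneg_left this hL
  have e : u ^ 2 - τ ^ 2 * σ ^ 2 = A + 2 * τ * X + τ ^ 2 * Y + 2 * B * τ ^ 2 * n ^ 2 + 4 * B * t * τ * S := by
    linear_combination hu + τ * h0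
  have h1 : -(2 * τ * (C * n * m * K)) ≤ 2 * τ * X := by
    have := (abs_le.1 hX).1
    nlinarith
  have h2 : -(τ ^ 2 * (C * n ^ 2 * K ^ 2)) ≤ τ ^ 2 * Y := by nlinarith [sq_nonneg τ]
  have h3 : -(4 * B * T * τ * (n * m)) ≤ 4 * B * t * τ * S := by
    have h4 := (abs_le.1 hS).1
    have h5 : 4 * B * t * τ * (n * m) ≤ 4 * B * T * τ * (n * m) := by gcongr
    have h6 : 4 * B * t * τ * (-(n * m)) ≤ 4 * B * t * τ * S := by gcongr
    linarith
  have hkey : 0 ≤ L * (L * m ^ 2 - 2 * τ * (C * n * m * K) - τ ^ 2 * (C * n ^ 2 * K ^ 2) +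
      2 * B * τ ^ 2 * n ^ 2 - 4 * B * T * τ * (n * m)) := by
    have q1 : 0 ≤ (L * m - 2 * τ * C * n * K) ^ 2 / 2 := by positivity
    have q2 : 0 ≤ (L * m - 4 * B * T * τ * n) ^ 2 / 2 := by positivity
    have q3 : 0 ≤ (B * L - (2 * C ^ 2 * K ^ 2 + C * K ^ 2 * L)) * (τ * n) ^ 2 :=
      mul_nonneg (sub_nonneg.2 hB) (sq_nonneg _)
    have q4 : 0 ≤ B * (L - 8 * B * T ^ 2) * (τ * n) ^ 2 :=
      mul_nonneg (mul_nonneg hB0 (sub_nonneg.2 hT)) (sq_nonneg _)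
    nlinarith
  have := nonneg_of_mul_nonneg_right hkey hL
  linarith

variable {E : Type*} [NormedAddCommGroup E] [InnerProductSpace ℝ E]

set_option maxHeartbeats 1000000 in
/-- A solution of the geodesic equation of a torsion-free metric connection on a short interval is not
longer than any other curve with the same endpoints. -/
theorem mul_le_of_geodesic {G : E → E →L[ℝ] E →L[ℝ] ℝ} {Γ : E → E →L[ℝ] E →L[ℝ] E} {s : Set E}
    {L C K B T σ ε : ℝ} {z w u u' : ℝ → E} {ν h : ℝ → ℝ}
    (hGd : ∀ x ∈ s, DifferentiableAt ℝ G x) (hGs : ∀ x ∈ s, ∀ a b, G x a b = G x b a)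
    (hΓs : ∀ x ∈ s, ∀ a b, Γ x a b = Γ x b a)
    (hGΓ : ∀ x ∈ s, ∀ v a b, fderiv ℝ G x v a b = G x (Γ x a v) b + G x a (Γ x b v))
    (hGL : ∀ x ∈ s, ∀ a, L * ‖a‖ ^ 2 ≤ G x a a)
    (hG1 : ∀ x ∈ s, ∀ y ∈ s, ‖G y - G x‖ ≤ C * ‖y - x‖)
    (hG2 : ∀ x ∈ s, ∀ y ∈ s, ‖G y - G x - fderiv ℝ G x (y - x)‖ ≤ C * ‖y - x‖ ^ 2)
    (hL : 0 < L) (hC : 0 ≤ C) (hK : 0 ≤ K) (hB : 2 * C ^ 2 * K ^ 2 + C * K ^ 2 * L ≤ B * L)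
    (hT0 : 0 < T) (hT : 8 * B * T ^ 2 ≤ L) (hε : 0 < ε)
    (hz : ∀ t ∈ Icc 0 T, HasDerivAt z (w t) t)
    (hw : ∀ t ∈ Icc 0 T, HasDerivAt w (-Γ (z t) (w t) (w t)) t)
    (hzs : ∀ t ∈ Icc 0 T, z t ∈ s) (hwK : ∀ t ∈ Icc 0 T, ‖w t‖ ≤ K)
    (hsp : ∀ t ∈ Icc 0 T, G (z t) (w t) (w t) = σ ^ 2)
    (huc : ContinuousOn u (Icc 0 1)) (hu : ∀ r ∈ Ioo 0 1, HasDerivAt u (u' r) r)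
    (hus : ∀ r ∈ Icc 0 1, u r ∈ s) (hu0 : u 0 = z 0) (hu1 : u 1 = z T)
    (hν0 : ∀ r ∈ Ioo (0 : ℝ) 1, 0 ≤ ν r)
    (hν : ∀ r ∈ Ioo 0 1, G (u r) (u' r) (u' r) = ν r ^ 2)
    (hh0 : h 0 = 0) (hhc : ContinuousOn h (Icc 0 1)) (hh : ∀ r ∈ Ioo 0 1, HasDerivAt h (ν r + ε) r) :
    σ * T ≤ h 1 := by
  have hmono : StrictMonoOn h (Icc 0 1) := by
    refine strictMonoOn_of_deriv_pos (convex_Icc 0 1) hhc fun r hr ↦ ?_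
    rw [interior_Icc] at hr
    rw [(hh r hr).deriv]
    linarith [hν0 r hr]
  have hh1 : 0 < h 1 := by
    rw [← hh0]
    exact hmono (by simp) (by simp) one_pos
  let t : ℝ → ℝ := fun r ↦ T / h 1 * h r
  have htm : ∀ r ∈ Icc (0 : ℝ) 1, t r ∈ Icc 0 T := fun r hr ↦ by
    have h1 : 0 ≤ h r := by
      rw [← hh0]
      exact hmono.monotoneOn (by simp) hr hr.1
    have h2 : h r ≤ h 1 := hmono.monotoneOn hr (by simp) hr.2
    refine ⟨by positivity, ?_⟩
    calc T / h 1 * h r ≤ T / h 1 * h 1 := by gcongr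
      _ = T := by field_simp
  have htc : ContinuousOn t (Icc 0 1) := by fun_prop
  have ht' : ∀ r ∈ Ioo (0 : ℝ) 1, HasDerivAt t (T / h 1 * (ν r + ε)) r := fun r hr ↦
    (hh r hr).const_mul _
  have hzc : ContinuousOn z (Icc 0 T) := fun t ht ↦ (hz t ht).continuousAt.continuousWithinAt
  have hwc : ContinuousOn w (Icc 0 T) := fun t ht ↦ (hw t ht).continuousAt.continuousWithinAt
  have hGc : ContinuousOn G s := fun x hx ↦ (hGd x hx).continuousAt.continuousWithinAt
  have hztc : ContinuousOn (fun r ↦ z (t r)) (Icc 0 1) := hzc.comp htc htm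
  have hwtc : ContinuousOn (fun r ↦ w (t r)) (Icc 0 1) := hwc.comp htc htm
  have hGtc : ContinuousOn (fun r ↦ G (z (t r))) (Icc 0 1) :=
    hGc.comp hztc fun r hr ↦ hzs _ (htm r hr)
  let ζ : ℝ → E := fun r ↦ u r - z (t r)
  have hζc : ContinuousOn ζ (Icc 0 1) := huc.sub hztc
  have ht0 : t 0 = 0 := by simp [t, hh0]
  have ht1 : t 1 = T := by
    simp only [t]
    field_simp
  have hζ0 : ζ 0 = 0 := by simp [ζ, ht0, hu0]
  have hζ1 : ζ 1 = 0 := by simp [ζ, ht1, hu1]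
  let Ψ : ℝ → ℝ := fun r ↦ 2 * G (z (t r)) (w (t r)) (ζ r) - 2 * B * (t r * ‖ζ r‖ ^ 2)
  have hΨc : ContinuousOn Ψ (Icc 0 1) :=
    (continuousOn_const.mul ((hGtc.clm_apply hwtc).clm_apply hζc)).sub
      (continuousOn_const.mul (htc.mul (hζc.norm.pow 2)))
  have hΨ01 : Ψ 0 = Ψ 1 := by simp [Ψ, hζ0, hζ1]
  let ζ' : ℝ → E := fun r ↦ u' r - (T / h 1 * (ν r + ε)) • w (t r)
  have hΨd : ∀ r ∈ Ioo (0 : ℝ) 1, HasDerivAt Ψ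
      (2 * ((fderiv ℝ G (z (t r)) ((T / h 1 * (ν r + ε)) • w (t r)) (w (t r)) +
        G (z (t r)) ((T / h 1 * (ν r + ε)) • (-Γ (z (t r)) (w (t r)) (w (t r))))) (ζ r) +
        G (z (t r)) (w (t r)) (ζ' r)) - 2 * B * (T / h 1 * (ν r + ε) * ‖ζ r‖ ^ 2 +
          t r * (2 * inner ℝ (ζ r) (ζ' r)))) r := by
    intro r hr
    have hr' := Ioo_subset_Icc_self hr
    have h1 : HasDerivAt (fun r ↦ z (t r)) ((T / h 1 * (ν r + ε)) • w (t r)) r :=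
      (hz _ (htm r hr')).scomp r (ht' r hr)
    have h2 : HasDerivAt (fun r ↦ w (t r)) ((T / h 1 * (ν r + ε)) • (-Γ (z (t r)) (w (t r)) (w (t r)))) r :=
      (hw _ (htm r hr')).scomp r (ht' r hr)
    have h3 : HasDerivAt ζ (ζ' r) r := (hu r hr).sub h1
    have h4 := hasDerivAt_comp_of_differentiableAt (F := E →L[ℝ] E →L[ℝ] ℝ) (f := G)
      (z := fun r ↦ z (t r)) (hGd _ (hzs _ (htm r hr'))) h1
    exact (((h4.clm_apply h2).clm_apply h3).const_mul 2).sub (((ht' r hr).mul h3.norm_sq).const_mul (2 * B))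
  obtain ⟨r, hr, h0⟩ := exists_hasDerivAt_eq_zero zero_lt_one hΨc hΨ01 hΨd
  have hr' := Ioo_subset_Icc_self hr
  have hzr := hzs _ (htm r hr')
  have hur := hus _ hr'
  set τ := T / h 1 * (ν r + ε) with hτ
  have hτ0 : 0 < τ := mul_pos (by positivity) (by linarith [hν0 r hr])
  set x := z (t r) with hx
  set v := w (t r) with hv
  have hu' : u' r = ζ' r + τ • v := by simp [ζ', hτ, hv]
  have hζr : u r - x = ζ r := rfl
  have hvK : ‖v‖ ≤ K := hwK _ (htm r hr')
  have hD : fderiv ℝ G x (ζ r) v v = 2 * G x v (Γ x (ζ r) v) := by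
    rw [hGΓ x hzr, hGs x hzr (Γ x v (ζ r)) v, hΓs x hzr v (ζ r)]
    ring
  have hest := sq_mul_sq_le_of_quadratic_estimate (A := G (u r) (ζ' r) (ζ' r))
    (X := (G (u r) - G x) (ζ' r) v) (Y := (G (u r) - G x - fderiv ℝ G x (u r - x)) v v)
    (S := inner ℝ (ζ r) (ζ' r)) (D := fderiv ℝ G x (ζ r) v v) (Gz := G x v (ζ' r)) (n := ‖ζ r‖)
    (m := ‖ζ' r‖) (τ := τ) (C := C) (K := K) (L := L) (B := B) (T := T) (t := t r) (u := ν r) (σ := σ)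
    hL hC (norm_nonneg _) (norm_nonneg _) hτ0.le (htm r hr').1 (htm r hr').2 (hGL _ hur _) ?_ ?_
    (abs_real_inner_le_norm _ _) hB hT ?_ ?_
  · have h2 : τ * σ ≤ ν r := by
      rw [← mul_pow] at hest
      exact abs_le_of_sq_le_sq' hest (hν0 r hr) |>.2
    by_contra! hlt
    have h3 : T * (ν r + ε) * σ ≤ h 1 * ν r := by
      calc T * (ν r + ε) * σ = h 1 * (τ * σ) := by
            rw [hτ]
            field_simp
        _ ≤ h 1 * ν r := by gcongr
    have h4 : h 1 * (ν r + ε) < σ * T * (ν r + ε) := by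
      have := hν0 r hr
      gcongr
    nlinarith [mul_pos hh1 hε]
  · have h1 := (G (u r) - G x).le_opNorm₂ (ζ' r) v
    rw [Real.norm_eq_abs] at h1
    refine h1.trans ?_
    have h2 := hG1 x hzr (u r) hur
    rw [hζr] at h2
    calc _ ≤ C * ‖ζ r‖ * ‖ζ' r‖ * K := by gcongr
      _ = _ := by ring
  · have h1 := (G (u r) - G x - fderiv ℝ G x (u r - x)).le_opNorm₂ v v
    rw [Real.norm_eq_abs] at h1
    have h2 := hG2 x hzr (u r) hur
    refine (abs_le.1 (h1.trans ?_)).1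
    rw [hζr] at h2 ⊢
    calc _ ≤ C * ‖ζ r‖ ^ 2 * K * K := by gcongr
      _ = _ := by ring
  · rw [← h0, hD, trilinear_smul_add_bilinear_smul_neg, hGΓ x hzr]
    ring
  · rw [← hν r hr, hu', hζr, ← hsp _ (htm r hr'), bilinear_add_smul_self _ (hGs _ hur)]
    simp only [sub_apply]
    rw [hGs _ hzr v (ζ' r)]
    ring

end Minimality

section Shooting

variable {E : Type*} [NormedAddCommGroup E] [NormedSpace ℝ E]

/-- The endpoint map of a second order equation on a short interval is close to the identity. -/
theorem norm_endpoint_sub_le {f : E × E → E × E} {k : NNReal} {W : Set (E × E)}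
    (hf : LipschitzOnWith k f W) (hf1 : ∀ q, (f q).1 = q.2) {T : ℝ} (hT : 0 ≤ T) (hkT : 4 * k * T ≤ 1)
    {α β : ℝ → E × E}
    (hα : ∀ t ∈ Icc 0 T, HasDerivAt α (f (α t)) t) (hβ : ∀ t ∈ Icc 0 T, HasDerivAt β (f (β t)) t)
    (hαW : ∀ t ∈ Icc 0 T, α t ∈ W) (hβW : ∀ t ∈ Icc 0 T, β t ∈ W) (h0 : (α 0).1 = (β 0).1) :
    ‖(α T).1 - (β T).1 - T • ((α 0).2 - (β 0).2)‖ ≤ T / 2 * ‖(α 0).2 - (β 0).2‖ := by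
  set d := (α 0).2 - (β 0).2 with hd
  have hT' : (k : ℝ) * T ≤ 1 / 4 := by linarith
  have hd0 : ‖α 0 - β 0‖ ≤ ‖d‖ := by
    rw [Prod.norm_def, Prod.fst_sub, Prod.snd_sub, h0, sub_self, norm_zero, ← hd]
    simp
  have hgr : ∀ t ∈ Icc 0 T, ‖α t - β t‖ ≤ 2 * ‖d‖ := by
    intro t ht
    have h1 := dist_le_of_trajectories_ODE_of_mem (v := fun _ ↦ f) (K := k) (s := fun _ ↦ W) (f := α) (g := β)
      (a := 0) (b := T) (δ := ‖d‖) (fun _ _ ↦ hf)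
      (fun t ht ↦ (hα t ht).continuousAt.continuousWithinAt)
      (fun t ht ↦ (hα t (Ico_subset_Icc_self ht)).hasDerivWithinAt)
      (fun t ht ↦ hαW t (Ico_subset_Icc_self ht))
      (fun t ht ↦ (hβ t ht).continuousAt.continuousWithinAt)
      (fun t ht ↦ (hβ t (Ico_subset_Icc_self ht)).hasDerivWithinAt)
      (fun t ht ↦ hβW t (Ico_subset_Icc_self ht)) (by rwa [dist_eq_norm]) t ht
    rw [dist_eq_norm, sub_zero] at h1
    refine h1.trans ?_
    have h2 : Real.exp (k * t) ≤ 2 := by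
      have h3 : (k : ℝ) * t ≤ 1 / 4 := (mul_le_mul_of_nonneg_left ht.2 k.2).trans hT'
      have h6 := Real.exp_bound_div_one_sub_of_interval (x := 1 / 4) (by norm_num) (by norm_num)
      refine (Real.exp_le_exp.2 h3).trans (h6.trans ?_)
      norm_num
    nlinarith [norm_nonneg d]
  have hvel : ∀ t ∈ Icc 0 T, ‖(α t).2 - (β t).2 - d‖ ≤ k * (2 * ‖d‖) * T := by
    intro t ht
    have hsub : Icc 0 t ⊆ Icc 0 T := Icc_subset_Icc_right ht.2
    have h1 := norm_image_sub_le_of_norm_deriv_le_segment' (f := fun t ↦ (α t).2 - (β t).2)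
      (f' := fun t ↦ (f (α t)).2 - (f (β t)).2) (a := 0) (b := t) (C := k * (2 * ‖d‖))
      (fun u hu ↦ by
        have h2 : HasDerivAt (fun t ↦ (α t).2) (f (α u)).2 u := (hα u (hsub hu)).snd
        have h3 : HasDerivAt (fun t ↦ (β t).2) (f (β u)).2 u := (hβ u (hsub hu)).snd
        exact (h2.sub h3).hasDerivWithinAt)
      (fun u hu ↦ by
        have hu' := hsub (Ico_subset_Icc_self hu)
        rw [← Prod.snd_sub]
        refine (norm_snd_le _).trans ((hf.norm_sub_le (hαW u hu') (hβW u hu')).trans ?_)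
        exact mul_le_mul_of_nonneg_left (hgr u hu') k.2) t (right_mem_Icc.2 ht.1)
    refine h1.trans ?_
    rw [sub_zero]
    exact mul_le_mul_of_nonneg_left ht.2 (by positivity)
  have h1 := norm_image_sub_le_of_norm_deriv_le_segment'
    (f := fun t ↦ (α t).1 - (β t).1 - t • d) (f' := fun t ↦ (α t).2 - (β t).2 - d) (a := 0) (b := T)
    (C := k * (2 * ‖d‖) * T) (fun u hu ↦ by
      have h2 : HasDerivAt (fun t ↦ (α t).1) (f (α u)).1 u := (hα u hu).fst
      have h3 : HasDerivAt (fun t ↦ (β t).1) (f (β u)).1 u := (hβ u hu).fst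
      rw [hf1] at h2 h3
      have h4 := (hasDerivAt_id u).smul_const d
      rw [one_smul] at h4
      exact ((h2.sub h3).sub h4).hasDerivWithinAt)
    (fun u hu ↦ hvel u (Ico_subset_Icc_self hu)) T (right_mem_Icc.2 hT)
  simp only [h0, sub_self, zero_smul, sub_zero] at h1
  refine h1.trans ?_
  have : 0 ≤ (1 / 4 - k * T) * (T * ‖d‖) := mul_nonneg (by linarith) (by positivity)
  nlinarith

/-- Points close to `z₀` can be reached by solutions starting at `z₀`. -/
theorem exists_endpoint_eq [CompleteSpace E] {f : E × E → E × E} {k : NNReal} {W : Set (E × E)}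
    (hf : LipschitzOnWith k f W) (hf1 : ∀ q, (f q).1 = q.2) {T : ℝ} (hT : 0 < T) (hkT : 4 * k * T ≤ 1)
    {z₀ : E} (hz₀ : f (z₀, 0) = 0) (hzW : (z₀, 0) ∈ W) {r : ℝ} {α : E → ℝ → E × E}
    (hα : ∀ v ∈ Metric.closedBall 0 r, ∀ t ∈ Icc 0 T, HasDerivAt (α v) (f (α v t)) t)
    (hαW : ∀ v ∈ Metric.closedBall 0 r, ∀ t ∈ Icc 0 T, α v t ∈ W)
    (hα0 : ∀ v ∈ Metric.closedBall 0 r, α v 0 = (z₀, v)) {y : E} (hy : 2 * ‖y - z₀‖ ≤ T * r) :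
    ∃ v, T * ‖v‖ ≤ 2 * ‖y - z₀‖ ∧ ‖v‖ ≤ r ∧ (α v T).1 = y := by
  set ρ := 2 * ‖y - z₀‖ / T with hρ
  have hρ0 : 0 ≤ ρ := by positivity
  have hρr : ρ ≤ r := by
    rw [hρ, div_le_iff₀ hT]
    linarith
  have hr0 : 0 ≤ r := hρ0.trans hρr
  let F : E → E := fun v ↦ T⁻¹ • ((α v T).1 - z₀)
  have hF : ApproximatesLinearOn F (ContinuousLinearMap.id ℝ E) (Metric.closedBall 0 ρ) (1 / 2) := by
    intro v hv v' hv'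
    have hv := Metric.closedBall_subset_closedBall hρr hv
    have hv' := Metric.closedBall_subset_closedBall hρr hv'
    have h1 := norm_endpoint_sub_le hf hf1 hT.le hkT (hα v hv) (hα v' hv') (hαW v hv) (hαW v' hv')
      (by rw [hα0 v hv, hα0 v' hv'])
    rw [hα0 v hv, hα0 v' hv'] at h1
    have h2 : F v - F v' - ContinuousLinearMap.id ℝ E (v - v') =
        T⁻¹ • ((α v T).1 - (α v' T).1 - T • (v - v')) := by
      simp only [F, ContinuousLinearMap.id_apply]
      rw [smul_sub _ _ (T • (v - v')), smul_smul, inv_mul_cancel₀ hT.ne', one_smul, ← smul_sub]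
      congr 2
      abel
    rw [h2, norm_smul, norm_inv, Real.norm_of_nonneg hT.le]
    calc T⁻¹ * _ ≤ T⁻¹ * (T / 2 * ‖v - v'‖) := by gcongr
      _ = _ := by
        push_cast
        field_simp
  have hF0 : F 0 = 0 := by
    have h0r : (0 : E) ∈ Metric.closedBall 0 r := Metric.mem_closedBall_self hr0
    have h1 := norm_endpoint_sub_le hf hf1 hT.le hkT (β := fun _ ↦ (z₀, (0 : E))) (hα 0 h0r)
      (fun t _ ↦ by
        rw [hz₀]
        exact hasDerivAt_const t _) (hαW 0 h0r) (fun _ _ ↦ hzW) (by rw [hα0 0 h0r])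
    rw [hα0 0 h0r] at h1
    simp only [sub_self, smul_zero, sub_zero, norm_zero, mul_zero, norm_le_zero_iff] at h1
    simp [F, h1]
  let I : (ContinuousLinearMap.id ℝ E).NonlinearRightInverse :=
    { toFun := id
      nnnorm := 1
      bound' := fun y ↦ by simp
      right_inv' := fun y ↦ rfl }
  have hs := hF.surjOn_closedBall_of_nonlinearRightInverse I hρ0 subset_rfl
  have hmem : T⁻¹ • (y - z₀) ∈ Metric.closedBall (F 0) (((I.nnnorm : ℝ)⁻¹ - ((1 / 2 : NNReal) : ℝ)) * ρ) := by
    rw [hF0, mem_closedBall_zero_iff, norm_smul, norm_inv, Real.norm_of_nonneg hT.le, hρ]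
    simp only [I]
    push_cast
    apply le_of_eq
    field_simp
    norm_num
  obtain ⟨v, hv, hvF⟩ := hs hmem
  rw [mem_closedBall_zero_iff] at hv
  refine ⟨v, ?_, hv.trans hρr, ?_⟩
  · rw [hρ, le_div_iff₀ hT] at hv
    linarith
  · have := (smul_right_injective E (inv_ne_zero hT.ne')) hvF
    exact sub_left_injective this

end Shooting

section LocalEstimates

variable {E : Type*} [NormedAddCommGroup E] [NormedSpace ℝ E]

/-- First and second order Taylor estimates of a smooth map near a point. -/
theorem ContDiffAt.exists_taylor_bounds {F : Type*} [NormedAddCommGroup F] [NormedSpace ℝ F] {f : E → F}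
    {z₀ : E} (hf : ContDiffAt ℝ ∞ f z₀) : ∃ C, 0 ≤ C ∧ ∃ R₀ > 0, ∀ R ≤ R₀,
      (∀ x ∈ Metric.closedBall z₀ R, ∀ y ∈ Metric.closedBall z₀ R, ‖f y - f x‖ ≤ C * ‖y - x‖) ∧
      (∀ x ∈ Metric.closedBall z₀ R, ∀ y ∈ Metric.closedBall z₀ R,
        ‖f y - f x - fderiv ℝ f x (y - x)‖ ≤ C * ‖y - x‖ ^ 2) := by
  obtain ⟨k₁, U₁, hU₁, h₁⟩ := (hf.of_le (m := 1) (by simp)).exists_lipschitzOnWith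
  have hf' : ContDiffAt ℝ 1 (fderiv ℝ f) z₀ := hf.fderiv_right (m := 1) (by norm_cast)
  obtain ⟨k₂, U₂, hU₂, h₂⟩ := hf'.exists_lipschitzOnWith
  have hd : ∀ᶠ z in 𝓝 z₀, DifferentiableAt ℝ f z := by
    filter_upwards [(hf.of_le (m := 1) (by simp)).eventually (by simp)] with z hz
    exact hz.differentiableAt one_ne_zero
  obtain ⟨R₀, hR₀, hsub⟩ := Metric.nhds_basis_closedBall.mem_iff.1 (inter_mem (inter_mem hU₁ hU₂) hd)
  refine ⟨max k₁ k₂, le_max_of_le_left k₁.2, R₀, hR₀, fun R hR ↦ ⟨fun x hx y hy ↦ ?_, fun x hx y hy ↦ ?_⟩⟩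
  · have hb := (Metric.closedBall_subset_closedBall hR).trans hsub
    refine (h₁.norm_sub_le (hb hy).1.1 (hb hx).1.1).trans ?_
    gcongr
    exact le_max_left _ _
  · have hb := (Metric.closedBall_subset_closedBall hR).trans hsub
    have hseg : segment ℝ x y ⊆ Metric.closedBall z₀ R := (convex_closedBall _ _).segment_subset hx hy
    have := (convex_segment x y).norm_image_sub_le_of_norm_hasFDerivWithin_le' (f := f)
      (f' := fderiv ℝ f) (φ := fderiv ℝ f x) (C := k₂ * ‖y - x‖)
      (fun z hz ↦ (hb (hseg hz)).2.hasFDerivAt.hasFDerivWithinAt)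
      (fun z hz ↦ (h₂.norm_sub_le (hb (hseg hz)).1.2 (hb hx).1.2).trans (by
        gcongr
        rw [segment_eq_image'] at hz
        obtain ⟨θ, hθ, rfl⟩ := hz
        rw [add_sub_cancel_left, norm_smul, Real.norm_of_nonneg hθ.1]
        exact mul_le_of_le_one_left (norm_nonneg _) hθ.2))
      (left_mem_segment ℝ x y) (right_mem_segment ℝ x y)
    refine this.trans ?_
    rw [mul_assoc, ← sq]
    gcongr
    exact le_max_right _ _

end LocalEstimates

section MinimizingGeodesics

variable {E : Type*} [NormedAddCommGroup E] [InnerProductSpace ℝ E] [FiniteDimensional ℝ E]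
  {M : Type*} [TopologicalSpace M] [ChartedSpace E M] [IsManifold 𝓘(ℝ, E) ∞ M]
  {g : ∀ x : M, TangentSpace 𝓘(ℝ, E) x →L[ℝ] TangentSpace 𝓘(ℝ, E) x →L[ℝ] ℝ}
  {cov : CovariantDerivative 𝓘(ℝ, E) E (fun x : M ↦ TangentSpace 𝓘(ℝ, E) x)}
  {γ : ℝ → M}

theorem IsSmoothMetric.continuous_speedSq (hg : IsSmoothMetric g)
    (hγ : ContMDiff 𝓘(ℝ, ℝ) 𝓘(ℝ, E) 1 γ) : Continuous (speedSq g γ) := by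
  rw [continuous_iff_continuousAt]
  intro t
  have hsrc : ∀ᶠ u in 𝓝 t, γ u ∈ (chartAt E (γ t)).source :=
    hγ.continuous.continuousAt (chart_source_mem_nhds_of_mem (mem_chart_source E (γ t)))
  have hf : ContDiffAt ℝ 1 (fun u ↦ extChartAt 𝓘(ℝ, E) (γ t) (γ u)) t := by
    rw [← contMDiffAt_iff_contDiffAt]
    exact (((contMDiffAt_extChartAt (I := 𝓘(ℝ, E)) (n := ∞) (x := γ t)).of_le (by simp)).comp t
      hγ.contMDiffAt)
  have hd : ContinuousAt (deriv fun u ↦ extChartAt 𝓘(ℝ, E) (γ t) (γ u)) t := by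
    have h1 := (hf.fderiv_right (m := 0) (by simp)).continuousAt
    exact h1.clm_apply continuousAt_const
  have hG : ContinuousAt (fun u ↦ chartMetric g (γ t) (extChartAt 𝓘(ℝ, E) (γ t) (γ u))) t :=
    ContinuousAt.comp (g := chartMetric g (γ t)) (f := fun u ↦ extChartAt 𝓘(ℝ, E) (γ t) (γ u))
      (hg.contDiffAt (mem_extChartAt_target (γ t))).continuousAt hf.continuousAt
  refine ((hG.clm_apply hd).clm_apply hd).congr ?_
  filter_upwards [hsrc] with u hu
  have hmd : MDifferentiableAt 𝓘(ℝ, ℝ) 𝓘(ℝ, E) γ u := hγ.mdifferentiableAt one_ne_zero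
  have h1 := hasDerivAt_extChartAt_comp hmd hu
  rw [speedSq_eq_of_hasDerivAt hmd hu h1, h1.deriv]

theorem IsSmoothMetric.metricLength_eq_integral (hg : IsSmoothMetric g)
    (hγ : ContMDiff 𝓘(ℝ, ℝ) 𝓘(ℝ, E) 1 γ) {a b : ℝ} (hab : a ≤ b) :
    metricLength g γ a b = ENNReal.ofReal (∫ t in a..b, Real.sqrt (speedSq g γ t)) := by
  have hc : Continuous fun t ↦ Real.sqrt (speedSq g γ t) := (hg.continuous_speedSq hγ).sqrt
  rw [intervalIntegral.integral_of_le hab, ← integral_Icc_eq_integral_Ioc,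
    ofReal_integral_eq_lintegral_ofReal (hc.continuousOn.integrableOn_Icc)
      (Eventually.of_forall fun t ↦ Real.sqrt_nonneg _)]
  rfl

variable [T2Space M]

set_option maxHeartbeats 1000000 in
/-- Points close to `p` can be joined to `p` by a minimizing geodesic of the Levi-Civita connection. -/
theorem exists_minimizing_geodesic (hcov : cov.ContMDiffCovariantDerivative ∞)
    (hg : IsSmoothMetric g) (hm : IsParallelMetric g cov)
    (hΓ : ∀ x₀ : M, ∀ z ∈ (extChartAt 𝓘(ℝ, E) x₀).target, ∀ a b,
      christoffel cov x₀ z a b = christoffel cov x₀ z b a) (p : M) :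
    ∃ ρ > 0, ∀ y ∈ closedChartBall E p ρ, ∃ (ζ : ℝ → M) (T ε σ : ℝ), 0 < T ∧ T < ε ∧ 0 ≤ σ ∧
      IsGeodesicOn cov ζ (Ioo (-ε) ε) ∧ ζ 0 = p ∧ ζ T = y ∧
      (∀ t ∈ Ioo (-ε) ε, speedSq g ζ t = σ ^ 2) ∧ ENNReal.ofReal (σ * T) ≤ metricDist g p y := by
  set z₀ := extChartAt 𝓘(ℝ, E) p p with hz₀
  have hz₀t : z₀ ∈ (extChartAt 𝓘(ℝ, E) p).target := mem_extChartAt_target p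
  obtain ⟨R₀, l, C₀, hb₀⟩ := hg.exists_isChartBall p
  obtain ⟨C, hC, R₁, hR₁, hTay⟩ := (hg.contDiffAt hz₀t).exists_taylor_bounds
  set R := min R₀ R₁ with hR
  have hR0 : 0 < R := lt_min hb₀.R_pos hR₁
  have hb := hb₀.mono hR0 (min_le_left _ _)
  obtain ⟨hG1, hG2⟩ := hTay R (min_le_right _ _)
  obtain ⟨k, U, hU, hk⟩ := (contDiffAt_geodesicField hcov (q := (z₀, (0 : E))) hz₀t).exists_lipschitzOnWith
  have hW : U ∩ (Metric.closedBall z₀ R ×ˢ Metric.closedBall (0 : E) 1) ∈ 𝓝 (z₀, (0 : E)) :=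
    inter_mem hU (prod_mem_nhds (Metric.closedBall_mem_nhds _ hR0) (Metric.closedBall_mem_nhds _ one_pos))
  obtain ⟨r, hr, ε, hε, hflow⟩ := exists_geodesicField_flow hcov (q₀ := (z₀, (0 : E))) hz₀t hW
  have hflow' : ∀ v ∈ Metric.closedBall (0 : E) r, ∃ α : ℝ → E × E, α 0 = (z₀, v) ∧ ∀ t ∈ Ioo (-ε) ε,
      HasDerivAt α (geodesicField cov p (α t)) t ∧
      α t ∈ U ∩ (Metric.closedBall z₀ R ×ˢ Metric.closedBall (0 : E) 1) ∧
      (α t).1 ∈ (extChartAt 𝓘(ℝ, E) p).target := fun v hv ↦ hflow (z₀, v) (by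
    rw [Metric.mem_closedBall, Prod.dist_eq, dist_self]
    exact max_le hr.le hv)
  choose! α hα0 hα using hflow'
  set L := l ^ 2 with hLdef
  have hl := hb.l_pos
  have hL : 0 < L := by positivity
  set B := (2 * C ^ 2 + C * L) / L with hBdef
  have hB0 : 0 ≤ B := by positivity
  have hBL : B * L = 2 * C ^ 2 + C * L := by
    rw [hBdef]
    field_simp
  obtain ⟨T, hT0, hTε, hTk, hTB⟩ : ∃ T : ℝ, 0 < T ∧ T < ε ∧ 4 * k * T ≤ 1 ∧ 8 * B * T ^ 2 ≤ L := by
    have h1 : Tendsto (fun T : ℝ ↦ 4 * k * T) (𝓝[>] 0) (𝓝 (4 * k * 0)) :=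
      (Continuous.tendsto (by fun_prop) 0).mono_left nhdsWithin_le_nhds
    have h2 : Tendsto (fun T : ℝ ↦ 8 * B * T ^ 2) (𝓝[>] 0) (𝓝 (8 * B * 0 ^ 2)) :=
      (Continuous.tendsto (by fun_prop) 0).mono_left nhdsWithin_le_nhds
    obtain ⟨T, h3, h4, h5⟩ := ((h1.eventually_le_const (u := 1) (by norm_num)).and
      ((h2.eventually_le_const (u := L) (by simpa using hL)).and (Ioo_mem_nhdsGT hε))).exists
    exact ⟨T, h5.1, h5.2, h3, h4⟩
  have hC₀ := hb.C_pos
  refine ⟨min R (min (T * r / 2) (l * R / (2 * C₀))), by positivity, fun y hy ↦ ?_⟩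
  have hyR : ‖extChartAt 𝓘(ℝ, E) p y - z₀‖ ≤ min R (min (T * r / 2) (l * R / (2 * C₀))) := by
    have := hy.2
    rwa [mem_preimage, Metric.mem_closedBall, dist_eq_norm] at this
  have hIcc : Icc 0 T ⊆ Ioo (-ε) ε := Icc_subset_Ioo (by linarith) hTε
  have hz00 : geodesicField cov p (z₀, (0 : E)) = 0 := by simp [geodesicField]
  obtain ⟨v, hv1, hv2, hv3⟩ := exists_endpoint_eq hk (fun _ ↦ rfl) hT0 hTk hz00 (mem_of_mem_nhds hU)
    (r := r) (α := α) (fun v hv t ht ↦ (hα v hv t (hIcc ht)).1) (fun v hv t ht ↦ (hα v hv t (hIcc ht)).2.1.1)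
    (fun v hv ↦ hα0 v hv) (y := extChartAt 𝓘(ℝ, E) p y) (by
      have := hyR.trans ((min_le_right _ _).trans (min_le_left _ _))
      linarith)
  have hvr : v ∈ Metric.closedBall (0 : E) r := mem_closedBall_zero_iff.2 hv2
  have hαv := hα v hvr
  have hα0v := hα0 v hvr
  set β := α v with hβ
  let ζ : ℝ → M := fun u ↦ (extChartAt 𝓘(ℝ, E) p).symm (β u).1
  have hζ : IsGeodesicOn cov ζ (Ioo (-ε) ε) :=
    isGeodesicOn_of_hasDerivAt isOpen_Ioo (fun u hu ↦ (hαv u hu).1) (fun u hu ↦ (hαv u hu).2.2)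
  have hd1 : ∀ t ∈ Ioo (-ε) ε, HasDerivAt (fun u ↦ (β u).1) (β t).2 t := fun t ht ↦ (hαv t ht).1.fst
  have hd2 : ∀ t ∈ Ioo (-ε) ε, HasDerivAt (fun u ↦ (β u).2)
    (-christoffel cov p (β t).1 (β t).2 (β t).2) t := fun t ht ↦ (hαv t ht).1.snd
  have hsp : ∀ t ∈ Ioo (-ε) ε, speedSq g ζ t = chartMetric g p (β t).1 (β t).2 (β t).2 := fun t ht ↦
    speedSq_extChartAt_symm_comp (hαv t ht).2.2 (hd1 t ht)
  have h0ε : (0 : ℝ) ∈ Ioo (-ε) ε := ⟨by linarith, hε⟩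
  set σ := Real.sqrt (speedSq g ζ 0) with hσ
  have hσsp : ∀ t ∈ Ioo (-ε) ε, speedSq g ζ t = σ ^ 2 := fun t ht ↦ by
    rw [hσ, Real.sq_sqrt (show 0 ≤ speedSq g ζ 0 from hg.nonneg _ _)]
    exact hζ.speedSq_eq_of_mem hg hm isOpen_Ioo isPreconnected_Ioo ht h0ε
  have hσv : σ ≤ C₀ * ‖v‖ := by
    rw [hσ, hsp 0 h0ε, hα0v]
    exact Real.sqrt_le_iff.2 ⟨by positivity, hb.upper z₀ (Metric.mem_closedBall_self hR0.le) v⟩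
  have hσT : σ * T ≤ l * R := by
    have h1 : ‖extChartAt 𝓘(ℝ, E) p y - z₀‖ ≤ l * R / (2 * C₀) :=
      hyR.trans ((min_le_right _ _).trans (min_le_right _ _))
    rw [le_div_iff₀ (by positivity)] at h1
    calc σ * T ≤ C₀ * ‖v‖ * T := by gcongr
      _ = C₀ * (T * ‖v‖) := by ring
      _ ≤ C₀ * (2 * ‖extChartAt 𝓘(ℝ, E) p y - z₀‖) := by gcongr
      _ ≤ l * R := by linarith
  have hζ0 : ζ 0 = p := by
    simp only [ζ, hα0v]
    exact extChartAt_to_inv p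
  have hζT : ζ T = y := by
    simp only [ζ, hv3]
    exact (extChartAt 𝓘(ℝ, E) p).left_inv (by simpa using hy.1)
  refine ⟨ζ, T, ε, σ, hT0, hTε, Real.sqrt_nonneg _, hζ, hζ0, hζT, hσsp, ?_⟩
  by_contra! hlt
  obtain ⟨η, hη0, hη1, hη, hηL⟩ := exists_path_of_metricDist_lt hlt
  by_cases hin : ∀ t ∈ Icc (0 : ℝ) 1, η t ∈ chartBall E p R
  · have hνc : Continuous fun t ↦ Real.sqrt (speedSq g η t) := (hg.continuous_speedSq hη).sqrt
    rw [hg.metricLength_eq_integral hη zero_le_one] at hηL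
    have hint := (ENNReal.ofReal_lt_ofReal_iff_of_nonneg (intervalIntegral.integral_nonneg zero_le_one
      fun t _ ↦ Real.sqrt_nonneg _)).1 hηL
    set δ := σ * T - ∫ t in (0 : ℝ)..1, Real.sqrt (speedSq g η t) with hδ
    have hδ0 : 0 < δ := sub_pos.2 hint
    have hmd : ∀ t, MDifferentiableAt 𝓘(ℝ, ℝ) 𝓘(ℝ, E) η t := fun t ↦ hη.mdifferentiableAt one_ne_zero
    have hηd : ∀ t ∈ Icc (0 : ℝ) 1, HasDerivAt (fun u ↦ extChartAt 𝓘(ℝ, E) p (η u))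
        (chartCoord p (η t) (curveVelocity 𝓘(ℝ, E) η univ t)) t := fun t ht ↦
      hasDerivAt_extChartAt_comp (hmd t) (hin t ht).1
    have hhd : ∀ t, HasDerivAt (fun r ↦ ∫ u in (0 : ℝ)..r, (Real.sqrt (speedSq g η u) + δ / 2))
        (Real.sqrt (speedSq g η t) + δ / 2) t := fun t ↦
      ((hνc.add continuous_const).integral_hasStrictDerivAt 0 t).hasDerivAt
    have hfin := mul_le_of_geodesic (G := chartMetric g p) (Γ := christoffel cov p)
      (s := Metric.closedBall z₀ R) (L := L) (C := C) (K := 1) (B := B) (T := T) (σ := σ) (ε := δ / 2)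
      (z := fun t ↦ (β t).1) (w := fun t ↦ (β t).2) (u := fun t ↦ extChartAt 𝓘(ℝ, E) p (η t))
      (u' := fun t ↦ chartCoord p (η t) (curveVelocity 𝓘(ℝ, E) η univ t))
      (ν := fun t ↦ Real.sqrt (speedSq g η t))
      (h := fun r ↦ ∫ u in (0 : ℝ)..r, (Real.sqrt (speedSq g η u) + δ / 2))
      (fun x hx ↦ (hg.contDiffAt (hb.subset hx)).differentiableAt (by simp))
      (fun x _ a b ↦ hg.chartMetric_symm x a b) (fun x hx a b ↦ hΓ p x (hb.subset hx) a b)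
      (fun x hx w a b ↦ hm p x (hb.subset hx) w a b)
      (fun x hx a ↦ (mul_pow l ‖a‖ 2).symm.trans_le (hb.lower x hx a)) hG1 hG2 hL hC zero_le_one
      (by rw [hBL]; simp) hT0 hTB (half_pos hδ0)
      (fun t ht ↦ hd1 t (hIcc ht)) (fun t ht ↦ hd2 t (hIcc ht))
      (fun t ht ↦ (hαv t (hIcc ht)).2.1.2.1)
      (fun t ht ↦ mem_closedBall_zero_iff.1 (hαv t (hIcc ht)).2.1.2.2)
      (fun t ht ↦ (hsp t (hIcc ht)).symm.trans (hσsp t (hIcc ht)))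
      (fun t ht ↦ (hηd t ht).continuousAt.continuousWithinAt) (fun t ht ↦ hηd t (Ioo_subset_Icc_self ht))
      (fun t ht ↦ Metric.ball_subset_closedBall (hin t ht).2) (by simp only [hη0, hα0v, hz₀])
      (by simp only [hη1, hv3]) (fun _ _ ↦ Real.sqrt_nonneg _)
      (fun t ht ↦ by
        rw [Real.sq_sqrt (show 0 ≤ speedSq g η t from hg.nonneg _ _)]
        exact (speedSq_eq_of_hasDerivAt (hmd t) (hin t (Ioo_subset_Icc_self ht)).1
          (hηd t (Ioo_subset_Icc_self ht))).symm)
      intervalIntegral.integral_same (fun t _ ↦ (hhd t).continuousAt.continuousWithinAt)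
      (fun t _ ↦ hhd t)
    rw [intervalIntegral.integral_add (hνc.intervalIntegrable _ _) (by simp)] at hfin
    simp at hfin
    linarith
  · push Not at hin
    obtain ⟨t, ht, htn⟩ := hin
    have h1 := hb.le_metricDist_of_notMem htn
    have h2 := metricDist_le_metricLength (g := g) (hη.contMDiffOn (s := Icc 0 t)) ht.1
    rw [hη0] at h2
    have h3 := (h1.trans h2).trans (metricLength_mono le_rfl ht.2)
    exact absurd (h3.trans_lt hηL) (not_lt.2 (ENNReal.ofReal_le_ofReal hσT))

end MinimizingGeodesics

section DistanceTopology

variable {E : Type*} [NormedAddCommGroup E] [NormedSpace ℝ E] [FiniteDimensional ℝ E]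
  {M : Type*} [TopologicalSpace M] [ChartedSpace E M] [IsManifold 𝓘(ℝ, E) ∞ M] [T2Space M]
  {g : ∀ x : M, TangentSpace 𝓘(ℝ, E) x →L[ℝ] TangentSpace 𝓘(ℝ, E) x →L[ℝ] ℝ}

/-- Convergence in the manifold implies convergence in the Riemannian distance. -/
theorem tendsto_metricDist_of_tendsto (hg : IsSmoothMetric g) {ι : Type*} {F : Filter ι} {u : ι → M}
    {q : M} (h : Tendsto u F (𝓝 q)) : Tendsto (fun i ↦ metricDist g q (u i)) F (𝓝 0) := by
  obtain ⟨R, l, C, hb⟩ := hg.exists_isChartBall q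
  have h1 : Tendsto (fun i ↦ ENNReal.ofReal
      (C * ‖extChartAt 𝓘(ℝ, E) q (u i) - extChartAt 𝓘(ℝ, E) q q‖)) F (𝓝 0) := by
    have h2 : Tendsto (fun i ↦ extChartAt 𝓘(ℝ, E) q (u i)) F (𝓝 (extChartAt 𝓘(ℝ, E) q q)) :=
      (continuousAt_extChartAt q).tendsto.comp h
    have h3 := ENNReal.tendsto_ofReal ((h2.sub_const (extChartAt 𝓘(ℝ, E) q q)).norm.const_mul C)
    simpa using h3
  refine tendsto_of_tendsto_of_tendsto_of_le_of_le' tendsto_const_nhds h1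
    (Eventually.of_forall fun _ ↦ zero_le) ?_
  filter_upwards [h.eventually ((isOpen_chartBall (E := E) q R).mem_nhds (mem_chartBall_self hb.R_pos q))] with i hi
  exact hb.metricDist_le ⟨hi.1, Metric.ball_subset_closedBall hi.2⟩

/-- Two unit speed curves whose concatenation is minimizing have the same velocity. -/
theorem eq_of_two_mul_le_metricDist (hg : IsSmoothMetric g) {p : M} {α β : ℝ → E} {v w : E}
    (hα0 : α 0 = extChartAt 𝓘(ℝ, E) p p) (hβ0 : β 0 = extChartAt 𝓘(ℝ, E) p p)
    (hα : HasDerivAt α (-v) 0) (hβ : HasDerivAt β w 0)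
    (hv : chartMetric g p (extChartAt 𝓘(ℝ, E) p p) v v = 1)
    (hw : chartMetric g p (extChartAt 𝓘(ℝ, E) p p) w w = 1)
    (h : ∀ᶠ s in 𝓝[>] (0 : ℝ), ENNReal.ofReal (2 * s) ≤
      metricDist g ((extChartAt 𝓘(ℝ, E) p).symm (α s)) ((extChartAt 𝓘(ℝ, E) p).symm (β s))) : v = w := by
  set z₀ := extChartAt 𝓘(ℝ, E) p p with hz₀
  have hz₀t : z₀ ∈ (extChartAt 𝓘(ℝ, E) p).target := mem_extChartAt_target p
  have hq : Tendsto (fun s ↦ s⁻¹ • (β s - α s)) (𝓝[>] 0) (𝓝 (w + v)) := by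
    have h1 := (hβ.sub hα).tendsto_slope_zero_right
    simpa [hα0, hβ0] using h1
  have key : ∀ κ, chartMetric g p z₀ (w + v) (w + v) < κ → 4 ≤ κ := by
    intro κ hκ
    have hκ0 : 0 ≤ κ := le_trans (hg.nonneg _ _) hκ.le
    have hc : ContinuousAt (fun x : E × E ↦ chartMetric g p x.1 x.2 x.2) (z₀, w + v) := by
      have h1 : ContinuousAt (fun x : E × E ↦ chartMetric g p x.1) (z₀, w + v) :=
        ContinuousAt.comp (g := chartMetric g p) (f := Prod.fst) (hg.contDiffAt hz₀t).continuousAt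
          continuousAt_fst
      exact (h1.clm_apply continuousAt_snd).clm_apply continuousAt_snd
    have hev := hc.eventually_lt_const hκ
    rw [nhds_prod_eq] at hev
    obtain ⟨P, hP, Q, hQ, hPQ⟩ := eventually_prod_iff.1 hev
    obtain ⟨R, hR, hRP⟩ := Metric.nhds_basis_ball.mem_iff.1
      (hP.and ((isOpen_extChartAt_target p).mem_nhds hz₀t))
    have hαR : ∀ᶠ s in 𝓝[>] (0 : ℝ), α s ∈ Metric.ball z₀ R :=
      nhdsWithin_le_nhds (hα.continuousAt (by rw [hα0]; exact Metric.ball_mem_nhds _ hR))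
    have hβR : ∀ᶠ s in 𝓝[>] (0 : ℝ), β s ∈ Metric.ball z₀ R :=
      nhdsWithin_le_nhds (hβ.continuousAt (by rw [hβ0]; exact Metric.ball_mem_nhds _ hR))
    obtain ⟨s, h1, h2, h3, h4, hs⟩ := (h.and (hαR.and (hβR.and ((hq.eventually hQ).and
      self_mem_nhdsWithin)))).exists
    have hs : 0 < s := hs
    have hle := metricDist_le_of_segment (g := g) (x₀ := p) (u := α s) (v := β s) (C := s * Real.sqrt κ)
      (by positivity) fun z hz ↦ by
        have hz' := hRP ((convex_ball z₀ R).segment_subset h2 h3 hz)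
        refine ⟨hz'.2, ?_⟩
        have h5 : β s - α s = s • (s⁻¹ • (β s - α s)) := by
          rw [smul_smul, mul_inv_cancel₀ hs.ne', one_smul]
        have h6 := hPQ hz'.1 h4
        rw [h5, mul_pow, Real.sq_sqrt hκ0]
        simp only [map_smul, smul_apply, smul_eq_mul] at h6 ⊢
        nlinarith [mul_lt_mul_of_pos_left h6 (pow_pos hs 2)]
    have h7 := (ENNReal.ofReal_le_ofReal_iff (by positivity)).1 (h1.trans hle)
    have h8 : 2 ≤ Real.sqrt κ := by nlinarith
    have h9 := Real.sq_sqrt hκ0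
    nlinarith
  have h4 : 4 ≤ chartMetric g p z₀ (w + v) (w + v) := le_of_forall_gt_imp_ge_of_dense key
  have h5 : chartMetric g p z₀ v w = chartMetric g p z₀ w v := hg.chartMetric_symm _ _ _
  by_contra hne
  have h6 := hg.chartMetric_pos hz₀t (sub_ne_zero.2 hne)
  simp only [map_add, map_sub, add_apply, sub_apply] at h4 h6
  linarith

end DistanceTopology

section EndDistance

variable {E : Type*} [NormedAddCommGroup E] [NormedSpace ℝ E] [FiniteDimensional ℝ E]
  {M : Type*} [TopologicalSpace M] [ChartedSpace E M] [IsManifold 𝓘(ℝ, E) ∞ M] [T2Space M]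
  {g : ∀ x : M, TangentSpace 𝓘(ℝ, E) x →L[ℝ] TangentSpace 𝓘(ℝ, E) x →L[ℝ] ℝ} {γ : ℝ → M} {a b σ : ℝ}

variable (g) in
/-- The distance to the right end of a curve of speed at most `σ` on `(a, b)`. -/
def endDist (γ : ℝ → M) (a b σ : ℝ) (x : M) : ℝ≥0∞ :=
  ⨅ t ∈ Ioo a b, (metricDist g x (γ t) + ENNReal.ofReal (σ * (b - t)))

theorem endDist_le_add (x y : M) : endDist g γ a b σ x ≤ metricDist g x y + endDist g γ a b σ y := by
  simp only [endDist, ENNReal.add_iInf]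
  refine le_iInf₂ fun t ht ↦ (iInf₂_le t ht).trans ?_
  rw [← add_assoc]
  exact add_le_add_left metricDist_triangle _

theorem exists_metricDist_add_lt_of_endDist_lt (hσ : 0 ≤ σ)
    (hγ : ∀ t ∈ Ioo a b, ∀ u ∈ Ioo a b, t ≤ u → metricDist g (γ t) (γ u) ≤ ENNReal.ofReal (σ * (u - t)))
    {x : M} {c : ℝ≥0∞} (h : endDist g γ a b σ x < c) {e : ℝ} (he : 0 < e) :
    ∃ t ∈ Ioo a b, b - t < e ∧ metricDist g x (γ t) + ENNReal.ofReal (σ * (b - t)) < c := by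
  simp only [endDist, iInf_lt_iff] at h
  obtain ⟨t, ht, hlt⟩ := h
  obtain ⟨u, hu1, hu2⟩ := exists_between (max_lt ht.2 (by linarith : b - e < b))
  have htu : t < u := (le_max_left _ _).trans_lt hu1
  have hu : u ∈ Ioo a b := ⟨ht.1.trans htu, hu2⟩
  refine ⟨u, hu, by linarith [(le_max_right t (b - e)).trans_lt hu1], lt_of_le_of_lt ?_ hlt⟩
  calc metricDist g x (γ u) + ENNReal.ofReal (σ * (b - u))
      ≤ metricDist g x (γ t) + ENNReal.ofReal (σ * (u - t)) + ENNReal.ofReal (σ * (b - u)) := by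
        gcongr
        exact metricDist_triangle.trans (add_le_add_right (hγ t ht u hu htu.le) _)
    _ = _ := by
        rw [add_assoc, ← ENNReal.ofReal_add (mul_nonneg hσ (by linarith)) (mul_nonneg hσ (by linarith))]
        ring_nf

/-- Small spheres contain a point on a minimizing path to the end of the curve. -/
theorem exists_mem_sphere_add_endDist_le (hg : IsSmoothMetric g) (hσ : 0 ≤ σ)
    (hγ : ∀ t ∈ Ioo a b, ∀ u ∈ Ioo a b, t ≤ u → metricDist g (γ t) (γ u) ≤ ENNReal.ofReal (σ * (u - t)))
    {x : M} (hx0 : endDist g γ a b σ x ≠ 0) (hx : endDist g γ a b σ x ≠ ⊤) :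
    ∃ R₀ > 0, ∀ R, 0 < R → R ≤ R₀ → ∃ y ∈ closedChartBall E x R, y ∉ chartBall E x R ∧
      metricDist g x y + endDist g γ a b σ y ≤ endDist g γ a b σ x := by
  obtain ⟨R₁, l, C, hb₁⟩ := hg.exists_isChartBall x
  set f := endDist g γ a b σ with hf
  set F := (f x).toReal with hF
  have hF0 : 0 < F := ENNReal.toReal_pos hx0 hx
  have hfF : f x = ENNReal.ofReal F := (ENNReal.ofReal_toReal hx).symm
  have hC := hb₁.C_pos
  refine ⟨min R₁ (F / (2 * C)), lt_min hb₁.R_pos (by positivity), fun R hR hRle ↦ ?_⟩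
  have hb := hb₁.mono hR (hRle.trans (min_le_left _ _))
  have hCR : C * R ≤ F / 2 := by
    have := hRle.trans (min_le_right _ _)
    rw [le_div_iff₀ (by positivity)] at this
    linarith
  have happ : ∀ e : ℝ≥0∞, 0 < e → ∃ y ∈ closedChartBall E x R ∩ (chartBall E x R)ᶜ,
      metricDist g x y + f y ≤ f x + e := by
    intro e he
    obtain ⟨t, ht, htb, hlt⟩ := exists_metricDist_add_lt_of_endDist_lt hσ hγ
      (ENNReal.lt_add_right hx he.ne') (e := F / (2 * (σ + 1))) (by positivity)
    have hσt : σ * (b - t) < F / 2 := by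
      rw [lt_div_iff₀ (by positivity)] at htb
      nlinarith [ht.2]
    have hout : γ t ∉ chartBall E x R := by
      intro hin
      have h1 : f x ≤ metricDist g x (γ t) + ENNReal.ofReal (σ * (b - t)) := iInf₂_le t ht
      have h2 : metricDist g x (γ t) ≤ ENNReal.ofReal (F / 2) := by
        refine (hb.metricDist_le ⟨hin.1, Metric.ball_subset_closedBall hin.2⟩).trans
          (ENNReal.ofReal_le_ofReal (le_trans ?_ hCR))
        have := (mem_ball_iff_norm.1 hin.2).le
        gcongr
      have h3 := h1.trans (add_le_add_left h2 _)
      rw [hfF, ← ENNReal.ofReal_add (by positivity) (mul_nonneg hσ (by linarith [ht.2])),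
        ENNReal.ofReal_le_ofReal_iff (add_nonneg (by positivity) (mul_nonneg hσ (by linarith [ht.2])))] at h3
      linarith
    have hlt' : metricDist g x (γ t) < f x + e - ENNReal.ofReal (σ * (b - t)) :=
      lt_tsub_iff_right.2 hlt
    obtain ⟨η, h0, h1, hη, hL⟩ := exists_path_of_metricDist_lt hlt'
    obtain ⟨s, hs, hsm, hse⟩ := exists_mem_sphere_of_notMem_chartBall hb.subset zero_le_one
      hη.continuous.continuousOn (by rw [h0]; exact mem_chartBall_self hR x) (by rwa [h1])
    refine ⟨η s, ⟨hsm s (right_mem_Icc.2 hs.1), fun hin ↦ ?_⟩, ?_⟩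
    · exact absurd hse (mem_ball_iff_norm.1 hin.2).ne
    · have h2 := metricDist_le_metricLength (g := g) (hη.contMDiffOn (s := Icc 0 s)) hs.1
      have h3 := metricDist_le_metricLength (g := g) (hη.contMDiffOn (s := Icc s 1)) hs.2
      have h4 : f (η s) ≤ metricDist g (η s) (γ t) + ENNReal.ofReal (σ * (b - t)) := iInf₂_le t ht
      rw [h0] at h2
      rw [h1] at h3
      calc metricDist g x (η s) + f (η s)
          ≤ metricLength g η 0 s + (metricLength g η s 1 + ENNReal.ofReal (σ * (b - t))) :=
            add_le_add h2 (h4.trans (add_le_add_left h3 _))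
        _ = metricLength g η 0 1 + ENNReal.ofReal (σ * (b - t)) := by
            rw [← add_assoc, metricLength_add hs.1 hs.2]
        _ ≤ f x + e := (lt_tsub_iff_right.1 hL).le
  choose y hyS hy using fun n : ℕ ↦ happ ((n : ℝ≥0∞)⁻¹) (by simp)
  have hK : IsCompact (closedChartBall E x R ∩ (chartBall E x R)ᶜ) :=
    (isCompact_closedChartBall hb.subset).inter_right (isOpen_chartBall x R).isClosed_compl
  have hfr : ∃ q ∈ closedChartBall E x R ∩ (chartBall E x R)ᶜ, MapClusterPt q atTop y :=
    hK.exists_mapClusterPt (tendsto_principal.2 (Eventually.of_forall hyS))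
  obtain ⟨q, hq, hqc⟩ := hfr
  refine ⟨q, hq.1, hq.2, ENNReal.le_of_forall_pos_le_add fun e he _ ↦ ?_⟩
  have he' : (0 : ℝ≥0∞) < e / 3 := ENNReal.div_pos (by simpa using he.ne') (by simp)
  have h1 : ∀ᶠ n : ℕ in atTop, (n : ℝ≥0∞)⁻¹ < e / 3 :=
    ENNReal.tendsto_inv_nat_nhds_zero.eventually_lt_const he'
  have h2 : ∀ᶠ r in 𝓝 q, metricDist g q r < e / 3 :=
    (tendsto_metricDist_of_tendsto hg tendsto_id).eventually_lt_const he'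
  obtain ⟨n, hn1, hn2⟩ := ((hqc.frequently h2).and_eventually h1).exists
  calc metricDist g x q + f q ≤ (metricDist g x (y n) + metricDist g (y n) q) +
        (metricDist g q (y n) + f (y n)) := add_le_add metricDist_triangle (endDist_le_add _ _)
    _ = (metricDist g x (y n) + f (y n)) + (metricDist g q (y n) + metricDist g q (y n)) := by
        rw [metricDist_comm (x := y n)]
        ring
    _ ≤ (f x + e / 3) + (e / 3 + e / 3) :=
        add_le_add ((hy n).trans (add_le_add_right hn2.le _)) (add_le_add hn1.le hn1.le)
    _ = f x + e := by
        rw [add_assoc, ← add_assoc (e / 3 : ℝ≥0∞), ENNReal.add_thirds]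

end EndDistance

section HopfRinow

variable {E : Type*} [NormedAddCommGroup E] [InnerProductSpace ℝ E] [FiniteDimensional ℝ E]
  {M : Type*} [TopologicalSpace M] [ChartedSpace E M] [IsManifold 𝓘(ℝ, E) ∞ M] [T2Space M]
  {g : ∀ x : M, TangentSpace 𝓘(ℝ, E) x →L[ℝ] TangentSpace 𝓘(ℝ, E) x →L[ℝ] ℝ}
  {cov cov' : CovariantDerivative 𝓘(ℝ, E) E (fun x : M ↦ TangentSpace 𝓘(ℝ, E) x)}
  {γ : ℝ → M} {a b σ : ℝ} {x : M}

theorem speedSq_congr {η η' : ℝ → M} {t : ℝ} (h : η =ᶠ[𝓝 t] η') : speedSq g η t = speedSq g η' t :=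
  congrArg (fun v : TangentBundle 𝓘(ℝ, E) M ↦ g v.1 v.2 v.2) (EventuallyEq.curveVelocity_heq (E := E) h)

theorem IsGeodesicOn.metricDist_le {s : Set ℝ} (hη : IsGeodesicOn cov γ s) (hs : s.OrdConnected)
    (hσ : 0 ≤ σ) (hsp : ∀ t ∈ s, speedSq g γ t ≤ σ ^ 2) {t u : ℝ} (ht : t ∈ s) (hu : u ∈ s)
    (htu : t ≤ u) : metricDist g (γ t) (γ u) ≤ ENNReal.ofReal (σ * (u - t)) :=
  metricDist_le_of_speedSq_le hσ (hη.1.mono (hs.out ht hu)) htu fun _ hr ↦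
    hsp _ (hs.out ht hu (Ioo_subset_Icc_self hr))

theorem exists_unit_geodesic_add_endDist_le (hcov : cov.ContMDiffCovariantDerivative ∞)
    (hg : IsSmoothMetric g) (hm : IsParallelMetric g cov)
    (hΓ : ∀ x₀ : M, ∀ z ∈ (extChartAt 𝓘(ℝ, E) x₀).target, ∀ a b,
      christoffel cov x₀ z a b = christoffel cov x₀ z b a) (hσ : 0 ≤ σ)
    (hγ : ∀ t ∈ Ioo a b, ∀ u ∈ Ioo a b, t ≤ u → metricDist g (γ t) (γ u) ≤ ENNReal.ofReal (σ * (u - t)))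
    (hx0 : endDist g γ a b σ x ≠ 0) (hx : endDist g γ a b σ x ≠ ⊤) :
    ∃ (β : ℝ → M) (h e : ℝ), 0 < h ∧ h < e ∧ IsGeodesicOn cov β (Ioo (-e) e) ∧ β 0 = x ∧
      (∀ t ∈ Ioo (-e) e, speedSq g β t = 1) ∧
      ∀ t ∈ Icc 0 h, endDist g γ a b σ (β t) + ENNReal.ofReal t ≤ endDist g γ a b σ x := by
  obtain ⟨ρ, hρ, hmin⟩ := exists_minimizing_geodesic hcov hg hm hΓ x
  obtain ⟨R₀, hR₀, hsph⟩ := exists_mem_sphere_add_endDist_le hg hσ hγ hx0 hx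
  obtain ⟨R₁, l, C, hb₁⟩ := hg.exists_isChartBall x
  obtain ⟨R, hR, hRρ, hRR₀, hRR₁⟩ : ∃ R, 0 < R ∧ R ≤ ρ ∧ R ≤ R₀ ∧ R ≤ R₁ :=
    ⟨min ρ (min R₀ R₁), lt_min hρ (lt_min hR₀ hb₁.R_pos), min_le_left _ _,
      (min_le_right _ _).trans (min_le_left _ _), (min_le_right _ _).trans (min_le_right _ _)⟩
  obtain ⟨y, hy, hyn, hyle⟩ := hsph R hR hRR₀
  obtain ⟨ζ, T, ε, τ, hT0, hTε, hτ0, hζ, hζ0, hζT, hsp, hd⟩ :=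
    hmin y ⟨hy.1, Metric.closedBall_subset_closedBall hRρ hy.2⟩
  have h0ε : (0 : ℝ) ∈ Ioo (-ε) ε := ⟨by linarith, by linarith⟩
  have hTm : T ∈ Ioo (-ε) ε := ⟨by linarith, hTε⟩
  have hτ : 0 < τ := by
    refine lt_of_le_of_ne hτ0 fun h0 ↦ ?_
    have h1 := hζ.metricDist_le (g := g) ordConnected_Ioo hτ0 (fun t ht ↦ (hsp t ht).le) h0ε hTm hT0.le
    rw [hζ0, hζT, ← h0, zero_mul, ENNReal.ofReal_zero] at h1
    have h2 := (hb₁.mono hR hRR₁).le_metricDist_of_notMem hyn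
    have h3 := mul_pos hb₁.l_pos hR
    exact absurd (h2.trans h1) (not_le.2 (ENNReal.ofReal_pos.2 h3))
  have hβ := hζ.comp_affine isOpen_Ioo τ⁻¹ 0
  have hmem : ∀ t, t ∈ Ioo (-(τ * ε)) (τ * ε) → τ⁻¹ * t + 0 ∈ Ioo (-ε) ε := fun t ht ↦ by
    rw [add_zero, inv_mul_eq_div, mem_Ioo, lt_div_iff₀ hτ, div_lt_iff₀ hτ]
    constructor <;> linarith [ht.1, ht.2]
  have hβ' := hβ.mono (s' := Ioo (-(τ * ε)) (τ * ε)) hmem isOpen_Ioo.uniqueDiffOn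
  have hspβ : ∀ t ∈ Ioo (-(τ * ε)) (τ * ε), speedSq g (fun u ↦ ζ (τ⁻¹ * u + 0)) t = 1 := fun t ht ↦ by
    rw [speedSq_comp_affine (hζ.mdifferentiableAt (Ioo_mem_nhds (hmem t ht).1 (hmem t ht).2)),
      hsp _ (hmem t ht)]
    field_simp
  have hTε' : τ * T < τ * ε := by gcongr
  have hβT : ζ (τ⁻¹ * (τ * T) + 0) = y := by
    rw [← hζT]
    congr 1
    field_simp
    simp
  refine ⟨_, τ * T, τ * ε, mul_pos hτ hT0, hTε', hβ', by simpa using hζ0, hspβ, fun t ht ↦ ?_⟩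
  have hτT := mul_pos hτ hT0
  have h1 := hβ'.metricDist_le (g := g) ordConnected_Ioo zero_le_one
    (fun t ht ↦ by rw [hspβ t ht, one_pow]) (t := t) (u := τ * T)
    ⟨by linarith [ht.1], by linarith [ht.2]⟩ ⟨by linarith, hTε'⟩ ht.2
  simp only [hβT, one_mul] at h1
  calc endDist g γ a b σ (ζ (τ⁻¹ * t + 0)) + ENNReal.ofReal t
      ≤ ENNReal.ofReal (τ * T - t) + endDist g γ a b σ y + ENNReal.ofReal t := by
        gcongr
        exact (endDist_le_add _ _).trans (add_le_add_left h1 _)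
    _ = ENNReal.ofReal (τ * T) + endDist g γ a b σ y := by
        rw [add_right_comm, ← ENNReal.ofReal_add (by linarith [ht.2]) ht.1]
        ring_nf
    _ ≤ metricDist g x y + endDist g γ a b σ y := by gcongr
    _ ≤ _ := hyle

/-- If the Levi-Civita connection is complete, a curve of finite length accumulates at its end. -/
theorem exists_endDist_eq_zero (hcov : cov.ContMDiffCovariantDerivative ∞)
    (hg : IsSmoothMetric g) (hm : IsParallelMetric g cov)
    (hΓ : ∀ x₀ : M, ∀ z ∈ (extChartAt 𝓘(ℝ, E) x₀).target, ∀ a b,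
      christoffel cov x₀ z a b = christoffel cov x₀ z b a) (hcomp : GeodesicallyComplete cov)
    (hσ : 0 ≤ σ)
    (hγ : ∀ t ∈ Ioo a b, ∀ u ∈ Ioo a b, t ≤ u → metricDist g (γ t) (γ u) ≤ ENNReal.ofReal (σ * (u - t)))
    (hx : endDist g γ a b σ x ≠ ⊤) : ∃ y, endDist g γ a b σ y = 0 := by
  by_contra! hne
  set f := endDist g γ a b σ with hf
  obtain ⟨β₀, h₀, e₀, hh₀, hhe₀, hβ₀, hβ₀0, hβ₀sp, hβ₀f⟩ :=
    exists_unit_geodesic_add_endDist_le hcov hg hm hΓ hσ hγ (hne x) hx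
  obtain ⟨η, hη, hηβ⟩ := hcomp β₀ h₀ hh₀ (hβ₀.mono (fun t ht ↦ ⟨by linarith [ht.1], by linarith [ht.2]⟩)
    (uniqueDiffOn_Icc hh₀))
  have hη0 : η 0 = x := by rw [hηβ (left_mem_Icc.2 hh₀.le), hβ₀0]
  have hηsp : ∀ t, speedSq g η t = 1 := by
    intro t
    rw [hη.speedSq_eq_of_mem hg hm isOpen_univ isPreconnected_univ (mem_univ t) (mem_univ (h₀ / 2)),
      speedSq_congr (hηβ.eventuallyEq_of_mem (Icc_mem_nhds (by linarith) (by linarith))),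
      hβ₀sp _ ⟨by linarith, by linarith⟩]
  have hηd : ∀ t u, t ≤ u → metricDist g (η t) (η u) ≤ ENNReal.ofReal (u - t) := fun t u htu ↦ by
    have := hη.metricDist_le (g := g) ordConnected_univ zero_le_one (fun t _ ↦ by rw [hηsp t, one_pow])
      (mem_univ t) (mem_univ u) htu
    rwa [one_mul] at this
  let S : Set ℝ := {T | 0 ≤ T ∧ f (η T) + ENNReal.ofReal T ≤ f x}
  have hS₀ : h₀ ∈ S := ⟨hh₀.le, by
    rw [hηβ (right_mem_Icc.2 hh₀.le)]
    exact hβ₀f h₀ (right_mem_Icc.2 hh₀.le)⟩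
  have hSb : BddAbove S := ⟨(f x).toReal, fun T hT ↦ by
    have h1 : ENNReal.ofReal T ≤ f x := le_add_self.trans hT.2
    exact (ENNReal.ofReal_le_iff_le_toReal hx).1 h1⟩
  set T := sSup S with hT
  have hh₀T : h₀ ≤ T := le_csSup hSb hS₀
  have hTS : f (η T) + ENNReal.ofReal T ≤ f x := by
    refine ENNReal.le_of_forall_pos_le_add fun e he _ ↦ ?_
    obtain ⟨u, huS, hu⟩ := exists_lt_of_lt_csSup ⟨h₀, hS₀⟩ (show T - e / 2 < sSup S by
      have : (0 : ℝ) < e := he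
      linarith)
    have huT : u ≤ T := le_csSup hSb huS
    calc f (η T) + ENNReal.ofReal T ≤ (ENNReal.ofReal (T - u) + f (η u)) +
          (ENNReal.ofReal u + ENNReal.ofReal (T - u)) := by
          refine add_le_add ((endDist_le_add _ (η u)).trans (add_le_add_left ?_ _)) ?_
          · rw [metricDist_comm]
            exact hηd u T huT
          · rw [← ENNReal.ofReal_add huS.1 (by linarith)]
            ring_nf
            exact le_rfl
      _ = (f (η u) + ENNReal.ofReal u) + ENNReal.ofReal (2 * (T - u)) := by
          rw [two_mul, ENNReal.ofReal_add (by linarith) (by linarith)]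
          ring
      _ ≤ f x + e := by
          refine add_le_add huS.2 ?_
          rw [← ENNReal.ofReal_coe_nnreal]
          exact ENNReal.ofReal_le_ofReal (by linarith)
  set p := η T with hp
  have hpx : f p ≤ f x := le_self_add.trans hTS
  have hpt : f p ≠ ⊤ := ne_top_of_le_ne_top hx hpx
  obtain ⟨β, h, e, hh, hhe, hβ, hβ0, hβsp, hβf⟩ :=
    exists_unit_geodesic_add_endDist_le hcov hg hm hΓ hσ hγ (hne p) hpt
  have hT0 : 0 < T := hh₀.trans_le hh₀T
  have h0e : (0 : ℝ) ∈ Ioo (-e) e := ⟨by linarith, by linarith⟩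
  have hsep : ∀ s ∈ Ioo 0 (min h T), ENNReal.ofReal (2 * s) ≤ metricDist g (η (T - s)) (β s) := by
    intro s hs
    have hsh : s < h := hs.2.trans_le (min_le_left _ _)
    have hsT : s < T := hs.2.trans_le (min_le_right _ _)
    have h1 : f x ≤ ENNReal.ofReal (T - s) + (metricDist g (η (T - s)) (β s) + f (β s)) := by
      refine (endDist_le_add x (η (T - s))).trans (add_le_add ?_ (endDist_le_add _ _))
      have := hηd 0 (T - s) (by linarith)
      rwa [hη0, sub_zero] at this
    have h2 : f (β s) + ENNReal.ofReal s + ENNReal.ofReal T ≤ f x :=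
      (add_le_add_left (hβf s ⟨hs.1.le, hsh.le⟩) _).trans hTS
    have h3 : f (β s) ≠ ⊤ := ne_top_of_le_ne_top hx (le_trans (le_self_add.trans le_self_add) h2)
    have h4 : (f (β s) + ENNReal.ofReal (T - s)) + ENNReal.ofReal (2 * s) ≤
        (f (β s) + ENNReal.ofReal (T - s)) + metricDist g (η (T - s)) (β s) := by
      calc _ = f (β s) + ENNReal.ofReal s + ENNReal.ofReal T := by
            rw [add_assoc, add_assoc, ← ENNReal.ofReal_add (by linarith) (by linarith [hs.1]),
              ← ENNReal.ofReal_add hs.1.le hT0.le]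
            ring_nf
        _ ≤ f x := h2
        _ ≤ _ := h1
        _ = _ := by ring
    exact (ENNReal.add_le_add_iff_left (ENNReal.add_ne_top.2 ⟨h3, ENNReal.ofReal_ne_top⟩)).1 h4
  have hps : p ∈ (chartAt E p).source := mem_chart_source E p
  have hβs : β 0 ∈ (chartAt E p).source := by rwa [hβ0]
  have hηmd := hη.mdifferentiableAt (t := T) univ_mem
  have hβmd := hβ.mdifferentiableAt (Ioo_mem_nhds h0e.1 h0e.2)
  have hηdv := hasDerivAt_extChartAt_comp hηmd hps
  have hβdv := hasDerivAt_extChartAt_comp hβmd hβs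
  have hvw : chartCoord p (η T) (curveVelocity 𝓘(ℝ, E) η univ T) =
      chartCoord p (β 0) (curveVelocity 𝓘(ℝ, E) β univ 0) := by
    have hηs : ∀ᶠ s in 𝓝[>] (0 : ℝ), η (T - s) ∈ (chartAt E p).source := by
      have h1 : ContinuousAt (fun s ↦ η (T - s)) 0 := by
        have h2 : ContinuousAt η (T - 0) := by
          rw [sub_zero]
          exact hηmd.continuousAt
        exact ContinuousAt.comp (g := η) (f := fun s ↦ T - s) h2 (by fun_prop)
      have h3 := h1.eventually (chart_source_mem_nhds_of_mem (E := E) (x₀ := p) (by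
        change η (T - 0) ∈ _
        rw [sub_zero]
        exact hps))
      exact nhdsWithin_le_nhds h3
    have hβs' : ∀ᶠ s in 𝓝[>] (0 : ℝ), β s ∈ (chartAt E p).source :=
      nhdsWithin_le_nhds (hβmd.continuousAt (chart_source_mem_nhds_of_mem hβs))
    refine eq_of_two_mul_le_metricDist hg (p := p)
      (α := fun s ↦ extChartAt 𝓘(ℝ, E) p (η (T - s))) (β := fun s ↦ extChartAt 𝓘(ℝ, E) p (β s))
      (by simp [hp]) (by simp [hβ0]) ?_ hβdv ?_ ?_ ?_
    · have h1 : HasDerivAt (fun u ↦ extChartAt 𝓘(ℝ, E) p (η u))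
          (chartCoord p (η T) (curveVelocity 𝓘(ℝ, E) η univ T)) (T - 0) := by
        rw [sub_zero]
        exact hηdv
      exact h1.comp_const_sub T 0
    · rw [← speedSq_eq_of_hasDerivAt hηmd hps hηdv, hηsp]
    · have h1 := speedSq_eq_of_hasDerivAt (g := g) hβmd hβs hβdv
      rw [hβsp 0 h0e] at h1
      rw [h1, hβ0]
    · filter_upwards [Ioo_mem_nhdsGT (lt_min hh hT0), hηs, hβs'] with s hs h1 h2
      rw [(extChartAt 𝓘(ℝ, E) p).left_inv (by simpa using h1),
        (extChartAt 𝓘(ℝ, E) p).left_inv (by simpa using h2)]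
      exact hsep s hs
  have hηT := hη.comp_affine isOpen_univ 1 T
  rw [preimage_univ] at hηT
  have hT1 : (1 * 0 + T : ℝ) = T := by ring
  have hev : (fun u ↦ η (1 * u + T)) =ᶠ[𝓝 0] β := by
    refine hηT.eventuallyEq hcov hβ univ_mem (Ioo_mem_nhds h0e.1 h0e.2) (x₀ := p) ?_ hβs ?_
    · rw [hT1]
      exact hps
    · rw [chartPhase_comp_affine (x₀ := p) (by rwa [hT1]), hT1, one_smul]
      refine Prod.ext ?_ hvw
      exact congrArg (extChartAt 𝓘(ℝ, E) p) hβ0.symm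
  have heq := IsGeodesicOn.eqOn hcov isOpen_Ioo isPreconnected_Ioo
    (hηT.mono (subset_univ _) isOpen_Ioo.uniqueDiffOn) hβ h0e hev
  have hlast : T + h ∈ S := by
    refine ⟨by linarith, ?_⟩
    have h1 : η (T + h) = β h := by
      rw [← heq ⟨by linarith, hhe⟩]
      congr 1
      ring
    rw [h1, ENNReal.ofReal_add hT0.le hh.le, add_comm (ENNReal.ofReal T), ← add_assoc]
    exact (add_le_add_left (hβf h (right_mem_Icc.2 hh.le)) _).trans hTS
  linarith [le_csSup hSb hlast]

/-- If the Levi-Civita connection of `g` is complete then the geodesics of every metric connection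
extend. -/
theorem geodesicsExtendForward_of_geodesicallyComplete (hcov : cov.ContMDiffCovariantDerivative ∞)
    (hcov' : cov'.ContMDiffCovariantDerivative ∞)
    (hg : IsSmoothMetric g) (hm : IsParallelMetric g cov) (hm' : IsParallelMetric g cov')
    (hΓ : ∀ x₀ : M, ∀ z ∈ (extChartAt 𝓘(ℝ, E) x₀).target, ∀ a b,
      christoffel cov x₀ z a b = christoffel cov x₀ z b a) (hcomp : GeodesicallyComplete cov) :
    GeodesicsExtendForward cov' := by
  intro γ a b hab hγ
  set m := (a + b) / 2 with hmid
  have hmm : m ∈ Ioo a b := ⟨by linarith, by linarith⟩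
  set σ := Real.sqrt (speedSq g γ m) + 1 with hσ
  have hsq : 0 ≤ Real.sqrt (speedSq g γ m) := Real.sqrt_nonneg _
  have hσ0 : 0 < σ := by positivity
  have hsp : ∀ t ∈ Ioo a b, speedSq g γ t ≤ σ ^ 2 := fun t ht ↦ by
    rw [hγ.speedSq_eq_of_mem hg hm' isOpen_Ioo isPreconnected_Ioo ht hmm]
    have := Real.sq_sqrt (show 0 ≤ speedSq g γ m from hg.nonneg _ _)
    nlinarith
  have hd : ∀ t ∈ Ioo a b, ∀ u ∈ Ioo a b, t ≤ u → metricDist g (γ t) (γ u) ≤ ENNReal.ofReal (σ * (u - t)) :=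
    fun t ht u hu htu ↦ hγ.metricDist_le ordConnected_Ioo hσ0.le hsp ht hu htu
  have hfin : endDist g γ a b σ (γ m) ≠ ⊤ := by
    have h1 : endDist g γ a b σ (γ m) ≤ metricDist g (γ m) (γ m) + ENNReal.ofReal (σ * (b - m)) :=
      iInf₂_le m hmm
    rw [metricDist_self, zero_add] at h1
    exact ne_top_of_le_ne_top ENNReal.ofReal_ne_top h1
  obtain ⟨q, hq⟩ := exists_endDist_eq_zero hcov hg hm hΓ hcomp hσ0.le hd hfin
  have hseq : ∀ n : ℕ, ∃ t ∈ Ioo a b, b - t < 1 / ((n : ℝ) + 1) ∧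
      metricDist g q (γ t) + ENNReal.ofReal (σ * (b - t)) < ((n : ℝ≥0∞) + 1)⁻¹ := fun n ↦
    exists_metricDist_add_lt_of_endDist_lt hσ0.le hd (by
      rw [hq]
      simp) (by positivity)
  choose τ hτ hτb hτq using hseq
  refine hγ.exists_extend_of_tendsto hcov' hg hm' hτ ?_ (q := q) (tendsto_of_tendsto_metricDist hg ?_)
  · have h1 : Tendsto (fun n ↦ b - τ n) atTop (𝓝 0) :=
      squeeze_zero (fun n ↦ by linarith [(hτ n).2]) (fun n ↦ (hτb n).le)
        tendsto_one_div_add_atTop_nhds_zero_nat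
    have h2 := h1.const_sub b
    simpa using h2
  · have h1 : Tendsto (fun n : ℕ ↦ ((n : ℝ≥0∞) + 1)⁻¹) atTop (𝓝 0) := by
      have := (tendsto_add_atTop_iff_nat 1).2 ENNReal.tendsto_inv_nat_nhds_zero
      simpa using this
    exact tendsto_of_tendsto_of_tendsto_of_le_of_le tendsto_const_nhds h1 (fun _ ↦ zero_le)
      fun n ↦ le_self_add.trans (hτq n).le

end HopfRinow

section ChartCalculus

variable {E : Type*} [NormedAddCommGroup E] [NormedSpace ℝ E] [FiniteDimensional ℝ E]
  {M : Type*} [TopologicalSpace M] [ChartedSpace E M] [IsManifold 𝓘(ℝ, E) ∞ M]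
  {cov : CovariantDerivative 𝓘(ℝ, E) E (fun x : M ↦ TangentSpace 𝓘(ℝ, E) x)}
  {F : Type*} [NormedAddCommGroup F] [NormedSpace ℝ F] {x₀ p : M}

theorem contDiffAt_of_clm_apply {L : E → E →L[ℝ] F} {s : Set E} (hs : IsOpen s) {z : E} (hz : z ∈ s)
    (h : ∀ a, ∀ z ∈ s, ContDiffAt ℝ ∞ (fun z ↦ L z a) z) : ContDiffAt ℝ ∞ L z :=
  (contDiffOn_clm_apply.2 fun a z hz ↦ (h a z hz).contDiffWithinAt).contDiffAt (hs.mem_nhds hz)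

theorem contDiffAt_comp_extChartAt_symm {f : M → F} {z : E} (hz : z ∈ (extChartAt 𝓘(ℝ, E) x₀).target)
    (hf : ContMDiffAt 𝓘(ℝ, E) 𝓘(ℝ, F) ∞ f ((extChartAt 𝓘(ℝ, E) x₀).symm z)) :
    ContDiffAt ℝ ∞ (fun w ↦ f ((extChartAt 𝓘(ℝ, E) x₀).symm w)) z := by
  have h1 : ContMDiffAt 𝓘(ℝ, E) 𝓘(ℝ, E) ∞ (extChartAt 𝓘(ℝ, E) x₀).symm z :=
    (contMDiffOn_extChartAt_symm x₀).contMDiffAt ((isOpen_extChartAt_target x₀).mem_nhds hz)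
  exact contMDiffAt_iff_contDiffAt.1 (ContMDiffAt.comp z hf h1)

theorem contMDiffAt_comp_extChartAt {f : E → F} (hp : p ∈ (chartAt E x₀).source)
    (hf : ContDiffAt ℝ ∞ f (extChartAt 𝓘(ℝ, E) x₀ p)) :
    ContMDiffAt 𝓘(ℝ, E) 𝓘(ℝ, F) ∞ (fun q ↦ f (extChartAt 𝓘(ℝ, E) x₀ q)) p :=
  ContMDiffAt.comp p (contMDiffAt_iff_contDiffAt.2 hf)
    (contMDiffOn_extChartAt.contMDiffAt (chart_source_mem_nhds_of_mem hp))

theorem mvfderiv_comp_extChartAt {f : E → F} (hp : p ∈ (chartAt E x₀).source)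
    (hf : DifferentiableAt ℝ f (extChartAt 𝓘(ℝ, E) x₀ p)) (v : TangentSpace 𝓘(ℝ, E) p) :
    mvfderiv 𝓘(ℝ, E) (fun q ↦ f (extChartAt 𝓘(ℝ, E) x₀ q)) p v =
      fderiv ℝ f (extChartAt 𝓘(ℝ, E) x₀ p) (chartCoord x₀ p v) := by
  have h1 := hf.hasFDerivAt.hasMFDerivAt.comp p (hasMFDerivAt_chartCoord hp)
  have h2 : mfderiv 𝓘(ℝ, E) 𝓘(ℝ, F) (fun q ↦ f (extChartAt 𝓘(ℝ, E) x₀ q)) p = _ := h1.mfderiv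
  simp only [mvfderiv]
  rw [h2]
  rfl

theorem mvfderiv_congr {f f' : M → F} (h : f =ᶠ[𝓝 p] f') :
    mvfderiv 𝓘(ℝ, E) f p = mvfderiv 𝓘(ℝ, E) f' p := by
  ext v
  simp only [mvfderiv]
  have h1 : mfderiv 𝓘(ℝ, E) 𝓘(ℝ, F) f p = mfderiv 𝓘(ℝ, E) 𝓘(ℝ, F) f' p := h.mfderiv_eq
  change (mfderiv 𝓘(ℝ, E) 𝓘(ℝ, F) f p v : F) = mfderiv 𝓘(ℝ, E) 𝓘(ℝ, F) f' p v
  rw [h1]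
  rfl

theorem two_le_infty : minSmoothness ℝ 2 ≤ (∞ : WithTop ℕ∞) := by
  rw [minSmoothness_of_isRCLikeNormedField]
  exact ENat.LEInfty.out

/-- A constant vector field on a vector space. -/
def constField (a z : E) : TangentSpace 𝓘(ℝ, E) z := a

theorem mlieBracket_chartFrame (hp : p ∈ (chartAt E x₀).source) (a b : E) :
    VectorField.mlieBracket 𝓘(ℝ, E) (chartFrame x₀ a) (chartFrame x₀ b) p = 0 := by
  have : IsManifold 𝓘(ℝ, E) (minSmoothness ℝ 2) M :=
    IsManifold.of_le (n := ∞) two_le_infty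
  have hpull : ∀ a : E, ∀ᶠ q in 𝓝 p, VectorField.mpullback 𝓘(ℝ, E) 𝓘(ℝ, E) (extChartAt 𝓘(ℝ, E) x₀)
      (constField a) q = chartFrame x₀ a q := by
    intro a
    filter_upwards [chart_source_mem_nhds_of_mem hp] with q hq
    rw [VectorField.mpullback_apply, ← chartCoord_eq_mfderiv hq]
    have h1 : (chartCoord x₀ q).inverse = chartVec (E := E) x₀ q :=
      ContinuousLinearMap.inverse_eq (by ext v; exact chartCoord_chartVec hq v)
        (by ext v; exact chartVec_chartCoord hq v)
    exact congrArg (fun L : E →L[ℝ] TangentSpace 𝓘(ℝ, E) q ↦ L a) h1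
  have hs : ∀ (c : E) (z : E), MDifferentiableAt 𝓘(ℝ, E) (𝓘(ℝ, E).prod 𝓘(ℝ, E))
      (fun y : E ↦ (⟨y, constField c y⟩ : TangentBundle 𝓘(ℝ, E) E)) z := fun c z ↦
    ((contMDiffAt_vectorSpace_iff_contDiffAt (n := 1)).2 contDiffAt_const).mdifferentiableAt one_ne_zero
  have h2 := VectorField.mpullback_mlieBracket (I := 𝓘(ℝ, E)) (I' := 𝓘(ℝ, E)) (n := ∞)
    (f := extChartAt 𝓘(ℝ, E) x₀) (x₀ := p) (V := constField a) (W := constField b) (hs a _) (hs b _)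
    (contMDiffOn_extChartAt.contMDiffAt (chart_source_mem_nhds_of_mem hp))
    two_le_infty
  rw [← Filter.EventuallyEq.mlieBracket_vectorField_eq (hpull a) (hpull b), ← h2,
    VectorField.mpullback_apply]
  have h3 : VectorField.mlieBracket 𝓘(ℝ, E) (constField a) (constField b)
      (extChartAt 𝓘(ℝ, E) x₀ p) = 0 := by
    rw [← VectorField.mlieBracketWithin_univ, VectorField.mlieBracketWithin_eq_lieBracketWithin]
    change VectorField.lieBracketWithin ℝ (fun _ : E ↦ a) (fun _ ↦ b) univ _ = (0 : E)
    simp [VectorField.lieBracketWithin]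
  rw [h3, map_zero]

theorem christoffel_symm_of_torsion_eq_zero (h : ∀ x : M, cov.torsion x = 0) {z : E}
    (hz : z ∈ (extChartAt 𝓘(ℝ, E) x₀).target) (a b : E) :
    christoffel cov x₀ z a b = christoffel cov x₀ z b a := by
  set p := (extChartAt 𝓘(ℝ, E) x₀).symm z with hpdef
  have hp : p ∈ (chartAt E x₀).source := extChartAt_symm_mem_chart_source hz
  have hz' : extChartAt 𝓘(ℝ, E) x₀ p = z := (extChartAt 𝓘(ℝ, E) x₀).right_inv hz
  have h1 := cov.torsion_apply (mdifferentiableAt_chartFrame hp b) (mdifferentiableAt_chartFrame hp a)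
  rw [h p, mlieBracket_chartFrame hp, sub_zero] at h1
  have h2 := congrArg (chartCoord x₀ p) h1
  have h3 := chartCoord_cov_chartFrame cov hp a b
  have h4 := chartCoord_cov_chartFrame cov hp b a
  rw [map_sub] at h2
  rw [← hz', ← h3, ← h4]
  have h5 : chartCoord x₀ p ((0 : TangentSpace 𝓘(ℝ, E) p →L[ℝ] TangentSpace 𝓘(ℝ, E) p →L[ℝ]
    TangentSpace 𝓘(ℝ, E) p) (chartFrame x₀ b p) (chartFrame x₀ a p)) = 0 := by simp
  exact sub_eq_zero.1 (h2.symm.trans h5)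

theorem exists_smooth_eventuallyEq_chartFrame [T2Space M] (hp : p ∈ (chartAt E x₀).source) (a : E) :
    ∃ Y : Π p : M, TangentSpace 𝓘(ℝ, E) p, CMDiff ∞ (T% Y) ∧ ∀ᶠ q in 𝓝 p, Y q = chartFrame x₀ a q :=
  exists_contMDiff_eventuallyEq (by
    filter_upwards [chart_source_mem_nhds_of_mem hp] with q hq using contMDiffAt_chartFrame hq a)

namespace SmoothOneForm

variable (θ : SmoothOneForm 𝓘(ℝ, E) M)

/-- The coefficients of a one-form in the chart at `x₀`. -/
def coord (x₀ : M) (z : E) : E →L[ℝ] ℝ :=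
  (θ.toFun ((extChartAt 𝓘(ℝ, E) x₀).symm z)).comp (chartVec x₀ _)

/-- The coefficients of the exterior derivative of a one-form in the chart at `x₀`. -/
def dCoord (x₀ : M) (z : E) : E →L[ℝ] E →L[ℝ] ℝ :=
  fderiv ℝ (θ.coord x₀) z - (fderiv ℝ (θ.coord x₀) z).flip

theorem coord_extChartAt (hp : p ∈ (chartAt E x₀).source) (a : E) :
    θ.coord x₀ (extChartAt 𝓘(ℝ, E) x₀ p) a = θ.toFun p (chartFrame x₀ a p) := by
  have : (extChartAt 𝓘(ℝ, E) x₀).symm (extChartAt 𝓘(ℝ, E) x₀ p) = p :=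
    (extChartAt 𝓘(ℝ, E) x₀).left_inv (by simpa using hp)
  change θ.toFun ((extChartAt 𝓘(ℝ, E) x₀).symm (extChartAt 𝓘(ℝ, E) x₀ p)) (chartVec x₀ _ a) = _
  rw [this]
  rfl

theorem coord_chartCoord (hp : p ∈ (chartAt E x₀).source) (v : TangentSpace 𝓘(ℝ, E) p) :
    θ.coord x₀ (extChartAt 𝓘(ℝ, E) x₀ p) (chartCoord x₀ p v) = θ.toFun p v := by
  rw [θ.coord_extChartAt hp, chartFrame, chartVec_chartCoord hp]

theorem contMDiffAt_apply {X : Π p : M, TangentSpace 𝓘(ℝ, E) p} (hX : CMDiffAt ∞ (T% X) p) :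
    ContMDiffAt 𝓘(ℝ, E) 𝓘(ℝ, ℝ) ∞ (fun q ↦ θ.toFun q (X q)) p := by
  have h1 := ContMDiffAt.clm_bundle_apply (F₁ := E) (F₂ := ℝ)
    (E₁ := fun x : M ↦ TangentSpace 𝓘(ℝ, E) x) (E₂ := Bundle.Trivial M ℝ) (θ.smooth p) hX
  rw [contMDiffAt_section] at h1
  exact h1

theorem contDiffAt_coord {z : E} (hz : z ∈ (extChartAt 𝓘(ℝ, E) x₀).target) :
    ContDiffAt ℝ ∞ (θ.coord x₀) z := by
  refine contDiffAt_of_clm_apply (isOpen_extChartAt_target x₀) hz fun a z hz ↦ ?_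
  exact contDiffAt_comp_extChartAt_symm (f := fun q ↦ θ.toFun q (chartFrame x₀ a q)) hz
    (θ.contMDiffAt_apply (contMDiffAt_chartFrame (k := (⊤ : ℕ∞)) (extChartAt_symm_mem_chart_source hz) a))

theorem contDiffAt_dCoord {z : E} (hz : z ∈ (extChartAt 𝓘(ℝ, E) x₀).target) :
    ContDiffAt ℝ ∞ (θ.dCoord x₀) z := by
  refine contDiffAt_of_clm_apply (isOpen_extChartAt_target x₀) hz fun a z hz ↦ ?_
  refine contDiffAt_of_clm_apply (isOpen_extChartAt_target x₀) hz fun b z hz ↦ ?_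
  have h1 : ContDiffAt ℝ ∞ (fderiv ℝ (θ.coord x₀)) z := (θ.contDiffAt_coord hz).fderiv_right (by simp)
  exact ((h1.clm_apply contDiffAt_const).clm_apply contDiffAt_const).sub
    ((h1.clm_apply contDiffAt_const).clm_apply contDiffAt_const)

theorem dCoord_chartCoord (hp : p ∈ (chartAt E x₀).source) (v w : TangentSpace 𝓘(ℝ, E) p) :
    θ.dCoord x₀ (extChartAt 𝓘(ℝ, E) x₀ p) (chartCoord x₀ p v) (chartCoord x₀ p w) = θ.d p v w := by
  have hz : extChartAt 𝓘(ℝ, E) x₀ p ∈ (extChartAt 𝓘(ℝ, E) x₀).target :=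
    (extChartAt 𝓘(ℝ, E) x₀).map_source (by simpa using hp)
  have hd : DifferentiableAt ℝ (θ.coord x₀) (extChartAt 𝓘(ℝ, E) x₀ p) :=
    (θ.contDiffAt_coord hz).differentiableAt (by simp)
  have key : ∀ (a : E) (v : TangentSpace 𝓘(ℝ, E) p),
      mvfderiv 𝓘(ℝ, E) (fun q ↦ θ.toFun q (chartFrame x₀ a q)) p v =
        fderiv ℝ (θ.coord x₀) (extChartAt 𝓘(ℝ, E) x₀ p) (chartCoord x₀ p v) a := by
    intro a v
    have h1 : (fun q ↦ θ.toFun q (chartFrame x₀ a q)) =ᶠ[𝓝 p]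
        fun q ↦ θ.coord x₀ (extChartAt 𝓘(ℝ, E) x₀ q) a := by
      filter_upwards [chart_source_mem_nhds_of_mem hp] with q hq using (θ.coord_extChartAt hq a).symm
    rw [mvfderiv_congr h1, mvfderiv_comp_extChartAt (f := fun z ↦ θ.coord x₀ z a) hp
      (hd.clm_apply (differentiableAt_const a))]
    rw [fderiv_clm_apply hd (differentiableAt_const a)]
    simp
  have h2 := θ.d_apply (mdifferentiableAt_chartFrame hp (chartCoord x₀ p v))
    (mdifferentiableAt_chartFrame hp (chartCoord x₀ p w))
  rw [mlieBracket_chartFrame hp, map_zero, sub_zero, key, key] at h2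
  have hv : chartFrame x₀ (chartCoord x₀ p v) p = v := chartVec_chartCoord hp v
  have hw : chartFrame x₀ (chartCoord x₀ p w) p = w := chartVec_chartCoord hp w
  rw [hv, hw] at h2
  rw [h2]
  simp [dCoord]

end SmoothOneForm

end ChartCalculus

section SectionCriteria

variable {E : Type*} [NormedAddCommGroup E] [NormedSpace ℝ E] [FiniteDimensional ℝ E]
  {M : Type*} [TopologicalSpace M] [T2Space M] [ChartedSpace E M] [IsManifold 𝓘(ℝ, E) ∞ M]
  {g : ∀ x : M, TangentSpace 𝓘(ℝ, E) x →L[ℝ] TangentSpace 𝓘(ℝ, E) x →L[ℝ] ℝ}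
  {cov : CovariantDerivative 𝓘(ℝ, E) E (fun x : M ↦ TangentSpace 𝓘(ℝ, E) x)}

theorem eventuallyEq_chartMetric {x₀ p : M} (hp : p ∈ (chartAt E x₀).source) {a b : E}
    {X Y : Π p : M, TangentSpace 𝓘(ℝ, E) p} (hX : ∀ᶠ q in 𝓝 p, X q = chartFrame x₀ a q)
    (hY : ∀ᶠ q in 𝓝 p, Y q = chartFrame x₀ b q) :
    (fun q ↦ g q (X q) (Y q)) =ᶠ[𝓝 p] fun q ↦ chartMetric g x₀ (extChartAt 𝓘(ℝ, E) x₀ q) a b := by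
  filter_upwards [chart_source_mem_nhds_of_mem hp, hX, hY] with q hq h1 h2
  rw [h1, h2, ← chartMetric_chartCoord hq]
  congr 1
  · exact congrArg _ (chartCoord_chartVec hq a)
  · exact chartCoord_chartVec hq b

/-- A field of inner products is smooth if its values on smooth vector fields are smooth. -/
theorem isSmoothMetric_of_contMDiff (symm : ∀ x v w, g x v w = g x w v)
    (pos : ∀ x v, v ≠ 0 → 0 < g x v v)
    (h : ∀ X Y : Π p : M, TangentSpace 𝓘(ℝ, E) p, CMDiff ∞ (T% X) → CMDiff ∞ (T% Y) →
      ContMDiff 𝓘(ℝ, E) 𝓘(ℝ, ℝ) ∞ (fun q ↦ g q (X q) (Y q))) : IsSmoothMetric g where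
  symm := symm
  pos := pos
  smooth x₀ := by
    intro z hz
    refine ContDiffAt.contDiffWithinAt ?_
    refine contDiffAt_of_clm_apply (isOpen_extChartAt_target x₀) hz fun a z hz ↦ ?_
    refine contDiffAt_of_clm_apply (isOpen_extChartAt_target x₀) hz fun b z hz ↦ ?_
    have hp := extChartAt_symm_mem_chart_source hz
    obtain ⟨X, hX, hXe⟩ := exists_smooth_eventuallyEq_chartFrame hp a
    obtain ⟨Y, hY, hYe⟩ := exists_smooth_eventuallyEq_chartFrame hp b
    have h1 := (h X Y hX hY _).congr_of_eventuallyEq (eventuallyEq_chartMetric hp hXe hYe).symm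
    refine (contDiffAt_comp_extChartAt_symm hz h1).congr_of_eventuallyEq ?_
    filter_upwards [(isOpen_extChartAt_target x₀).mem_nhds hz] with w hw
    rw [(extChartAt 𝓘(ℝ, E) x₀).right_inv hw]

/-- A metric is parallel in charts if it is parallel on smooth vector fields. -/
theorem IsSmoothMetric.isParallelMetric (hg : IsSmoothMetric g)
    (h : ∀ X Y : Π p : M, TangentSpace 𝓘(ℝ, E) p, CMDiff ∞ (T% X) → CMDiff ∞ (T% Y) →
      ∀ (p : M) (v : TangentSpace 𝓘(ℝ, E) p), mvfderiv 𝓘(ℝ, E) (fun q ↦ g q (X q) (Y q)) p v =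
        g p (cov X p v) (Y p) + g p (X p) (cov Y p v)) : IsParallelMetric g cov := by
  intro x₀ z hz w a b
  have hp := extChartAt_symm_mem_chart_source hz
  have hz' := (extChartAt 𝓘(ℝ, E) x₀).right_inv hz
  generalize (extChartAt 𝓘(ℝ, E) x₀).symm z = p at hp hz'
  subst hz'
  obtain ⟨X, hX, hXe⟩ := exists_smooth_eventuallyEq_chartFrame hp a
  obtain ⟨Y, hY, hYe⟩ := exists_smooth_eventuallyEq_chartFrame hp b
  have hcov : ∀ (a : E) (X : Π p : M, TangentSpace 𝓘(ℝ, E) p), CMDiff ∞ (T% X) →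
      (∀ᶠ q in 𝓝 p, X q = chartFrame x₀ a q) → cov X p = cov (chartFrame x₀ a) p :=
    fun a X hX hXe ↦ cov.isCovariantDerivativeOn.congr_of_eventuallyEq
      ((hX p).mdifferentiableAt (by simp)) (mdifferentiableAt_chartFrame hp _) univ_mem hXe
  have h1 := h X Y hX hY p (chartFrame x₀ w p)
  have hd : DifferentiableAt ℝ (chartMetric g x₀) (extChartAt 𝓘(ℝ, E) x₀ p) :=
    (hg.contDiffAt hz).differentiableAt (by simp)
  rw [mvfderiv_congr (eventuallyEq_chartMetric hp hXe hYe),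
    mvfderiv_comp_extChartAt (f := fun z ↦ chartMetric g x₀ z a b) hp
      ((hd.clm_apply (differentiableAt_const a)).clm_apply (differentiableAt_const b)),
    hcov a X hX hXe, hcov b Y hY hYe, hXe.self_of_nhds, hYe.self_of_nhds,
    ← chartMetric_chartCoord hp, ← chartMetric_chartCoord hp] at h1
  have hΓ : ∀ a w : E, chartCoord x₀ p (cov (chartFrame x₀ a) p (chartFrame x₀ w p)) =
    christoffel cov x₀ (extChartAt 𝓘(ℝ, E) x₀ p) a w := chartCoord_cov_chartFrame cov hp
  have ha : ∀ a : E, chartCoord x₀ p (chartFrame x₀ a p) = a := chartCoord_chartVec hp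
  rw [hΓ, hΓ, ha, ha, ha, fderiv_clm_apply (hd.clm_apply (differentiableAt_const a)) (differentiableAt_const b),
    fderiv_clm_apply hd (differentiableAt_const a)] at h1
  simpa using h1

end SectionCriteria

/-- A nondegenerate bilinear form on a finite dimensional space is invertible. -/
theorem isInvertible_of_injective {E : Type*} [NormedAddCommGroup E] [NormedSpace ℝ E]
    [FiniteDimensional ℝ E] {A : E →L[ℝ] E →L[ℝ] ℝ} (hA : Function.Injective A) :
    A.IsInvertible := by
  have hdim : finrank ℝ E = finrank ℝ (E →L[ℝ] ℝ) := by
    rw [← (LinearMap.toContinuousLinearMap (𝕜 := ℝ) (E := E) (F' := ℝ)).finrank_eq]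
    exact (Subspace.dual_finrank_eq (K := ℝ)).symm
  refine ⟨(LinearEquiv.ofInjectiveOfFinrankEq A.toLinearMap hA hdim).toContinuousLinearEquiv, ?_⟩
  ext a : 1
  rfl

section Webster

namespace PseudoHermitian

variable {m : ℕ} {M : Type*} [TopologicalSpace M]
  [ChartedSpace (EuclideanSpace ℝ (Fin (2 * m + 1))) M] [IsManifold (𝓡 (2 * m + 1)) ∞ M]
  (P : PseudoHermitian m M)

theorem projHor_apply (x : M) (v : TangentSpace (𝓡 (2 * m + 1)) x) :
    (P.projHor x v : TangentSpace (𝓡 (2 * m + 1)) x) = v - P.θ.toFun x v • P.reeb x :=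
  rfl

theorem webster_self_pos (x : M) (v : TangentSpace (𝓡 (2 * m + 1)) x) (hv : v ≠ 0) :
    0 < P.webster x v v := by
  simp only [webster, levi]
  by_cases h : P.projHor x v = 0
  · rw [h, map_zero]
    have h1 := P.projHor_apply x v
    rw [h, Submodule.coe_zero, eq_comm, sub_eq_zero] at h1
    have h2 : P.θ.toFun x v ≠ 0 := fun h3 ↦ hv (by rw [h1, h3, zero_smul])
    have h4 : P.θ.d x ((0 : P.hor x) : TangentSpace (𝓡 (2 * m + 1)) x)
      ((0 : P.hor x) : TangentSpace (𝓡 (2 * m + 1)) x) = 0 := by simp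
    rw [h4, add_zero]
    exact mul_self_pos.2 h2
  · exact add_pos_of_nonneg_of_pos (mul_self_nonneg _) (P.levi_pos x _ h)

theorem isBilinearMap_webster (x : M) :
    IsBilinearMap ℝ fun v w ↦ 1 / 2 * (P.webster x v w + P.webster x w v) where
  add_left u v w := by
    simp only [webster, levi, map_add, Submodule.coe_add, add_apply]
    ring
  smul_left c u v := by
    simp only [webster, levi, map_smul, Submodule.coe_smul, smul_apply, smul_eq_mul]
    ring
  add_right u v w := by
    simp only [webster, levi, map_add, Submodule.coe_add, add_apply]
    ring
  smul_right c u v := by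
    simp only [webster, levi, map_smul, Submodule.coe_smul, smul_apply, smul_eq_mul]
    ring

/-- The Webster metric as a field of continuous symmetric bilinear forms. (The Levi form is
symmetric by integrability; it is cheaper to symmetrize.) -/
def websterForm (x : M) :
    TangentSpace (𝓡 (2 * m + 1)) x →L[ℝ] TangentSpace (𝓡 (2 * m + 1)) x →L[ℝ] ℝ :=
  have : FiniteDimensional ℝ (TangentSpace (𝓡 (2 * m + 1)) x) :=
    inferInstanceAs (FiniteDimensional ℝ (EuclideanSpace ℝ (Fin (2 * m + 1))))
  have : T2Space (TangentSpace (𝓡 (2 * m + 1)) x) :=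
    inferInstanceAs (T2Space (EuclideanSpace ℝ (Fin (2 * m + 1))))
  (P.isBilinearMap_webster x).toContinuousBilinearMap

theorem websterForm_apply (x : M) (v w : TangentSpace (𝓡 (2 * m + 1)) x) :
    P.websterForm x v w = 1 / 2 * (P.webster x v w + P.webster x w v) :=
  rfl

theorem websterForm_self (x : M) (v : TangentSpace (𝓡 (2 * m + 1)) x) :
    P.webster x v v = P.websterForm x v v := by
  rw [websterForm_apply]
  ring

/-- The form `dθ + θ ⊗ θ` in the chart at `x₀`. -/
def reebOperator (x₀ : M) (z : EuclideanSpace ℝ (Fin (2 * m + 1))) :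
    EuclideanSpace ℝ (Fin (2 * m + 1)) →L[ℝ] EuclideanSpace ℝ (Fin (2 * m + 1)) →L[ℝ] ℝ :=
  P.θ.dCoord x₀ z + (P.θ.coord x₀ z).smulRight (P.θ.coord x₀ z)

theorem contDiffAt_reebOperator {x₀ : M} {z : EuclideanSpace ℝ (Fin (2 * m + 1))}
    (hz : z ∈ (extChartAt (𝓡 (2 * m + 1)) x₀).target) : ContDiffAt ℝ ∞ (P.reebOperator x₀) z :=
  (P.θ.contDiffAt_dCoord hz).add ((P.θ.contDiffAt_coord hz).smulRight (P.θ.contDiffAt_coord hz))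

theorem reebOperator_chartCoord {x₀ p : M} (hp : p ∈ (chartAt (EuclideanSpace ℝ (Fin (2 * m + 1))) x₀).source)
    (v w : TangentSpace (𝓡 (2 * m + 1)) p) :
    P.reebOperator x₀ (extChartAt (𝓡 (2 * m + 1)) x₀ p) (chartCoord x₀ p v) (chartCoord x₀ p w) =
      P.θ.d p v w + P.θ.toFun p v * P.θ.toFun p w := by
  rw [← P.θ.dCoord_chartCoord hp, ← P.θ.coord_chartCoord hp, ← P.θ.coord_chartCoord hp]
  rfl

theorem eq_zero_of_d_add (x : M) (v : TangentSpace (𝓡 (2 * m + 1)) x)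
    (h : ∀ w, P.θ.d x v w + P.θ.toFun x v * P.θ.toFun x w = 0) : v = 0 := by
  have h1 := h (P.reeb x)
  rw [P.θ.d_swap, P.d_reeb, P.θ_reeb, neg_zero, zero_add, mul_one] at h1
  have h2 : v ∈ P.hor x := by
    rw [← P.ker_θ x]
    exact h1
  by_contra hne
  have h3 := P.levi_pos x ⟨v, h2⟩ fun h0 ↦ hne (congrArg Subtype.val h0)
  have h4 := h (P.J x ⟨v, h2⟩)
  rw [h1, zero_mul, add_zero] at h4
  exact h3.ne' h4

theorem isInvertible_reebOperator {x₀ p : M}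
    (hp : p ∈ (chartAt (EuclideanSpace ℝ (Fin (2 * m + 1))) x₀).source) :
    (P.reebOperator x₀ (extChartAt (𝓡 (2 * m + 1)) x₀ p)).IsInvertible := by
  set A := P.reebOperator x₀ (extChartAt (𝓡 (2 * m + 1)) x₀ p) with hA
  have hinj : Function.Injective A := by
    rw [injective_iff_map_eq_zero]
    intro a ha
    have h1 : chartVec x₀ p a = 0 := P.eq_zero_of_d_add p _ fun w ↦ by
      rw [← P.reebOperator_chartCoord hp, chartCoord_chartVec hp]
      exact congrArg (fun f ↦ f (chartCoord x₀ p w)) ha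
    rw [← chartCoord_chartVec hp a, h1, map_zero]
  exact isInvertible_of_injective hinj

theorem chartCoord_reeb {x₀ p : M} (hp : p ∈ (chartAt (EuclideanSpace ℝ (Fin (2 * m + 1))) x₀).source) :
    chartCoord x₀ p (P.reeb p) = (P.reebOperator x₀ (extChartAt (𝓡 (2 * m + 1)) x₀ p)).inverse
      (P.θ.coord x₀ (extChartAt (𝓡 (2 * m + 1)) x₀ p)) := by
  have h1 : P.θ.coord x₀ (extChartAt (𝓡 (2 * m + 1)) x₀ p) =
      P.reebOperator x₀ (extChartAt (𝓡 (2 * m + 1)) x₀ p) (chartCoord x₀ p (P.reeb p)) := by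
    ext1 a
    rw [← chartCoord_chartVec hp a, P.reebOperator_chartCoord hp, P.d_reeb, P.θ_reeb, zero_add, one_mul,
      P.θ.coord_chartCoord hp]
  rw [h1, (P.isInvertible_reebOperator hp).inverse_apply_self]

theorem contMDiff_reeb : IsSmoothFieldOn univ P.reeb := by
  refine contMDiffOn_univ.2 fun p ↦ ?_
  have hp := mem_chart_source (EuclideanSpace ℝ (Fin (2 * m + 1))) p
  refine (contMDiffAt_iff_chartCoord (k := (⊤ : ℕ∞)) hp).2 ?_
  have hz := mem_extChartAt_target (I := 𝓡 (2 * m + 1)) p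
  have h1 : ContDiffAt ℝ ∞ (fun z ↦ (P.reebOperator p z).inverse (P.θ.coord p z))
      (extChartAt (𝓡 (2 * m + 1)) p p) :=
    ((P.isInvertible_reebOperator hp).contDiffAt_map_inverse.comp _
      (P.contDiffAt_reebOperator hz)).clm_apply (P.θ.contDiffAt_coord hz)
  refine (contMDiffAt_comp_extChartAt hp h1).congr_of_eventuallyEq ?_
  filter_upwards [chart_source_mem_nhds_of_mem hp] with q hq using P.chartCoord_reeb hq

variable {X Y : Π x : M, TangentSpace (𝓡 (2 * m + 1)) x}

theorem contMDiff_projHor (hX : IsSmoothFieldOn univ X) :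
    IsSmoothFieldOn univ (fun x ↦ (P.projHor x (X x) : TangentSpace (𝓡 (2 * m + 1)) x)) := by
  have h1 : ContMDiff (𝓡 (2 * m + 1)) 𝓘(ℝ, ℝ) ∞ (fun x ↦ P.θ.toFun x (X x)) := fun x ↦
    P.θ.contMDiffAt_apply (contMDiffOn_univ.1 hX x)
  exact contMDiffOn_univ.2 ((contMDiffOn_univ.1 hX).sub_section
    (h1.smul_section (contMDiffOn_univ.1 P.contMDiff_reeb)))

theorem contMDiff_J_projHor (hX : IsSmoothFieldOn univ X) :
    IsSmoothFieldOn univ (fun x ↦ (P.J x (P.projHor x (X x)) : TangentSpace (𝓡 (2 * m + 1)) x)) :=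
  P.J_smooth (fun x ↦ P.projHor x (X x)) (P.contMDiff_projHor hX)

theorem _root_.SmoothOneForm.contMDiff_d (θ : SmoothOneForm (𝓡 (2 * m + 1)) M)
    (hX : IsSmoothFieldOn univ X) (hY : IsSmoothFieldOn univ Y) :
    ContMDiff (𝓡 (2 * m + 1)) 𝓘(ℝ, ℝ) ∞ (fun x ↦ θ.d x (X x) (Y x)) := by
  intro p
  have hp := mem_chart_source (EuclideanSpace ℝ (Fin (2 * m + 1))) p
  have h1 := contMDiffAt_comp_extChartAt hp (θ.contDiffAt_dCoord (mem_extChartAt_target p))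
  have h2 := (contMDiffAt_iff_chartCoord (k := (⊤ : ℕ∞)) hp).1 (contMDiffOn_univ.1 hX p)
  have h3 := (contMDiffAt_iff_chartCoord (k := (⊤ : ℕ∞)) hp).1 (contMDiffOn_univ.1 hY p)
  refine ((h1.clm_apply h2).clm_apply h3).congr_of_eventuallyEq ?_
  filter_upwards [chart_source_mem_nhds_of_mem hp] with q hq using (θ.dCoord_chartCoord hq _ _).symm

theorem contMDiff_webster (hX : IsSmoothFieldOn univ X) (hY : IsSmoothFieldOn univ Y) :
    ContMDiff (𝓡 (2 * m + 1)) 𝓘(ℝ, ℝ) ∞ (fun x ↦ P.webster x (X x) (Y x)) := by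
  have h1 : ∀ X : Π x : M, TangentSpace (𝓡 (2 * m + 1)) x, IsSmoothFieldOn univ X →
      ContMDiff (𝓡 (2 * m + 1)) 𝓘(ℝ, ℝ) ∞ (fun x ↦ P.θ.toFun x (X x)) := fun X hX x ↦
    P.θ.contMDiffAt_apply (contMDiffOn_univ.1 hX x)
  exact ((h1 X hX).mul (h1 Y hY)).add
    (P.θ.contMDiff_d (P.contMDiff_projHor hX) (P.contMDiff_J_projHor hY))

theorem contMDiff_websterForm (hX : IsSmoothFieldOn univ X) (hY : IsSmoothFieldOn univ Y) :
    ContMDiff (𝓡 (2 * m + 1)) 𝓘(ℝ, ℝ) ∞ (fun x ↦ P.websterForm x (X x) (Y x)) :=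
  contMDiff_const.mul ((P.contMDiff_webster hX hY).add (P.contMDiff_webster hY hX))

variable [T2Space M]

theorem isSmoothMetric_websterForm : IsSmoothMetric P.websterForm :=
  isSmoothMetric_of_contMDiff
    (fun x v w ↦ by rw [websterForm_apply, websterForm_apply, add_comm])
    (fun x v hv ↦ by
      rw [← websterForm_self]
      exact P.webster_self_pos x v hv)
    fun X Y hX hY ↦ P.contMDiff_websterForm (contMDiffOn_univ.2 hX) (contMDiffOn_univ.2 hY)

theorem IsMetric.isParallelMetric {cov : CovariantDerivative (𝓡 (2 * m + 1))
    (EuclideanSpace ℝ (Fin (2 * m + 1))) (fun x : M ↦ TangentSpace (𝓡 (2 * m + 1)) x)}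
    (h : P.IsMetric cov) : IsParallelMetric P.websterForm cov := by
  refine P.isSmoothMetric_websterForm.isParallelMetric fun X Y hX hY p v ↦ ?_
  replace hX : IsSmoothFieldOn univ X := contMDiffOn_univ.2 hX
  replace hY : IsSmoothFieldOn univ Y := contMDiffOn_univ.2 hY
  have h1 := h X Y hX hY p v
  have h2 := h Y X hY hX p v
  have d1 := (P.contMDiff_webster hX hY p).mdifferentiableAt (by simp)
  have d2 := (P.contMDiff_webster hY hX p).mdifferentiableAt (by simp)
  have d3 : MDifferentiableAt (𝓡 (2 * m + 1)) 𝓘(ℝ, ℝ)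
      (fun q ↦ P.webster q (X q) (Y q) + P.webster q (Y q) (X q)) p :=
    d1.add d2
  have h3 : (fun q ↦ P.websterForm q (X q) (Y q)) =
      fun q ↦ (1 / 2 : ℝ) * (P.webster q (X q) (Y q) + P.webster q (Y q) (X q)) := rfl
  rw [h3, mvfderiv_fun_mul mdifferentiableAt_const d3, mvfderiv_const, mvfderiv_fun_add d1 d2]
  simp only [websterForm_apply]
  simp [h1, h2]
  ring

end PseudoHermitian

end Webster

end

theorem theorem2p5 (m : ℕ) (M : Type*) [TopologicalSpace M] [T2Space M]
    [ChartedSpace (EuclideanSpace ℝ (Fin (2 * m + 1))) M] [IsManifold (𝓡 (2 * m + 1)) ∞ M]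
    (P : PseudoHermitian m M)
    (nabla : CovariantDerivative (𝓡 (2 * m + 1)) (EuclideanSpace ℝ (Fin (2 * m + 1)))
      (fun x : M ↦ TangentSpace (𝓡 (2 * m + 1)) x))
    (hnabla : P.IsTanakaWebster nabla) :
    (IsCompleteDist (brokenGeodesicDist P.webster nabla) →
      GeodesicallyComplete nabla ∧ (geodesicExp nabla).Dom = Set.univ) ∧
    (∀ nablaLC : CovariantDerivative (𝓡 (2 * m + 1)) (EuclideanSpace ℝ (Fin (2 * m + 1)))
        (fun x : M ↦ TangentSpace (𝓡 (2 * m + 1)) x),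
      P.IsLeviCivita nablaLC → GeodesicallyComplete nablaLC → GeodesicallyComplete nabla) := by
  have hm := PseudoHermitian.IsMetric.isParallelMetric P hnabla.metric
  refine ⟨fun hδ ↦ ?_, fun nablaLC hLC hcomp ↦ ?_⟩
  · have h := geodesicsExtendForward_of_isCompleteDist hnabla.smooth P.isSmoothMetric_websterForm hm
      P.websterForm_self hδ
    exact ⟨h.geodesicallyComplete hnabla.smooth, h.geodesicExp_dom hnabla.smooth⟩
  · refine (geodesicsExtendForward_of_geodesicallyComplete hLC.smooth hnabla.smooth
      P.isSmoothMetric_websterForm (PseudoHermitian.IsMetric.isParallelMetric P hLC.metric) hm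
      (fun x₀ z hz a b ↦ christoffel_symm_of_torsion_eq_zero hLC.torsion_eq_zero hz a b)
      hcomp).geodesicallyComplete hnabla.smooth
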